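/- Theorem 4.1. A link is a non-empty finite union of pairwise disjoint simple closed curves in $\mathbb{R}^3$ that is tame (ambient isotopic to a union of disjoint simple closed polygons); links are considered up to ambient isotopy, and a knot is a link with one component. A link is split if it is ambient isotopic to a link that misses some plane and has components on both sides of it. A tile is a square with four possible connection points: for traditional tiles the midpoints of its edges, for corner connection tiles its corners. In either case there are eleven tiles: the blank tile; four tiles with one arc joining two neighbouring connection points; two tiles with one line joining two opposite connection points; two tiles with two disjoint arcs, each joining two neighbouring connection points; and two crossings, on which both lines are drawn, one passing over the other. A mosaic is an $n\times n$ array of tiles, for some $n$, in which every endpoint of a curve drawn on a tile touches an endpoint of a curve on another tile. It depicts a link $K$ if the curves drawn on its tiles form a diagram of $K$. Let $t(K)$ and $t_c(K)$ be the smallest number of non-blank tiles in a mosaic of any size that depicts $K$ and is made of traditional tiles, respectively of corner connection tiles. Then for every knot and for every non-split link $K$, both numbers are defined (mosaics of both kinds depicting $K$ exist) and $$t_c(K) < t(K).$$ -/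

import Mathlib

noncomputable section

namespace KnotMosaic

/-! ### Links in 3-space -/

/-- Euclidean 3-space. Only its structure of a topological real vector space is used. -/
abbrev Space : Type := Fin 3 → ℝ

/-- `K` can be deformed into `L` through space: there is an ambient isotopy `H` of 3-space
(a jointly continuous family of homeomorphisms starting at the identity) with `H 1 (K) = L`. -/
def AmbientIsotopic (K L : Set Space) : Prop :=
  ∃ H : unitInterval → (Space ≃ₜ Space),
    Continuous (fun p : unitInterval × Space => H p.1 p.2) ∧
    (∀ x, H 0 x = x) ∧ (fun x => H 1 x) '' K = L

/-- The closed polygon with the cyclically ordered vertices `v 0, …, v n`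
(`i + 1` is taken modulo `n + 1`). -/
def closedPolygon {n : ℕ} (v : Fin (n + 1) → Space) : Set Space :=
  ⋃ i, segment ℝ (v i) (v (i + 1))

/-- `C` is a simple closed polygon: running once around the polygon visits no point twice. -/
def IsSimpleClosedPolygon (C : Set Space) : Prop :=
  ∃ (n : ℕ) (v : Fin (n + 1) → Space),
    Function.Injective (fun p : Fin (n + 1) × Set.Ico (0 : ℝ) 1 =>
      (AffineMap.lineMap (v p.1) (v (p.1 + 1)) (p.2 : ℝ) : Space)) ∧
    C = closedPolygon v

/-- `P` is a disjoint union of `k` simple closed polygons. -/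
def IsPolygonalLink (k : ℕ) (P : Set Space) : Prop :=
  ∃ C : Fin k → Set Space, (∀ i, IsSimpleClosedPolygon (C i)) ∧
    Pairwise (fun i j => Disjoint (C i) (C j)) ∧ P = ⋃ i, C i

/-- `K` is a (tame) link with `k` components. -/
def IsLinkWith (k : ℕ) (K : Set Space) : Prop :=
  ∃ P, IsPolygonalLink k P ∧ AmbientIsotopic K P

/-- A (tame) link: at least one component. -/
def IsLink (K : Set Space) : Prop := ∃ k, 1 ≤ k ∧ IsLinkWith k K

/-- A (tame) knot: a link with exactly one component. -/
def IsKnot (K : Set Space) : Prop := IsLinkWith 1 K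

/-- `K` is split: it can be deformed so as to miss a plane `{x | f x = c}` and to have points,
hence components, on both sides of it. -/
def IsSplit (K : Set Space) : Prop :=
  ∃ L, AmbientIsotopic K L ∧ ∃ (f : Space →ₗ[ℝ] ℝ) (c : ℝ),
    (∀ x ∈ L, f x ≠ c) ∧ (∃ x ∈ L, f x < c) ∧ (∃ x ∈ L, c < f x)

/-! ### Tiles

A tile is a square with four possible connection points, numbered `0, 1, 2, 3` counterclockwise.
For traditional tiles these are the midpoints of the edges, for corner connection tiles the corners.
In both cases there are the same eleven ways to draw curves. -/

/-- The eleven tiles: the blank one, four with one arc between neighbouring connection points,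
two with one line between opposite connection points, two with two arcs, two crossings. -/
inductive Tile : Type
  | blank : Tile
  | arc (p : Fin 4) : Tile
  | line (b : Bool) : Tile
  | doubleArc (b : Bool) : Tile
  | crossing (b : Bool) : Tile
  deriving DecidableEq

/-- A curve on a tile, with its two ends; `upper` tells that it is the upper one at a crossing. -/
structure Strand : Type where
  src : Fin 4
  tgt : Fin 4
  upper : Bool

/-- The curves drawn on a tile. -/
def Tile.strands : Tile → List Strand
  | .blank => []
  | .arc p => [⟨p, p + 1, false⟩]
  | .line false => [⟨0, 2, false⟩]
  | .line true => [⟨1, 3, false⟩]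
  | .doubleArc false => [⟨0, 1, false⟩, ⟨2, 3, false⟩]
  | .doubleArc true => [⟨1, 2, false⟩, ⟨3, 0, false⟩]
  | .crossing b => [⟨0, 2, b⟩, ⟨1, 3, !b⟩]

/-- `p` is a connection point of the tile: an end of a curve drawn on it. -/
def Tile.HasEnd (T : Tile) (p : Fin 4) : Prop :=
  ∃ s ∈ T.strands, p = s.src ∨ p = s.tgt

/-! ### Mosaics

Tiles are squares of side `2`; the tile in row `i` and column `j` has its centre at `(2j, -2i)`,
so that rows are counted downwards. A placement `o : Fin 4 → ℤ × ℤ` gives the possible connection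
points relative to the centre. -/

/-- Right, top, left and bottom edge midpoints: traditional tiles. -/
def edgeMidpoints : Fin 4 → ℤ × ℤ := ![(1, 0), (0, 1), (-1, 0), (0, -1)]

/-- Upper right, upper left, lower left and lower right corners: corner connection tiles. -/
def corners : Fin 4 → ℤ × ℤ := ![(1, 1), (-1, 1), (-1, -1), (1, -1)]

/-- An `n × n` array of tiles. -/
abbrev TileArray (n : ℕ) : Type := Fin n × Fin n → Tile

/-- The centre of the tile in row `t.1` and column `t.2`. -/
def centre {n : ℕ} (t : Fin n × Fin n) : ℤ × ℤ := (2 * (t.2 : ℕ), -2 * (t.1 : ℕ))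

/-- The point `x` of the plane is a connection point of the tile at `t`. -/
def IsConnectionPoint (o : Fin 4 → ℤ × ℤ) {n : ℕ} (M : TileArray n) (t : Fin n × Fin n)
    (x : ℤ × ℤ) : Prop :=
  ∃ p, (M t).HasEnd p ∧ x = centre t + o p

/-- Each connection point of each tile touches a connection point of another tile. (With corner
tiles, arrays in which curves of more than two tiles meet at a corner are not excluded here, but
the set `curve o M` is then not a 1-manifold and represents no link.) -/
def IsMosaic (o : Fin 4 → ℤ × ℤ) {n : ℕ} (M : TileArray n) : Prop :=
  ∀ t x, IsConnectionPoint o M t x → ∃ s, s ≠ t ∧ IsConnectionPoint o M s x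

/-- The number of non-blank tiles. -/
def tileCount {n : ℕ} (M : TileArray n) : ℕ :=
  (Finset.univ.filter (fun t => M t ≠ Tile.blank)).card

/-- A curve on a tile with centre `c`, drawn in space: its ends lie at height `0`; from there it
runs straight to a middle point inside the tile, which is the centre of the tile for a line and
lies halfway between the centre and the midpoint of the ends for an arc. The middle of the upper
line of a crossing is lifted to height `1`. -/
def strandCurve (o : Fin 4 → ℤ × ℤ) (c : ℤ × ℤ) (s : Strand) : Set Space :=
  let P : Space := ![((c.1 + (o s.src).1 : ℤ) : ℝ), ((c.2 + (o s.src).2 : ℤ) : ℝ), 0]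
  let Q : Space := ![((c.1 + (o s.tgt).1 : ℤ) : ℝ), ((c.2 + (o s.tgt).2 : ℤ) : ℝ), 0]
  let W : Space :=
    ![(c.1 : ℝ) + (((o s.src).1 : ℝ) + ((o s.tgt).1 : ℝ)) / 4,
      (c.2 : ℝ) + (((o s.src).2 : ℝ) + ((o s.tgt).2 : ℝ)) / 4,
      if s.upper then 1 else 0]
  segment ℝ P W ∪ segment ℝ W Q

/-- The subset of 3-space depicted by an array of tiles. -/
def curve (o : Fin 4 → ℤ × ℤ) {n : ℕ} (M : TileArray n) : Set Space :=
  ⋃ t, ⋃ s ∈ (M t).strands, strandCurve o (centre t) s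

/-- The least number of non-blank tiles in a mosaic (of any size) depicting `K`;
it is `⊤` if no mosaic depicts `K`. -/
def tileNumber (o : Fin 4 → ℤ × ℤ) (K : Set Space) : ℕ∞ :=
  sInf {m : ℕ∞ | ∃ (n : ℕ) (M : TileArray n),
    IsMosaic o M ∧ AmbientIsotopic K (curve o M) ∧ m = (tileCount M : ℕ∞)}

/-- `t(K)`. -/
def traditionalTileNumber (K : Set Space) : ℕ∞ := tileNumber edgeMidpoints K

/-- `t_c(K)`. -/
def cornerTileNumber (K : Set Space) : ℕ∞ := tileNumber corners K

end KnotMosaic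

end

open Set Filter Topology
open scoped NNReal

noncomputable section

namespace KnotMosaic

section

/-! ### Ambient isotopy is an equivalence relation -/

/-! Two things are to be shown: traditional mosaics of a link exist, and a traditional mosaic of a
link can be traded for a corner connection mosaic with fewer tiles. Applying the second to a minimal
traditional mosaic gives the inequality.

The trade. Turn a traditional mosaic by 45 degrees and stretch it: the edge midpoints of each tile
become the corners of a square, so the same tiles form a corner connection mosaic. In this picture
only every second square of the new grid is occupied; the others lie around the vertices of the old
grid. In the highest non-blank row, the leftmost non-blank tile must be an arc from right to bottom;
it is followed by horizontal lines and then by an arc from left to bottom (`Closed.exists_topRun`).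
This run of `X₂ - X₁ + 1` tiles can be pushed down onto the lower boundary of its row
(`TopRun.ambientIsotopic`), where it becomes a straight segment that crosses only `X₂ - X₁` squares
around old vertices. One tile is saved (`TopRun.tileCount_lt`).

Existence. Corners of a polygonal link are cut until it turns by less than a right angle everywhere,
and the vertices are perturbed to have distinct coordinates. Each edge is divided into short pieces,
and each piece is replaced by three moves parallel to the axes (`CycEmb.exists_stair`). Along one
edge all coordinates progress monotonically; at each vertex some coordinate keeps its direction;
edges that are not neighbours stay far apart. Hence no intersections arise. Replacing two
coordinates by their ranks then gives paths through the squares of a grid that meet only in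
transversal crossings, and these are read off as tiles (`exists_mosaic_of_stair`).

All deformations of polygons rest on `ambientIsotopic_of_cycEmb`: vertices may be moved linearly as
long as the polygon stays simple. A small displacement of the vertices displaces the curve by a map
of Lipschitz constant less than `1`; such a map extends to space, and adding multiples of it to the
identity gives homeomorphisms. -/

theorem AmbientIsotopic.of_family {K L : Set Space} (F G : unitInterval → Space → Space)
    (hF : Continuous fun p : unitInterval × Space => F p.1 p.2) (hG : ∀ t, Continuous (G t))
    (hGF : ∀ t x, G t (F t x) = x) (hFG : ∀ t x, F t (G t x) = x) (h0 : ∀ x, F 0 x = x)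
    (h1 : F 1 '' K = L) : AmbientIsotopic K L :=
  ⟨fun t => { toFun := F t, invFun := G t, left_inv := hGF t, right_inv := hFG t,
              continuous_toFun := hF.comp (by fun_prop : Continuous fun x : Space => (t, x)),
              continuous_invFun := hG t }, hF, h0, h1⟩

theorem AmbientIsotopic.trans {K L M : Set Space} (h : AmbientIsotopic K L)
    (h' : AmbientIsotopic L M) : AmbientIsotopic K M := by
  obtain ⟨H, hc, h0, rfl⟩ := h
  obtain ⟨G, gc, g0, rfl⟩ := h'
  refine ⟨fun t => (H t).trans (G t), ?_, ?_, ?_⟩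
  · exact gc.comp (continuous_fst.prodMk hc)
  · intro x; simp [h0, g0]
  · rw [← image_comp]; rfl

/-- The inverses of a jointly continuous family of homeomorphisms are jointly continuous. -/
theorem continuous_family_symm {T : Type*} [TopologicalSpace T] (H : T → (Space ≃ₜ Space))
    (hc : Continuous fun p : T × Space => H p.1 p.2) :
    Continuous fun p : T × Space => (H p.1).symm p.2 := by
  rw [continuous_iff_continuousAt]
  rintro ⟨t₀, y₀⟩
  rw [ContinuousAt, Metric.nhds_basis_closedBall.tendsto_right_iff]
  intro ε hε
  set x₀ := (H t₀).symm y₀ with hx₀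
  have hy₀ : H t₀ x₀ = y₀ := by simp [hx₀]
  -- The sphere is compact, so for `t` near `t₀` its image misses a fixed ball around `y₀`. That
  -- ball is connected and contains the image of the centre `x₀`, hence it lies in the image of the
  -- open ball.
  set S := Metric.sphere x₀ ε
  have hScomp : IsCompact S := isCompact_sphere _ _
  have hne : y₀ ∉ H t₀ '' S := by
    rintro ⟨x, hx, hxy⟩
    rw [← hy₀] at hxy
    have := (H t₀).injective hxy
    subst this
    simp [S] at hx
    exact hε.ne hx
  have hclosed : IsClosed (H t₀ '' S) := (hScomp.image (H t₀).continuous).isClosed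
  obtain ⟨r, hr, hball⟩ := Metric.isOpen_iff.1 hclosed.isOpen_compl y₀ hne
  have hev1 : ∀ᶠ t in 𝓝 t₀, ∀ x ∈ S, H t x ∉ Metric.closedBall y₀ (r / 2) := by
    have hopen : IsOpen {p : T × Space | H p.1 p.2 ∉ Metric.closedBall y₀ (r / 2)} :=
      (Metric.isClosed_closedBall.preimage hc).isOpen_compl
    have := generalized_tube_lemma (s := {t₀}) isCompact_singleton (t := S) hScomp hopen (by
      rintro ⟨t, x⟩ ⟨ht, hx⟩
      simp only [mem_singleton_iff] at ht
      subst ht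
      intro h
      exact hball (Metric.closedBall_subset_ball (by linarith) h) ⟨x, hx, rfl⟩)
    obtain ⟨u, v, hu, hv, htu, hSv, huv⟩ := this
    filter_upwards [hu.mem_nhds (htu rfl)] with t ht x hx
    exact huv (mk_mem_prod ht (hSv hx))
  have hev2 : ∀ᶠ t in 𝓝 t₀, H t x₀ ∈ Metric.ball y₀ (r / 2) := by
    have : ContinuousAt (fun t => H t x₀) t₀ :=
      (hc.comp (by fun_prop : Continuous fun t : T => (t, x₀))).continuousAt
    exact this (by simpa [hy₀] using Metric.ball_mem_nhds y₀ (half_pos hr))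
  have hev3 : ∀ᶠ y in 𝓝 y₀, y ∈ Metric.ball y₀ (r / 2) := Metric.ball_mem_nhds _ (half_pos hr)
  filter_upwards [(hev1.and hev2).prod_nhds hev3]
  rintro ⟨t, y⟩ ⟨⟨h1, h2⟩, h3⟩
  have hconn : IsPreconnected (Metric.ball y₀ (r / 2)) := (convex_ball _ _).isPreconnected
  have hsub := hconn.subset_left_of_subset_union
    (u := H t '' Metric.ball x₀ ε) (v := H t '' (Metric.closedBall x₀ ε)ᶜ)
    ((H t).isOpenMap _ Metric.isOpen_ball)
    ((H t).isOpenMap _ Metric.isClosed_closedBall.isOpen_compl)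
    (by
      rw [disjoint_image_iff (H t).injective, disjoint_compl_right_iff_subset]
      exact Metric.ball_subset_closedBall)
    (by
      intro z hz
      obtain ⟨x, rfl⟩ := (H t).surjective z
      rcases lt_trichotomy (dist x x₀) ε with hlt | heq | hgt
      · exact Or.inl ⟨x, hlt, rfl⟩
      · exact absurd (Metric.ball_subset_closedBall hz) (h1 x heq)
      · exact Or.inr ⟨x, by simpa using hgt, rfl⟩)
    ⟨H t x₀, h2, ⟨x₀, Metric.mem_ball_self hε, rfl⟩⟩
  obtain ⟨x, hx, hxy⟩ := hsub h3
  have hx' : (H t).symm y = x := (Homeomorph.symm_apply_eq _).2 hxy.symm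
  change (H t).symm y ∈ _
  rw [hx']
  exact Metric.ball_subset_closedBall hx

theorem AmbientIsotopic.symm {K L : Set Space} (h : AmbientIsotopic K L) :
    AmbientIsotopic L K := by
  obtain ⟨H, hc, h0, rfl⟩ := h
  refine ⟨fun t => (H t).symm, continuous_family_symm H hc, fun x => ?_, ?_⟩
  · rw [Homeomorph.symm_apply_eq, h0]
  · rw [← image_comp]; simp

/-! ### Lipschitz displacements -/

/-- Every stage `x + t • b x` differs from the identity by a map of Lipschitz constant at most `c <
1`, so it is a homeomorphism of the whole space by the inverse function theorem for
`ApproximatesLinearOn`. -/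
theorem ambientIsotopic_add_lipschitz (b : Space → Space) {c : ℝ≥0} (hb : LipschitzWith c b)
    (hc : c < 1) (A : Set Space) : AmbientIsotopic A ((fun x => x + b x) '' A) := by
  have happ : ∀ t : unitInterval, ApproximatesLinearOn (fun x => x + (t : ℝ) • b x)
      ((ContinuousLinearEquiv.refl ℝ Space : Space ≃L[ℝ] Space) : Space →L[ℝ] Space) univ c := by
    intro t x _ y _
    have : x + (t : ℝ) • b x - (y + (t : ℝ) • b y) -
        ((ContinuousLinearEquiv.refl ℝ Space : Space ≃L[ℝ] Space) : Space →L[ℝ] Space) (x - y) =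
        (t : ℝ) • (b x - b y) := by
      simp only [ContinuousLinearEquiv.coe_coe, ContinuousLinearEquiv.refl_apply, smul_sub]
      abel
    rw [this, norm_smul, Real.norm_of_nonneg t.2.1]
    have h1 := hb.dist_le_mul x y
    rw [dist_eq_norm, dist_eq_norm] at h1
    calc (t : ℝ) * ‖b x - b y‖ ≤ 1 * ‖b x - b y‖ := by gcongr; exact t.2.2
      _ ≤ _ := by rwa [one_mul]
  have hN : c < ‖((ContinuousLinearEquiv.refl ℝ Space).symm : Space →L[ℝ] Space)‖₊⁻¹ := by
    have : ((ContinuousLinearEquiv.refl ℝ Space).symm : Space →L[ℝ] Space)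
      = ContinuousLinearMap.id ℝ Space := rfl
    rw [this, ContinuousLinearMap.nnnorm_id]
    simpa using hc
  refine ⟨fun t => (happ t).toHomeomorph _ (Or.inr hN), ?_, ?_, ?_⟩
  · change Continuous fun p : unitInterval × Space => p.2 + (p.1 : ℝ) • b p.2
    have := hb.continuous
    fun_prop
  · intro x
    change x + ((0 : unitInterval) : ℝ) • b x = x
    simp
  · change (fun x => x + ((1 : unitInterval) : ℝ) • b x) '' A = _
    simp

/-- A displacement of a set with Lipschitz constant less than `1` is an ambient isotopy. -/
theorem ambientIsotopic_of_lipschitzOn {A : Set Space} (f : Space → Space) {c : ℝ≥0}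
    (hf : LipschitzOnWith c (fun x => f x - x) A) (hc : c < 1) : AmbientIsotopic A (f '' A) := by
  -- The norm of `Space` is the maximum norm, so the displacement extends coordinate by coordinate
  -- without loss in the constant.
  obtain ⟨g, hg, hgf⟩ := hf.extend_pi
  have : f '' A = (fun x => x + g x) '' A := image_congr fun x hx => by simp [← hgf hx]
  rw [this]
  exact ambientIsotopic_add_lipschitz g hg hc A

/-! ### Closed polygons indexed by a finite cyclically ordered type -/

variable {V : Type*}

/-- The point at parameter `t` of the edge from `v a` to `v (next a)`. -/
def edgePoint (next : V → V) (v : V → Space) (a : V) (t : ℝ) : Space :=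
  v a + t • (v (next a) - v a)

/-- No point is visited twice. -/
def CycEmb (next : V → V) (v : V → Space) : Prop :=
  ∀ a b : V, ∀ t t' : ℝ, 0 ≤ t → t < 1 → 0 ≤ t' → t' < 1 →
    edgePoint next v a t = edgePoint next v b t' → a = b ∧ t = t'

/-- The map `next` may have several cycles, so one such curve can be a link with any number of
components. -/
def cycCurve (next : V → V) (v : V → Space) : Set Space :=
  ⋃ a, segment ℝ (v a) (v (next a))

theorem mem_cycCurve {next : V → V} {v : V → Space} {x : Space} :
    x ∈ cycCurve next v ↔ ∃ a t, 0 ≤ t ∧ t ≤ 1 ∧ x = edgePoint next v a t := by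
  simp only [cycCurve, mem_iUnion, segment_eq_image', mem_image, edgePoint, mem_Icc]
  exact exists_congr fun a => ⟨fun ⟨t, h, e⟩ => ⟨t, h.1, h.2, e.symm⟩,
    fun ⟨t, h1, h2, e⟩ => ⟨t, ⟨h1, h2⟩, e.symm⟩⟩

@[simp] theorem edgePoint_zero (next : V → V) (v : V → Space) (a : V) :
    edgePoint next v a 0 = v a := by simp [edgePoint]

@[simp] theorem edgePoint_one (next : V → V) (v : V → Space) (a : V) :
    edgePoint next v a 1 = v (next a) := by simp [edgePoint]

theorem edgePoint_sub (next : V → V) (v w : V → Space) (a : V) (t : ℝ) :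
    edgePoint next (v - w) a t = edgePoint next v a t - edgePoint next w a t := by
  simp only [edgePoint, Pi.sub_apply, smul_sub]; abel

/-- Two edges that do not follow each other are disjoint. -/
theorem CycEmb.disjoint {next : V → V} {v : V → Space} (h : CycEmb next v)
    (hn : Function.Injective next) {a b : V} (hab : a ≠ b) (h1 : next a ≠ b) (h2 : next b ≠ a)
    {t t' : ℝ} (ht0 : 0 ≤ t) (ht1 : t ≤ 1) (ht0' : 0 ≤ t') (ht1' : t' ≤ 1) :
    edgePoint next v a t ≠ edgePoint next v b t' := by
  intro e
  rcases ht1.lt_or_eq with l | rfl <;> rcases ht1'.lt_or_eq with l' | rfl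
  · exact hab (h _ _ _ _ ht0 l ht0' l' e).1
  · rw [edgePoint_one, ← edgePoint_zero next v (next b)] at e
    exact h2 (h _ _ _ _ ht0 l le_rfl one_pos e).1.symm
  · rw [edgePoint_one, ← edgePoint_zero next v (next a)] at e
    exact h1 (h _ _ _ _ le_rfl one_pos ht0' l' e).1
  · rw [edgePoint_one, edgePoint_one, ← edgePoint_zero next v (next a), ← edgePoint_zero next v (next b)] at e
    exact hab (hn (h _ _ _ _ le_rfl one_pos le_rfl one_pos e).1)

theorem CycEmb.vertex_injective {next : V → V} {v : V → Space} (h : CycEmb next v) :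
    Function.Injective v := fun a b e =>
  (h a b 0 0 le_rfl one_pos le_rfl one_pos (by simpa using e)).1

theorem CycEmb.next_ne {next : V → V} {v : V → Space} (h : CycEmb next v) (a : V) :
    next a ≠ a := fun e => by
  have := (h a a 0 (1 / 2) le_rfl one_pos (by norm_num) (by norm_num) (by simp [edgePoint, e])).2
  norm_num at this

theorem CycEmb.edge_ne_zero {next : V → V} {v : V → Space} (h : CycEmb next v) (a : V) :
    v (next a) - v a ≠ 0 := fun e => h.next_ne a (h.vertex_injective (sub_eq_zero.1 e))

/-! ### Displacements of the vertices control displacements of the curve -/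

theorem norm_edgePoint_le [Fintype V] (next : V → V) (u : V → Space) (a : V) {t : ℝ} (ht0 : 0 ≤ t)
    (ht1 : t ≤ 1) : ‖edgePoint next u a t‖ ≤ ‖u‖ := by
  have : edgePoint next u a t = (1 - t) • u a + t • u (next a) := by
    simp only [edgePoint]; module
  rw [this]
  calc _ ≤ ‖(1 - t) • u a‖ + ‖t • u (next a)‖ := norm_add_le _ _
    _ = (1 - t) * ‖u a‖ + t * ‖u (next a)‖ := by
      rw [norm_smul, norm_smul, Real.norm_of_nonneg ht0, Real.norm_of_nonneg (by linarith)]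
    _ ≤ (1 - t) * ‖u‖ + t * ‖u‖ := by
      gcongr
      · exact norm_le_pi_norm u _
      · exact norm_le_pi_norm u _
    _ = ‖u‖ := by ring

/-- Two vectors that are not opposite to each other span a salient cone. -/
theorem exists_le_norm_cone {E : Type*} [NormedAddCommGroup E] [NormedSpace ℝ E] (d e : E)
    (h : ∀ α β : ℝ, 0 ≤ α → 0 ≤ β → α • d + β • e = 0 → α = 0 ∧ β = 0) :
    ∃ C > 0, ∀ α β : ℝ, 0 ≤ α → 0 ≤ β → α + β ≤ C * ‖α • d + β • e‖ := by
  -- By homogeneity it is enough to bound the norm from below on the compact segment `α + β = 1`.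
  have hcont : ContinuousOn (fun α : ℝ => ‖α • d + (1 - α) • e‖) (Icc 0 1) := by fun_prop
  obtain ⟨α₀, hα₀, hmin⟩ := isCompact_Icc.exists_isMinOn ⟨0, by simp⟩ hcont
  have hpos : 0 < ‖α₀ • d + (1 - α₀) • e‖ := by
    rw [norm_pos_iff]
    intro h0
    have := h _ _ hα₀.1 (by linarith [hα₀.2]) h0
    linarith
  refine ⟨‖α₀ • d + (1 - α₀) • e‖⁻¹, inv_pos.2 hpos, fun α β hα hβ => ?_⟩
  rw [← div_eq_inv_mul, le_div_iff₀ hpos]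
  rcases (add_nonneg hα hβ).eq_or_lt with h0 | h0
  · rw [← h0]; simp
  · have := hmin (show α / (α + β) ∈ Icc (0 : ℝ) 1 from
      ⟨by positivity, by rw [div_le_one h0]; linarith⟩)
    simp only [mem_ofPred_eq] at this
    calc _ ≤ (α + β) * ‖(α / (α + β)) • d + (1 - α / (α + β)) • e‖ := by gcongr
      _ = ‖(α + β) • ((α / (α + β)) • d + (1 - α / (α + β)) • e)‖ := by
        rw [norm_smul, Real.norm_of_nonneg h0.le]
      _ = _ := by
        congr 1
        rw [smul_add, smul_smul, smul_smul]
        congr 2 <;> field_simp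
        ring

theorem norm_edge_le [Fintype V] (next : V → V) (u : V → Space) (b : V) :
    ‖u (next b) - u b‖ ≤ 2 * ‖u‖ :=
  (norm_sub_le _ _).trans (by linarith [norm_le_pi_norm u b, norm_le_pi_norm u (next b)])

/-- Seen from the common vertex, the difference of points on consecutive edges is, up to sign, a
combination of the two edge vectors with coefficients `1 - t` and `t'`, which are nonnegative on the
edges. -/
theorem edgePoint_sub_edgePoint_next (next : V → V) (u : V → Space) (a : V) (t t' : ℝ) :
    edgePoint next u a t - edgePoint next u (next a) t' =
      -((1 - t) • (u (next a) - u a) + t' • (u (next (next a)) - u (next a))) := by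
  simp only [edgePoint]; module

/-- Points near a common vertex are arbitrarily close, so no minimal distance is available. Instead,
both sides are compared with `(1 - t) + t'`: simplicity makes the cone of the two edge vectors
salient. -/
theorem CycEmb.exists_lipschitz_adjacent [Fintype V] {next : V → V} {v : V → Space}
    (h : CycEmb next v) (a : V) :
    ∃ C > 0, ∀ (u : V → Space) (t t' : ℝ), 0 ≤ t → t ≤ 1 → 0 ≤ t' → t' ≤ 1 →
      ‖edgePoint next u a t - edgePoint next u (next a) t'‖ ≤
        C * ‖u‖ * ‖edgePoint next v a t - edgePoint next v (next a) t'‖ := by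
  have hcone : ∀ α β : ℝ, 0 ≤ α → 0 ≤ β →
      α • (v (next a) - v a) + β • (v (next (next a)) - v (next a)) = 0 → α = 0 ∧ β = 0 := by
    intro α β hα hβ h0
    rcases (add_nonneg hα hβ).eq_or_lt with h1 | h1
    · constructor <;> linarith
    exfalso
    -- Dividing a relation between the edge vectors by `2 * (α + β)` brings its coefficients into
    -- `[0, 1/2]`. It then says that a point just before the vertex agrees with a point of the next
    -- edge.
    have hs : 0 < 2 * (α + β) := by linarith
    by_cases hα0 : α = 0
    · subst hα0
      rw [zero_smul, zero_add] at h0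
      rcases smul_eq_zero.1 h0 with h2 | h2
      · subst h2; simp at h1
      · exact h.edge_ne_zero _ h2
    have hα' : 0 < α := lt_of_le_of_ne hα (Ne.symm hα0)
    have hpos : 0 < α / (2 * (α + β)) := by positivity
    have := h a (next a) (1 - α / (2 * (α + β))) (β / (2 * (α + β)))
      (by rw [sub_nonneg, div_le_one hs]; linarith) (by linarith) (by positivity)
      (by rw [div_lt_one hs]; linarith)
      (by
        rw [← sub_eq_zero, edgePoint_sub_edgePoint_next, neg_eq_zero, sub_sub_cancel,
          div_eq_inv_mul, div_eq_inv_mul, mul_smul, mul_smul, ← smul_add, h0, smul_zero])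
    exact h.next_ne a this.1.symm
  obtain ⟨C, hC, hle⟩ := exists_le_norm_cone _ _ hcone
  refine ⟨2 * C, by positivity, fun u t t' h1 h2 h3 h4 => ?_⟩
  have h5 : 0 ≤ 1 - t := by linarith
  rw [edgePoint_sub_edgePoint_next, edgePoint_sub_edgePoint_next, norm_neg, norm_neg]
  have e1 : ‖(1 - t) • (u (next a) - u a)‖ ≤ (1 - t) * (2 * ‖u‖) := by
    rw [norm_smul, Real.norm_of_nonneg h5]
    exact mul_le_mul_of_nonneg_left (norm_edge_le next u a) h5
  have e2 : ‖t' • (u (next (next a)) - u (next a))‖ ≤ t' * (2 * ‖u‖) := by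
    rw [norm_smul, Real.norm_of_nonneg h3]
    exact mul_le_mul_of_nonneg_left (norm_edge_le next u (next a)) h3
  have e3 := mul_le_mul_of_nonneg_left (hle (1 - t) t' h5 h3)
    (by positivity : 0 ≤ 2 * ‖u‖)
  refine (norm_add_le _ _).trans ((add_le_add e1 e2).trans ?_)
  rw [← add_mul, mul_comm]
  exact e3.trans (le_of_eq (by ring))

theorem CycEmb.exists_lipschitz_same [Fintype V] {next : V → V} {v : V → Space}
    (h : CycEmb next v) (a : V) :
    ∃ C > 0, ∀ (u : V → Space) (t t' : ℝ),
      ‖edgePoint next u a t - edgePoint next u a t'‖ ≤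
        C * ‖u‖ * ‖edgePoint next v a t - edgePoint next v a t'‖ := by
  have hd := norm_pos_iff.2 (h.edge_ne_zero a)
  have key : ∀ (u : V → Space) (t t' : ℝ),
      edgePoint next u a t - edgePoint next u a t' = (t - t') • (u (next a) - u a) := by
    intro u t t'
    simp only [edgePoint]; module
  refine ⟨2 * ‖v (next a) - v a‖⁻¹, by positivity, fun u t t' => ?_⟩
  rw [key, key, norm_smul, norm_smul]
  refine (mul_le_mul_of_nonneg_left (norm_edge_le next u a) (norm_nonneg _)).trans (le_of_eq ?_)
  field_simp

/-- The least distance of two edges that do not follow each other is positive. -/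
theorem CycEmb.exists_dist_pos {next : V → V} {v : V → Space} (h : CycEmb next v)
    (hn : Function.Injective next) {a b : V} (hab : a ≠ b) (h1 : next a ≠ b) (h2 : next b ≠ a) :
    ∃ δ > 0, ∀ t t' : ℝ, 0 ≤ t → t ≤ 1 → 0 ≤ t' → t' ≤ 1 →
      δ ≤ ‖edgePoint next v a t - edgePoint next v b t'‖ := by
  have hcont : Continuous
      (fun p : ℝ × ℝ => ‖edgePoint next v a p.1 - edgePoint next v b p.2‖) := by
    unfold edgePoint; fun_prop
  obtain ⟨p, hp, hmin⟩ := ((isCompact_Icc (a := (0 : ℝ)) (b := 1)).prod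
    (isCompact_Icc (a := (0 : ℝ)) (b := 1))).exists_isMinOn ⟨(0, 0), by simp⟩ hcont.continuousOn
  rw [isMinOn_iff] at hmin
  have hne := h.disjoint hn hab h1 h2 hp.1.1 hp.1.2 hp.2.1 hp.2.2
  exact ⟨_, norm_pos_iff.2 (sub_ne_zero.2 hne),
    fun t t' h1 h2 h3 h4 => hmin (t, t') ⟨⟨h1, h2⟩, h3, h4⟩⟩

theorem CycEmb.exists_lipschitz_disjoint [Fintype V] {next : V → V} {v : V → Space}
    (h : CycEmb next v) (hn : Function.Injective next) {a b : V} (hab : a ≠ b)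
    (h1 : next a ≠ b) (h2 : next b ≠ a) :
    ∃ C > 0, ∀ (u : V → Space) (t t' : ℝ), 0 ≤ t → t ≤ 1 → 0 ≤ t' → t' ≤ 1 →
      ‖edgePoint next u a t - edgePoint next u b t'‖ ≤
        C * ‖u‖ * ‖edgePoint next v a t - edgePoint next v b t'‖ := by
  obtain ⟨δ, hδ, hle⟩ := h.exists_dist_pos hn hab h1 h2
  refine ⟨2 * δ⁻¹, by positivity, fun u t t' h1 h2 h3 h4 => ?_⟩
  have e1 : 1 ≤ δ⁻¹ * ‖edgePoint next v a t - edgePoint next v b t'‖ := by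
    rw [← div_eq_inv_mul, le_div_iff₀ hδ, one_mul]
    exact hle t t' h1 h2 h3 h4
  have e2 := mul_le_mul_of_nonneg_left e1 (by positivity : 0 ≤ 2 * ‖u‖)
  refine (norm_sub_le _ _).trans ?_
  linarith [norm_edgePoint_le next u a h1 h2, norm_edgePoint_le next u b h3 h4]

/-- Displacements of the vertices give Lipschitz displacements of the polygon. -/
theorem CycEmb.exists_lipschitz [Fintype V] {next : V → V} {v : V → Space} (h : CycEmb next v)
    (hn : Function.Injective next) :
    ∃ C > 0, ∀ (u : V → Space) (a b : V) (t t' : ℝ), 0 ≤ t → t ≤ 1 → 0 ≤ t' → t' ≤ 1 →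
      ‖edgePoint next u a t - edgePoint next u b t'‖ ≤
        C * ‖u‖ * ‖edgePoint next v a t - edgePoint next v b t'‖ := by
  have hs : ∀ a b : V, ∃ C > 0, ∀ (u : V → Space) (t t' : ℝ),
      0 ≤ t → t ≤ 1 → 0 ≤ t' → t' ≤ 1 → ‖edgePoint next u a t - edgePoint next u b t'‖ ≤
        C * ‖u‖ * ‖edgePoint next v a t - edgePoint next v b t'‖ := by
    intro a b
    by_cases hab : a = b
    · subst hab
      obtain ⟨C, hC, hle⟩ := h.exists_lipschitz_same a
      exact ⟨C, hC, fun u t t' _ _ _ _ => hle u t t'⟩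
    by_cases h1 : next a = b
    · subst h1; exact h.exists_lipschitz_adjacent a
    by_cases h2 : next b = a
    · subst h2
      obtain ⟨C, hC, hle⟩ := h.exists_lipschitz_adjacent b
      refine ⟨C, hC, fun u t t' h1 h2 h3 h4 => ?_⟩
      rw [norm_sub_rev, norm_sub_rev (edgePoint next v _ _)]
      exact hle u t' t h3 h4 h1 h2
    · exact h.exists_lipschitz_disjoint hn hab h1 h2
  choose C hC hle using hs
  have hnn : ∀ a, 0 ≤ ∑ b, C a b := fun a => Finset.sum_nonneg fun b _ => (hC a b).le
  have hnn' : 0 ≤ ∑ a, ∑ b, C a b := Finset.sum_nonneg fun a _ => hnn a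
  refine ⟨1 + ∑ a, ∑ b, C a b, by linarith, fun u a b t t' h1 h2 h3 h4 =>
    (hle a b u t t' h1 h2 h3 h4).trans ?_⟩
  have e1 : C a b ≤ ∑ b, C a b :=
    Finset.single_le_sum (f := fun b => C a b) (fun b _ => (hC a b).le) (Finset.mem_univ b)
  have e2 : ∑ b, C a b ≤ ∑ a, ∑ b, C a b :=
    Finset.single_le_sum (f := fun a => ∑ b, C a b) (fun a _ => hnn a) (Finset.mem_univ a)
  gcongr
  linarith

/-- Small displacements of the vertices of a simple polygon are ambient isotopies. -/
theorem CycEmb.exists_nhds [Fintype V] {next : V → V} {v : V → Space} (h : CycEmb next v)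
    (hn : Function.Injective next) :
    ∃ ε > 0, ∀ w : V → Space, ‖w - v‖ < ε →
      CycEmb next w ∧ AmbientIsotopic (cycCurve next v) (cycCurve next w) := by
  obtain ⟨C, hC, hle⟩ := h.exists_lipschitz hn
  -- With this bound the displacement has Lipschitz constant `1 / 2`.
  refine ⟨1 / (2 * C), by positivity, fun w hw => ?_⟩
  have hCw : C * ‖w - v‖ < 1 / 2 := by
    rw [lt_div_iff₀ (by positivity)] at hw
    linarith
  have hle' : ∀ (a b : V) (t t' : ℝ), 0 ≤ t → t ≤ 1 → 0 ≤ t' → t' ≤ 1 →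
      ‖edgePoint next (w - v) a t - edgePoint next (w - v) b t'‖ ≤
        1 / 2 * ‖edgePoint next v a t - edgePoint next v b t'‖ := fun a b t t' h1 h2 h3 h4 =>
    (hle (w - v) a b t t' h1 h2 h3 h4).trans (by gcongr)
  constructor
  · intro a b t t' h1 h2 h3 h4 e
    apply h a b t t' h1 h2 h3 h4
    have := hle' a b t t' h1 h2.le h3 h4.le
    rw [edgePoint_sub, edgePoint_sub, e, sub_sub_sub_cancel_left, norm_sub_rev] at this
    have h0 : ‖edgePoint next v a t - edgePoint next v b t'‖ = 0 := by
      have := norm_nonneg (edgePoint next v a t - edgePoint next v b t')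
      linarith
    exact sub_eq_zero.1 (norm_eq_zero.1 h0)
  · classical
    -- A vertex lies on two edges, so a point can have two parameters. One is chosen; `hle'` for two
    -- parameters of the same point has right side zero and shows that the choice does not matter.
    have hrep : ∀ x : Space, ∃ p : Option (V × ℝ), (x ∈ cycCurve next v → ∃ a t, p = some (a, t) ∧
        0 ≤ t ∧ t ≤ 1 ∧ x = edgePoint next v a t) := by
      intro x
      by_cases hx : x ∈ cycCurve next v
      · obtain ⟨a, t, h1, h2, h3⟩ := mem_cycCurve.1 hx
        exact ⟨some (a, t), fun _ => ⟨a, t, rfl, h1, h2, h3⟩⟩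
      · exact ⟨none, fun h => absurd h hx⟩
    choose rep hrep using hrep
    let f : Space → Space := fun x => (rep x).elim x fun p => edgePoint next w p.1 p.2
    have hf : ∀ a t, 0 ≤ t → t ≤ 1 → f (edgePoint next v a t) = edgePoint next w a t := by
      intro a t h1 h2
      obtain ⟨b, t', e, h3, h4, e'⟩ := hrep _ (mem_cycCurve.2 ⟨a, t, h1, h2, rfl⟩)
      have : f (edgePoint next v a t) = edgePoint next w b t' := by simp [f, e]
      rw [this]
      have := hle' a b t t' h1 h2 h3 h4
      rw [edgePoint_sub, edgePoint_sub, ← e', sub_self, norm_zero, mul_zero,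
        sub_sub_sub_cancel_right, norm_le_zero_iff, sub_eq_zero] at this
      exact this.symm
    have himg : cycCurve next w = f '' cycCurve next v := by
      ext x
      constructor
      · intro hx
        obtain ⟨a, t, h1, h2, rfl⟩ := mem_cycCurve.1 hx
        exact ⟨_, mem_cycCurve.2 ⟨a, t, h1, h2, rfl⟩, hf a t h1 h2⟩
      · rintro ⟨y, hy, rfl⟩
        obtain ⟨a, t, h1, h2, rfl⟩ := mem_cycCurve.1 hy
        exact mem_cycCurve.2 ⟨a, t, h1, h2, hf a t h1 h2⟩
    rw [himg]
    refine ambientIsotopic_of_lipschitzOn f (c := 1 / 2) ?_ (by norm_num)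
    refine LipschitzOnWith.of_dist_le_mul fun x hx y hy => ?_
    obtain ⟨a, t, h1, h2, rfl⟩ := mem_cycCurve.1 hx
    obtain ⟨b, t', h3, h4, rfl⟩ := mem_cycCurve.1 hy
    rw [hf a t h1 h2, hf b t' h3 h4, ← edgePoint_sub, ← edgePoint_sub, dist_eq_norm, dist_eq_norm]
    simpa using hle' a b t t' h1 h2 h3 h4

/-- A straight motion of the vertices through simple polygons is an ambient isotopy. -/
theorem ambientIsotopic_of_cycEmb [Fintype V] {next : V → V} (hn : Function.Injective next)
    (v w : V → Space)
    (h : ∀ s : ℝ, 0 ≤ s → s ≤ 1 → CycEmb next (fun a => (1 - s) • v a + s • w a)) :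
    AmbientIsotopic (cycCurve next v) (cycCurve next w) := by
  let γ : ℝ → V → Space := fun s a => (1 - s) • v a + s • w a
  have hγ : Continuous γ := by unfold γ; fun_prop
  have hpre : IsPreconnected (Icc (0 : ℝ) 1) := isPreconnected_Icc
  -- The isotopy class is locally constant during the motion by `CycEmb.exists_nhds`, hence constant
  -- on the connected interval.
  have hcl := hpre.induction₂
    (fun s t => AmbientIsotopic (cycCurve next (γ s)) (cycCurve next (γ t)))
    (by
      intro s hs
      obtain ⟨ε, hε, hball⟩ := (h s hs.1 hs.2).exists_nhds hn
      have : ∀ᶠ t in 𝓝 s, ‖γ t - γ s‖ < ε := by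
        have := hγ.continuousAt (x := s) (Metric.ball_mem_nhds (γ s) hε)
        filter_upwards [this] with t ht
        simpa [dist_eq_norm] using ht
      filter_upwards [mem_nhdsWithin_of_mem_nhds this] with t ht
      exact (hball (γ t) ht).2)
    (fun _ _ _ _ _ _ => AmbientIsotopic.trans) (fun _ _ _ _ => AmbientIsotopic.symm)
    (show (0 : ℝ) ∈ Icc (0 : ℝ) 1 by simp) (show (1 : ℝ) ∈ Icc (0 : ℝ) 1 by simp)
  simpa [γ] using hcl

end

section

/-! ### Subdivision -/

section Subdivision
variable {V : Type*} (N : V → ℕ) (hN : ∀ a, 0 < N a) (next : V → V)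

/-- The cyclic order in which the edge from `a` to `next a` is replaced by `N a` edges. -/
def subdivNext (x : Σ a, Fin (N a)) : Σ a, Fin (N a) :=
  if h : x.2.1 + 1 < N x.1 then ⟨x.1, ⟨x.2.1 + 1, h⟩⟩ else ⟨next x.1, ⟨0, hN _⟩⟩

theorem subdivNext_of_lt {a : V} {m : ℕ} (hm : m < N a) (h : m + 1 < N a) :
    subdivNext N hN next ⟨a, ⟨m, hm⟩⟩ = ⟨a, ⟨m + 1, h⟩⟩ := dif_pos h

theorem subdivNext_of_eq {a : V} {m : ℕ} (hm : m < N a) (h : m + 1 = N a) :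
    subdivNext N hN next ⟨a, ⟨m, hm⟩⟩ = ⟨next a, ⟨0, hN _⟩⟩ := dif_neg (by simp [h])

theorem subdivNext_injective (hn : Function.Injective next) :
    Function.Injective (subdivNext N hN next) := by
  rintro ⟨a, m, hm⟩ ⟨b, k, hk⟩ h
  simp only [subdivNext] at h
  split_ifs at h with h1 h2 h2
  · simp only [Sigma.mk.injEq] at h
    obtain ⟨rfl, h⟩ := h
    simpa using h
  · simp only [Sigma.mk.injEq] at h
    obtain ⟨rfl, h⟩ := h
    simp at h
  · simp only [Sigma.mk.injEq] at h
    obtain ⟨rfl, h⟩ := h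
    simp at h
  · simp only [Sigma.mk.injEq] at h
    obtain ⟨h, -⟩ := h
    obtain rfl := hn h
    have : m = k := by omega
    subst this
    rfl

/-- The list of points on an edge ends where the next list begins. So the successor's point is
always the next entry of the same list, also at the end of an edge. -/
theorem subdiv_next_apply {E : Type*} (P : V → ℕ → E) (hP : ∀ a, P a (N a) = P (next a) 0)
    (x : Σ a, Fin (N a)) :
    P (subdivNext N hN next x).1 (subdivNext N hN next x).2 = P x.1 (x.2 + 1) := by
  obtain ⟨a, m, hm⟩ := x
  by_cases h : m + 1 < N a
  · rw [subdivNext_of_lt N hN next hm h]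
  · have : m + 1 = N a := by omega
    rw [subdivNext_of_eq N hN next hm this, ← hP]
    exact congrArg (P a) this.symm

theorem edgePoint_subdiv (P : V → ℕ → Space) (hP : ∀ a, P a (N a) = P (next a) 0)
    (x : Σ a, Fin (N a)) (t : ℝ) :
    edgePoint (subdivNext N hN next) (fun y => P y.1 y.2) x t =
      P x.1 x.2 + t • (P x.1 (x.2 + 1) - P x.1 x.2) := by
  simp only [edgePoint, subdiv_next_apply N hN next P hP]

theorem cycCurve_subdiv (P : V → ℕ → Space) (hP : ∀ a, P a (N a) = P (next a) 0) :
    cycCurve (subdivNext N hN next) (fun y => P y.1 y.2) =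
      ⋃ a, ⋃ m, ⋃ _ : m < N a, segment ℝ (P a m) (P a (m + 1)) := by
  unfold cycCurve
  simp_rw [subdiv_next_apply N hN next P hP]
  ext x
  simp only [mem_iUnion]
  exact ⟨fun ⟨⟨a, m, hm⟩, h⟩ => ⟨a, m, hm, h⟩, fun ⟨a, m, hm, h⟩ => ⟨⟨a, m, hm⟩, h⟩⟩

end Subdivision

theorem segment_union_segment {E : Type*} [AddCommGroup E] [Module ℝ E] (x d : E) {b c : ℝ}
    (hb : 0 ≤ b) (hbc : b ≤ c) :
    segment ℝ x (x + b • d) ∪ segment ℝ (x + b • d) (x + c • d) = segment ℝ x (x + c • d) := by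
  have key : ∀ a b : ℝ, a ≤ b → segment ℝ (x + a • d) (x + b • d) = (fun t : ℝ => x + t • d) '' Icc a b := by
    intro a b hab
    rw [← segment_eq_Icc hab]
    have := image_segment ℝ (AffineMap.lineMap x (x + d) : ℝ →ᵃ[ℝ] E) a b
    simp only [AffineMap.lineMap_apply, vsub_eq_sub, add_sub_cancel_left, vadd_eq_add] at this
    rw [add_comm x, add_comm x, ← this]
    simp only [AffineMap.lineMap_apply, vsub_eq_sub, vadd_eq_add, add_comm x,
      add_sub_cancel_right]
  have h0 : segment ℝ x (x + b • d) = segment ℝ (x + (0 : ℝ) • d) (x + b • d) := by simp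
  have h0' : segment ℝ x (x + c • d) = segment ℝ (x + (0 : ℝ) • d) (x + c • d) := by simp
  rw [h0, h0', key _ _ hb, key _ _ hbc, key _ _ (hb.trans hbc), ← image_union,
    Icc_union_Icc_eq_Icc hb hbc]

theorem iUnion_segment_eq {E : Type*} [AddCommGroup E] [Module ℝ E] (x d : E) (c : ℕ → ℝ)
    (hc : Monotone c) (h0 : c 0 = 0) (n : ℕ) :
    ⋃ m, ⋃ _ : m < n + 1, segment ℝ (x + c m • d) (x + c (m + 1) • d) =
      segment ℝ x (x + c (n + 1) • d) := by
  induction n with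
  | zero => simp [h0]
  | succ n ih =>
    have hnn : 0 ≤ c (n + 1) := h0 ▸ hc (Nat.zero_le _)
    rw [← segment_union_segment x d hnn (hc (Nat.le_succ _)), ← ih]
    ext y
    simp only [mem_iUnion, mem_union, Nat.lt_succ_iff_lt_or_eq (n := n + 1), exists_prop, or_and_right, exists_or]
    simp

theorem cycCurve_linearSubdiv {V : Type*} (N : V → ℕ) (hN : ∀ a, 0 < N a) (next : V → V)
    (v : V → Space) (c : V → ℕ → ℝ) (hc : ∀ a, Monotone (c a)) (h0 : ∀ a, c a 0 = 0)
    (h1 : ∀ a, c a (N a) = 1) :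
    cycCurve (subdivNext N hN next) (fun y => edgePoint next v y.1 (c y.1 y.2)) =
      cycCurve next v := by
  rw [cycCurve_subdiv N hN next (fun a m => edgePoint next v a (c a m)) (by simp [h0, h1])]
  refine iUnion_congr fun a => ?_
  obtain ⟨n, hn⟩ : ∃ n, N a = n + 1 := ⟨N a - 1, by have := hN a; omega⟩
  simp only [edgePoint, hn]
  rw [iUnion_segment_eq _ _ _ (hc a) (h0 a), ← hn, h1]
  simp

/-! ### Polygonal links as cyclic polygons -/

/-- The vertices of all components are collected in one sigma type; disjointness of the components
turns into the injectivity across different cycles. -/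
theorem IsPolygonalLink.exists_cycEmb {k : ℕ} {P : Set Space} (h : IsPolygonalLink k P) :
    ∃ (V : Type) (_ : Fintype V) (next : V → V) (v : V → Space), Function.Injective next ∧
      CycEmb next v ∧ P = cycCurve next v ∧ (1 ≤ k → Nonempty V) := by
  obtain ⟨C, hC, hdisj, rfl⟩ := h
  choose n v hinj hpoly using hC
  let next : (Σ i : Fin k, Fin (n i + 1)) → Σ i : Fin k, Fin (n i + 1) :=
    fun x => ⟨x.1, x.2 + 1⟩
  have hline : ∀ x t, edgePoint next (fun y => v y.1 y.2) x t =
      AffineMap.lineMap (v x.1 x.2) (v x.1 (x.2 + 1)) t := by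
    intro x t
    simp [edgePoint, next, AffineMap.lineMap_apply, add_comm]
  have hmem : ∀ x t, 0 ≤ t → t < 1 → edgePoint next (fun y => v y.1 y.2) x t ∈ C x.1 := by
    intro x t h0 h1
    rw [hpoly, closedPolygon, hline, mem_iUnion]
    exact ⟨x.2, segment_eq_image_lineMap ℝ (v x.1 x.2) _ ▸ ⟨t, ⟨h0, h1.le⟩, rfl⟩⟩
  refine ⟨Σ i : Fin k, Fin (n i + 1), inferInstance, next, fun y => v y.1 y.2, ?_, ?_, ?_, ?_⟩
  · rintro ⟨i, m⟩ ⟨j, l⟩ h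
    simp only [next, Sigma.mk.injEq] at h
    obtain ⟨rfl, h⟩ := h
    simpa using h
  · rintro ⟨i, m⟩ ⟨j, l⟩ t t' h1 h2 h3 h4 e
    have hij : i = j := by
      by_contra hne
      exact (Set.disjoint_left.1 (hdisj hne)) (hmem ⟨i, m⟩ t h1 h2) (e ▸ hmem ⟨j, l⟩ t' h3 h4)
    subst hij
    rw [hline, hline] at e
    have := hinj i (a₁ := (m, ⟨t, h1, h2⟩)) (a₂ := (l, ⟨t', h3, h4⟩)) e
    simp only [Prod.mk.injEq] at this
    exact ⟨by rw [this.1], congrArg Subtype.val this.2⟩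
  · ext x
    simp only [mem_iUnion, cycCurve, hpoly, closedPolygon]
    exact ⟨fun ⟨i, m, h⟩ => ⟨⟨i, m⟩, h⟩, fun ⟨⟨i, m⟩, h⟩ => ⟨i, m, h⟩⟩
  · intro hk
    exact ⟨⟨⟨0, hk⟩, 0⟩⟩

/-! ### Generic perturbations -/

/-- Finitely many points can be moved slightly so that no two agree in any coordinate. -/
theorem exists_perturbation [Fintype V] (v : V → Space) {ε : ℝ} (hε : 0 < ε) :
    ∃ w : V → Space, ‖w - v‖ < ε ∧ ∀ j, Function.Injective fun a => w a j := by
  classical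
  let idx : V → ℕ := fun a => (Fintype.equivFin V a : ℕ)
  have hidx : Function.Injective idx := fun a b h =>
    (Fintype.equivFin V).injective (Fin.ext h)
  -- The `idx`-th point is moved by `η * idx` in all coordinates. A pair of points and a coordinate
  -- exclude one value of `η`; the diagonal only contributes the junk value `0 / 0 = 0`, which is
  -- not in the interval of candidates.
  let B : Set ℝ := ⋃ a, ⋃ b, ⋃ j : Fin 3, {-(v a j - v b j) / ((idx a : ℝ) - idx b)}
  have hB : B.Finite := by
    refine finite_iUnion fun a => finite_iUnion fun b => finite_iUnion fun j => finite_singleton _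
  set R : ℝ := Fintype.card V + 1
  have hR : 0 < R := by positivity
  obtain ⟨η, hη, hηB⟩ := (Ioo_infinite (show (0 : ℝ) < ε / R by positivity)).exists_notMem_finite hB
  refine ⟨fun a j => v a j + η * idx a, ?_, fun j a b h => ?_⟩
  · rw [pi_norm_lt_iff hε]
    intro a
    rw [pi_norm_lt_iff hε]
    intro j
    simp only [Pi.sub_apply, add_sub_cancel_left, Real.norm_eq_abs]
    rw [abs_of_nonneg (by have := hη.1; positivity)]
    have h1 : (idx a : ℝ) ≤ R := by
      have : idx a < Fintype.card V := (Fintype.equivFin V a).2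
      have : (idx a : ℝ) < Fintype.card V := by exact_mod_cast this
      simp only [R]; linarith
    calc η * idx a ≤ η * R := by gcongr; exact hη.1.le
      _ < ε := by rw [← lt_div_iff₀ hR]; exact hη.2
  · by_contra hab
    apply hηB
    simp only [B, mem_iUnion, mem_singleton_iff]
    refine ⟨a, b, j, ?_⟩
    have hne : (idx a : ℝ) - idx b ≠ 0 := sub_ne_zero.2 fun h => hab (hidx (by exact_mod_cast h))
    rw [eq_div_iff hne]
    simp only at h
    linarith

end

section

/-! ### Cutting corners -/

variable {V : Type*}

/-- Angles are needed here, so lengths and directions are taken with respect to the dot product,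
while the norm of `Space` is the maximum norm. -/
theorem exists_unit_smul {d : Space} (hd : d ≠ 0) :
    ∃ (l : ℝ) (u : Space), 0 < l ∧ u ⬝ᵥ u = 1 ∧ d = l • u := by
  have hpos : 0 < d ⬝ᵥ d := by
    have h0 : 0 ≤ d ⬝ᵥ d := by
      simp only [dotProduct]
      exact Finset.sum_nonneg fun i _ => mul_self_nonneg _
    exact lt_of_le_of_ne h0 fun h => hd (dotProduct_self_eq_zero.1 h.symm)
  refine ⟨√(d ⬝ᵥ d), (√(d ⬝ᵥ d))⁻¹ • d, Real.sqrt_pos.2 hpos, ?_, ?_⟩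
  · rw [smul_dotProduct, dotProduct_smul, smul_eq_mul, smul_eq_mul, ← mul_assoc, ← mul_inv,
      Real.mul_self_sqrt hpos.le, inv_mul_cancel₀ hpos.ne']
  · rw [smul_smul, mul_inv_cancel₀ (Real.sqrt_pos.2 hpos).ne', one_smul]

theorem norm_le_one_of_dotProduct_self {u : Space} (hu : u ⬝ᵥ u = 1) : ‖u‖ ≤ 1 := by
  rw [pi_norm_le_iff_of_nonneg zero_le_one]
  intro i
  have h1 : u i * u i ≤ u ⬝ᵥ u :=
    Finset.single_le_sum (f := fun i => u i * u i) (fun i _ => mul_self_nonneg _)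
      (Finset.mem_univ i)
  rw [Real.norm_eq_abs, ← sq_le_one_iff_abs_le_one, sq]
  linarith

theorem sq_eq_of_smul_eq {u w : Space} (hu : u ⬝ᵥ u = 1) (hw : w ⬝ᵥ w = 1) {a b : ℝ}
    (h : a • u = b • w) : a = b ∨ a = -b := by
  have : (a • u) ⬝ᵥ (a • u) = (b • w) ⬝ᵥ (b • w) := by rw [h]
  simp only [smul_dotProduct, dotProduct_smul, smul_eq_mul, hu, hw, mul_one] at this
  exact mul_self_eq_mul_self_iff.1 this

theorem one_add_dotProduct_pos {u w : Space} (hu : u ⬝ᵥ u = 1) (hw : w ⬝ᵥ w = 1)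
    (h : u ≠ -w) : 0 < 1 + u ⬝ᵥ w := by
  have h0 : 0 ≤ (u + w) ⬝ᵥ (u + w) := by
    simp only [dotProduct]
    exact Finset.sum_nonneg fun i _ => mul_self_nonneg _
  have hne : (u + w) ⬝ᵥ (u + w) ≠ 0 := fun h' =>
    h (eq_neg_of_add_eq_zero_left (dotProduct_self_eq_zero.1 h'))
  have : 0 < (u + w) ⬝ᵥ (u + w) := lt_of_le_of_ne h0 hne.symm
  rw [add_dotProduct, dotProduct_add, dotProduct_add, hu, hw, dotProduct_comm w u] at this
  linarith

/-- Consecutive edges of a simple polygon do not point in opposite directions. -/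
theorem CycEmb.direction_ne_neg {next : V → V} {v : V → Space} (h : CycEmb next v) {a : V}
    {l l' : ℝ} {u w : Space} (hl : 0 < l) (hl' : 0 < l') (hu : v (next a) - v a = l • u)
    (hw : v (next (next a)) - v (next a) = l' • w) : w ≠ -u := by
  rintro rfl
  -- With opposite directions, the point at distance `m` before the vertex would be visited again at
  -- distance `m` after it.
  set m := min l l' / 2 with hm
  have hm0 : 0 < m := by positivity
  have hml : m < l := by have := min_le_left l l'; linarith
  have hml' : m < l' := by have := min_le_right l l'; linarith
  have := h a (next a) (1 - m / l) (m / l') (by rw [sub_nonneg, div_le_one hl]; exact hml.le)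
    (by have : 0 < m / l := by positivity
        linarith) (by positivity) (by rwa [div_lt_one hl'])
    (by
      rw [← sub_eq_zero]
      have e : edgePoint next v a (1 - m / l) - edgePoint next v (next a) (m / l') =
          -((m / l) • (v (next a) - v a) + (m / l') • (v (next (next a)) - v (next a))) := by
        simp only [edgePoint]; module
      rw [e, hu, hw, smul_smul, smul_smul, div_mul_cancel₀ _ hl.ne', div_mul_cancel₀ _ hl'.ne']
      simp)
  exact h.next_ne a this.1.symm

/-- Vertices keep a distance from each other and from the edges that do not contain them. -/
theorem CycEmb.exists_separation [Fintype V] {next : V → V} {v : V → Space}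
    (h : CycEmb next v) :
    ∃ δ > 0, (∀ a b, a ≠ b → δ ≤ ‖v a - v b‖) ∧
      ∀ a b t, a ≠ b → a ≠ next b → 0 ≤ t → t ≤ 1 → δ ≤ ‖v a - edgePoint next v b t‖ := by
  classical
  have h1 : ∀ a b, ∃ δ > 0, ∀ t, a ≠ b → a ≠ next b → 0 ≤ t → t ≤ 1 →
      δ ≤ ‖v a - edgePoint next v b t‖ := by
    intro a b
    have hcont : Continuous (fun t : ℝ => ‖v a - edgePoint next v b t‖) := by
      unfold edgePoint; fun_prop
    obtain ⟨p, hp, hmin⟩ := (isCompact_Icc (a := (0 : ℝ)) (b := 1)).exists_isMinOn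
      ⟨0, by simp⟩ hcont.continuousOn
    rw [isMinOn_iff] at hmin
    by_cases hab : a ≠ b ∧ a ≠ next b
    · refine ⟨_, norm_pos_iff.2 (sub_ne_zero.2 fun e => ?_),
        fun t _ _ h1 h2 => hmin t ⟨h1, h2⟩⟩
      rw [← edgePoint_zero next v a] at e
      rcases hp.2.lt_or_eq with hlt | heq
      · exact hab.1 (h _ _ _ _ le_rfl one_pos hp.1 hlt e).1
      · rw [heq, edgePoint_one, ← edgePoint_zero next v (next b)] at e
        exact hab.2 (h _ _ _ _ le_rfl one_pos le_rfl one_pos e).1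
    · exact ⟨1, one_pos, fun t h1 h2 => absurd ⟨h1, h2⟩ hab⟩
  choose δ hδ hle using h1
  have h2 : ∃ δ' > 0, ∀ a b, a ≠ b → δ' ≤ ‖v a - v b‖ := by
    have : ∀ p : V × V, ∃ δ > 0, p.1 ≠ p.2 → δ ≤ ‖v p.1 - v p.2‖ := by
      intro p
      by_cases hp : p.1 = p.2
      · exact ⟨1, one_pos, fun h => absurd hp h⟩
      · exact ⟨_, norm_pos_iff.2 (sub_ne_zero.2 fun e => hp (h.vertex_injective e)), fun _ => le_rfl⟩
    choose f hf hfle using this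
    by_cases hV : Nonempty V
    · obtain ⟨p, hp⟩ := Finite.exists_min f
      exact ⟨f p, hf p, fun a b hab => (hp (a, b)).trans (hfle (a, b) hab)⟩
    · exact ⟨1, one_pos, fun a => absurd ⟨a⟩ hV⟩
  obtain ⟨δ', hδ', hle'⟩ := h2
  by_cases hV : Nonempty V
  · obtain ⟨p, hp⟩ := Finite.exists_min (fun p : V × V => δ p.1 p.2)
    refine ⟨min δ' (δ p.1 p.2), lt_min hδ' (hδ _ _), fun a b hab =>
      (min_le_left _ _).trans (hle' a b hab), fun a b t hab hab' h1 h2 =>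
      (min_le_right _ _).trans ((hp (a, b)).trans (hle a b t hab hab' h1 h2))⟩
  · exact ⟨1, one_pos, fun a => absurd ⟨a⟩ hV, fun a => absurd ⟨a⟩ hV⟩

/-- The direction changes by less than a right angle at each vertex. -/
def GentleTurns (next : V → V) (v : V → Space) : Prop :=
  ∀ a, 0 < (v (next a) - v a) ⬝ᵥ (v (next (next a)) - v (next a))

section CornerCut
variable (σ : Equiv.Perm V) (v : V → Space) (l : V → ℝ) (u : V → Space) (ε : ℝ)

/-- The vertices on the edge from `a`, with the corner at `a` partially cut off. -/
def cutPoint (s : ℝ) (a : V) : ℕ → Space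
  -- At `s = 0` this is the corner, at `s = 1` it is the midpoint of the segment that cuts the
  -- corner off.
  | 0 => v a + (s * ε / 2) • (u a - u (σ.symm a))
  | 1 => v a + ε • u a
  | 2 => v (σ a) - ε • u a
  | _ => v (σ a) + (s * ε / 2) • (u (σ a) - u a)

theorem cutPoint_closes (s : ℝ) (a : V) : cutPoint σ v u ε s a 3 = cutPoint σ v u ε s (σ a) 0 := by
  simp [cutPoint]

/-- The point near the corner at `c` with coordinates `α` and `β` along the outgoing and the
incoming edge. -/
def cornerPoint (c : V) (α β : ℝ) : Space := v c + α • u c - β • u (σ.symm c)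

/-- The position of a point of the polygon with cut corners: near a corner, on the outgoing or on
the incoming edge, or in the middle of an edge. -/
theorem cutPosition (hd : ∀ a, v (σ a) - v a = l a • u a) {s : ℝ} (hs0 : 0 ≤ s) (hs1 : s ≤ 1)
    (hε : 0 < ε) (x : Σ _ : V, Fin 3) {t : ℝ} (ht0 : 0 ≤ t) (ht1 : t < 1) :
    (∃ c α β, edgePoint (subdivNext (fun _ => 3) (fun _ => Nat.zero_lt_succ 2) σ)
        (fun y => cutPoint σ v u ε s y.1 y.2) x t = cornerPoint σ v u c α β ∧
        0 ≤ α ∧ 0 ≤ β ∧ α + β ≤ ε ∧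
        (x = ⟨c, 0⟩ ∧ α - β = t * ε ∨ x = ⟨σ.symm c, 2⟩ ∧ α - β = -(1 - t) * ε)) ∨
    ∃ a γ, edgePoint (subdivNext (fun _ => 3) (fun _ => Nat.zero_lt_succ 2) σ)
        (fun y => cutPoint σ v u ε s y.1 y.2) x t = v a + γ • u a ∧
        γ = ε + t * (l a - 2 * ε) ∧ x = ⟨a, 1⟩ := by
  rw [edgePoint_subdiv _ _ _ _ (cutPoint_closes σ v u ε s)]
  obtain ⟨a, m⟩ := x
  have hva : v (σ a) = v a + l a • u a := by rw [← hd]; abel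
  have h1t : 0 ≤ 1 - t := by linarith
  have hsε : s * ε ≤ ε := by nlinarith
  -- On the two pieces at a corner, `α - β` runs from `-ε` to `ε`; its value determines the piece
  -- and the parameter `t`.
  fin_cases m
  · left
    refine ⟨a, (1 - t) * (s * ε / 2) + t * ε, (1 - t) * (s * ε / 2), ?_, by positivity,
      by positivity, by nlinarith, Or.inl ⟨rfl, by ring⟩⟩
    simp only [cutPoint, cornerPoint]
    module
  · right
    refine ⟨a, _, ?_, rfl, rfl⟩
    simp only [cutPoint, hva]
    module
  · left
    refine ⟨σ a, t * (s * ε / 2), t * (s * ε / 2) + (1 - t) * ε, ?_, by positivity,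
      by positivity, by nlinarith, Or.inr ⟨by simp, by ring⟩⟩
    simp only [cutPoint, cornerPoint, Equiv.symm_apply_apply]
    module

/-- The equation compares multiples of two unit vectors, so the factors agree up to sign. Equal
factors give the claim; opposite nonzero factors would need opposite vectors. -/
theorem cornerPoint_inj (hu : ∀ a, u a ⬝ᵥ u a = 1) {c : V} (hne : u c ≠ -u (σ.symm c))
    {α β α' β' : ℝ} (h : cornerPoint σ v u c α β = cornerPoint σ v u c α' β') :
    α - β = α' - β' := by
  have e : (α - α') • u c = (β - β') • u (σ.symm c) := by
    unfold cornerPoint at h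
    have := sub_eq_zero.2 h
    rw [← sub_eq_zero]
    rw [← this]
    module
  rcases sq_eq_of_smul_eq (hu _) (hu _) e with h1 | h1
  · linarith
  · rw [h1, neg_smul, neg_eq_iff_eq_neg, ← smul_neg] at e
    have : (β - β') • (u c + u (σ.symm c)) = 0 := by
      rw [smul_add, e, smul_neg, neg_add_cancel]
    rcases smul_eq_zero.1 this with h2 | h2
    · rw [h2] at h1; linarith
    · exact absurd (eq_neg_of_add_eq_zero_left h2) hne

theorem norm_cornerPoint_sub_le (hu : ∀ a, u a ⬝ᵥ u a = 1) (c : V) {α β : ℝ} (hα : 0 ≤ α)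
    (hβ : 0 ≤ β) : ‖cornerPoint σ v u c α β - v c‖ ≤ α + β := by
  have e : cornerPoint σ v u c α β - v c = α • u c - β • u (σ.symm c) := by
    unfold cornerPoint; abel
  rw [e]
  refine (norm_sub_le _ _).trans ?_
  rw [norm_smul, norm_smul, Real.norm_of_nonneg hα, Real.norm_of_nonneg hβ]
  have h1 := norm_le_one_of_dotProduct_self (hu c)
  have h2 := norm_le_one_of_dotProduct_self (hu (σ.symm c))
  nlinarith

/-- If the corner is an end of the edge, the equation again compares multiples of unit vectors, and
the bounds on `α`, `β`, `γ` exclude both signs, the case of opposite vectors aside. Otherwise the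
corner has distance at least `δ > ε` from the edge. -/
theorem cornerPoint_ne_mid (hu : ∀ a, u a ⬝ᵥ u a = 1) (hd : ∀ a, v (σ a) - v a = l a • u a)
    {δ : ℝ} (hδ : ∀ a b t, a ≠ b → a ≠ σ b → 0 ≤ t → t ≤ 1 → δ ≤ ‖v a - edgePoint σ v b t‖)
    (hεδ : ε < δ) {a c : V} (hne : u c ≠ -u (σ.symm c)) (hl : 0 < l a) {α β γ : ℝ} (hα : 0 ≤ α)
    (hβ : 0 ≤ β) (hαβ : α + β ≤ ε) (hlt : α - β < ε) (hγ : ε ≤ γ) (hγ' : γ < l a - ε) :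
    cornerPoint σ v u c α β ≠ v a + γ • u a := by
  intro h
  by_cases hca : c = a
  · subst hca
    have e : (α - γ) • u c = β • u (σ.symm c) := by
      unfold cornerPoint at h
      have := sub_eq_zero.2 h
      rw [← sub_eq_zero, ← this]
      module
    rcases sq_eq_of_smul_eq (hu _) (hu _) e with h1 | h1
    · linarith
    · rw [h1, neg_smul, neg_eq_iff_eq_neg, ← smul_neg] at e
      have : β • (u c + u (σ.symm c)) = 0 := by
        rw [smul_add, e, smul_neg, neg_add_cancel]
      rcases smul_eq_zero.1 this with h2 | h2
      · linarith
      · exact absurd (eq_neg_of_add_eq_zero_left h2) hne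
  by_cases hca' : c = σ a
  · subst hca'
    have hva : v (σ a) = v a + l a • u a := by rw [← hd]; abel
    have e : α • u (σ a) = (β - (l a - γ)) • u a := by
      unfold cornerPoint at h
      rw [hva, Equiv.symm_apply_apply] at h
      have := sub_eq_zero.2 h
      rw [← sub_eq_zero, ← this]
      module
    rcases sq_eq_of_smul_eq (hu _) (hu _) e with h1 | h1 <;> linarith
  · have h1 := norm_cornerPoint_sub_le σ v u hu c hα hβ
    have h2 := hδ c a (γ / l a) hca hca' (by apply div_nonneg <;> linarith)
      (by rw [div_le_one hl]; linarith)
    have e : edgePoint σ v a (γ / l a) = cornerPoint σ v u c α β := by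
      rw [h, edgePoint, hd, smul_smul, div_mul_cancel₀ _ hl.ne']
    rw [e, norm_sub_rev] at h2
    linarith

theorem cycEmb_cut (hv : CycEmb σ v) (hu : ∀ a, u a ⬝ᵥ u a = 1) (hl : ∀ a, 0 < l a)
    (hd : ∀ a, v (σ a) - v a = l a • u a)
    {δ : ℝ} (hδ' : ∀ a b, a ≠ b → δ ≤ ‖v a - v b‖)
    (hδ : ∀ a b t, a ≠ b → a ≠ σ b → 0 ≤ t → t ≤ 1 → δ ≤ ‖v a - edgePoint σ v b t‖)
    (hε : 0 < ε) (hεδ : 2 * ε < δ) (hεl : ∀ a, 2 * ε < l a) {s : ℝ} (hs0 : 0 ≤ s) (hs1 : s ≤ 1) :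
    CycEmb (subdivNext (fun _ => 3) (fun _ => Nat.zero_lt_succ 2) σ)
      (fun y => cutPoint σ v u ε s y.1 y.2) := by
  have hne : ∀ c, u c ≠ -u (σ.symm c) := fun c => by
    refine hv.direction_ne_neg (hl (σ.symm c)) (hl c) (hd _) ?_
    rw [Equiv.apply_symm_apply, hd]
  intro x y t t' ht0 ht1 ht0' ht1' h
  have hγ : ∀ a t γ, 0 ≤ t → t < 1 → γ = ε + t * (l a - 2 * ε) → ε ≤ γ ∧ γ < l a - ε := by
    intro a t γ h0 h1 e
    have := hεl a
    constructor <;> nlinarith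
  have hlt : ∀ (c : V) (x : Σ _ : V, Fin 3) (t α β : ℝ), t < 1 →
      (x = ⟨c, 0⟩ ∧ α - β = t * ε ∨ x = ⟨σ.symm c, 2⟩ ∧ α - β = -(1 - t) * ε) → α - β < ε := by
    rintro c x t α β h1 (⟨-, e⟩ | ⟨-, e⟩) <;> nlinarith
  rcases cutPosition σ v l u ε hd hs0 hs1 hε x ht0 ht1 with
    ⟨c, α, β, e, hα, hβ, hαβ, hx⟩ | ⟨a, γ, e, eγ, hx⟩ <;>
  rcases cutPosition σ v l u ε hd hs0 hs1 hε y ht0' ht1' with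
    ⟨c', α', β', e', hα', hβ', hαβ', hy⟩ | ⟨a', γ', e', eγ', hy⟩ <;>
  rw [e, e'] at h
  · by_cases hcc : c = c'
    · subst hcc
      have := cornerPoint_inj σ v u hu (hne c) h
      rcases hx with ⟨hx, e1⟩ | ⟨hx, e1⟩ <;> rcases hy with ⟨hy, e2⟩ | ⟨hy, e2⟩
      · exact ⟨hx.trans hy.symm, mul_right_cancel₀ hε.ne' (by linarith)⟩
      · nlinarith
      · nlinarith
      · exact ⟨hx.trans hy.symm, mul_right_cancel₀ hε.ne' (by linarith)⟩
    -- Points near different corners are within `ε` of them, and the corners are more than `2 * ε`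
    -- apart.
    · have h1 := norm_cornerPoint_sub_le σ v u hu c hα hβ
      have h2 := norm_cornerPoint_sub_le σ v u hu c' hα' hβ'
      rw [h] at h1
      have h3 := norm_sub_le_norm_sub_add_norm_sub (v c) (cornerPoint σ v u c' α' β') (v c')
      rw [norm_sub_rev (v c) (cornerPoint σ v u c' α' β')] at h3
      linarith [hδ' c c' hcc]
  · obtain ⟨h1, h2⟩ := hγ a' t' γ' ht0' ht1' eγ'
    exact absurd h (cornerPoint_ne_mid σ v l u ε hu hd hδ (by linarith) (hne c) (hl _) hα hβ hαβ
      (hlt _ _ _ _ _ ht1 hx) h1 h2)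
  · obtain ⟨h1, h2⟩ := hγ a t γ ht0 ht1 eγ
    exact absurd h.symm (cornerPoint_ne_mid σ v l u ε hu hd hδ (by linarith) (hne c') (hl _) hα'
      hβ' hαβ' (hlt _ _ _ _ _ ht1' hy) h1 h2)
  · obtain ⟨h1, h2⟩ := hγ a t γ ht0 ht1 eγ
    obtain ⟨h3, h4⟩ := hγ a' t' γ' ht0' ht1' eγ'
    have key : ∀ a γ, v a + γ • u a = edgePoint σ v a (γ / l a) := fun a γ => by
      rw [edgePoint, hd, smul_smul, div_mul_cancel₀ _ (hl a).ne']
    rw [key, key] at h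
    have := hv _ _ _ _ (by apply div_nonneg <;> linarith)
      (by rw [div_lt_one (hl a)]; linarith) (by apply div_nonneg <;> linarith)
      (by rw [div_lt_one (hl a')]; linarith) h
    obtain ⟨rfl, h5⟩ := this
    rw [div_left_inj' (hl a).ne', eγ, eγ'] at h5
    have h6 : 0 < l a - 2 * ε := by linarith [hεl a]
    exact ⟨hx.trans hy.symm, mul_right_cancel₀ h6.ne' (by linarith)⟩

/-- The cut runs along the sum of the unit directions before and after the corner. Its dot product
with either of them is a positive multiple of `1 + u (σ a) ⬝ᵥ u a`, which is positive because the
directions are not opposite. At the midpoint of the cut the direction does not change. -/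
theorem gentleTurns_cut (hv : CycEmb σ v) (hu : ∀ a, u a ⬝ᵥ u a = 1) (hl : ∀ a, 0 < l a)
    (hd : ∀ a, v (σ a) - v a = l a • u a) (hε : 0 < ε) (hεl : ∀ a, 2 * ε < l a) :
    GentleTurns (subdivNext (fun _ => 3) (fun _ => Nat.zero_lt_succ 2) σ)
      (fun y => cutPoint σ v u ε 1 y.1 y.2) := by
  have hpos : ∀ a, 0 < 1 + u (σ a) ⬝ᵥ u a := fun a => by
    refine one_add_dotProduct_pos (hu _) (hu _) ?_
    exact hv.direction_ne_neg (hl a) (hl (σ a)) (hd _) (hd _)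
  have hstep := subdiv_next_apply (fun _ => 3) (fun _ => Nat.zero_lt_succ 2) σ
    (cutPoint σ v u ε 1) (cutPoint_closes σ v u ε 1)
  have e0 : ∀ a, cutPoint σ v u ε 1 a 1 - cutPoint σ v u ε 1 a 0 =
      (ε / 2) • (u a + u (σ.symm a)) := fun a => by simp only [cutPoint]; module
  have e1 : ∀ a, cutPoint σ v u ε 1 a 2 - cutPoint σ v u ε 1 a 1 = (l a - 2 * ε) • u a := fun a => by
    have hva : v (σ a) = v a + l a • u a := by rw [← hd]; abel
    simp only [cutPoint, hva]; module
  have e2 : ∀ a, cutPoint σ v u ε 1 a 3 - cutPoint σ v u ε 1 a 2 = (ε / 2) • (u (σ a) + u a) :=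
    fun a => by simp only [cutPoint]; module
  intro x
  beta_reduce
  rw [hstep (subdivNext _ _ _ x), hstep x]
  obtain ⟨a, m⟩ := x
  have h2ε := hεl a
  fin_cases m
  · change 0 < (cutPoint σ v u ε 1 a 1 - cutPoint σ v u ε 1 a 0) ⬝ᵥ
      (cutPoint σ v u ε 1 a 2 - cutPoint σ v u ε 1 a 1)
    obtain ⟨c, rfl⟩ := σ.surjective a
    rw [e0, e1, Equiv.symm_apply_apply, smul_dotProduct, dotProduct_smul, add_dotProduct, hu,
      dotProduct_comm]
    exact mul_pos (half_pos hε) (mul_pos (by linarith) (hpos c))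
  · change 0 < (cutPoint σ v u ε 1 a 2 - cutPoint σ v u ε 1 a 1) ⬝ᵥ
      (cutPoint σ v u ε 1 a 3 - cutPoint σ v u ε 1 a 2)
    rw [e1, e2, smul_dotProduct, dotProduct_smul, dotProduct_add, hu, add_comm, dotProduct_comm]
    exact mul_pos (by linarith) (mul_pos (half_pos hε) (hpos a))
  · change 0 < (cutPoint σ v u ε 1 a 3 - cutPoint σ v u ε 1 a 2) ⬝ᵥ
      (cutPoint σ v u ε 1 (σ a) 1 - cutPoint σ v u ε 1 a 3)
    rw [e2, cutPoint_closes, e0, Equiv.symm_apply_apply, smul_dotProduct, dotProduct_smul, add_dotProduct,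
      dotProduct_add, dotProduct_add, hu, hu, dotProduct_comm (u a)]
    have := hpos a
    exact mul_pos (half_pos hε) (mul_pos (half_pos hε) (by linarith))

end CornerCut

/-- Every simple polygon is isotopic to one that turns gently. -/
theorem CycEmb.exists_gentleTurns {V : Type} [Fintype V] {next : V → V} {v : V → Space}
    (h : CycEmb next v) (hn : Function.Injective next) :
    ∃ (W : Type) (_ : Fintype W) (next' : W → W) (w : W → Space), Function.Injective next' ∧
      CycEmb next' w ∧ GentleTurns next' w ∧
      AmbientIsotopic (cycCurve next v) (cycCurve next' w) ∧ (Nonempty V → Nonempty W) := by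
  obtain ⟨σ, rfl⟩ : ∃ σ : Equiv.Perm V, next = σ :=
    ⟨Equiv.ofBijective next (Finite.injective_iff_bijective.1 hn), rfl⟩
  choose l u hl hu hd using fun a => exists_unit_smul (h.edge_ne_zero a)
  obtain ⟨δ, hδ, hδ1, hδ2⟩ := h.exists_separation
  obtain ⟨m, hm, hml⟩ : ∃ m > 0, ∀ a, m ≤ l a := by
    by_cases hV : Nonempty V
    · obtain ⟨a, ha⟩ := Finite.exists_min l
      exact ⟨l a, hl a, ha⟩
    · exact ⟨1, one_pos, fun a => absurd ⟨a⟩ hV⟩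
  -- A third leaves `2 * ε < δ`, which separates the corners, and `2 * ε < l a`, which leaves a
  -- middle piece on each edge.
  set ε := min δ m / 3
  have hε : 0 < ε := by positivity
  have hεδ : 2 * ε < δ := by have := min_le_left δ m; simp only [ε]; linarith
  have hεl : ∀ a, 2 * ε < l a := fun a => by
    have := min_le_right δ m; have := hml a; simp only [ε] at hε ⊢; linarith
  have hemb := fun s hs0 hs1 => cycEmb_cut (s := s) σ v l u ε h hu hl hd hδ1 hδ2 hε hεδ hεl hs0 hs1
  refine ⟨Σ _ : V, Fin 3, inferInstance, subdivNext (fun _ => 3) (fun _ => Nat.zero_lt_succ 2) σ,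
    fun y => cutPoint σ v u ε 1 y.1 y.2, subdivNext_injective _ _ _ hn,
    hemb 1 zero_le_one le_rfl, gentleTurns_cut σ v l u ε h hu hl hd hε hεl, ?_,
    fun ⟨a⟩ => ⟨⟨a, 0⟩⟩⟩
  have hiso := ambientIsotopic_of_cycEmb (subdivNext_injective (fun _ => 3)
    (fun _ => Nat.zero_lt_succ 2) _ hn) (fun y => cutPoint σ v u ε 0 y.1 y.2)
    (fun y => cutPoint σ v u ε 1 y.1 y.2) (fun s hs0 hs1 => by
      convert hemb s hs0 hs1 using 1
      funext ⟨a, m⟩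
      fin_cases m <;> simp only [cutPoint] <;> module)
  -- At `s = 0` nothing is cut off: the polygon is the old one with each edge subdivided at the
  -- lengths `ε` and `l a - ε`.
  convert hiso using 1
  rw [cycCurve_subdiv _ _ _ _ (cutPoint_closes σ v u ε 0)]
  refine iUnion_congr fun a => ?_
  have key := iUnion_segment_eq (v a) (u a)
    (fun m => if m = 0 then 0 else if m = 1 then ε else if m = 2 then l a - ε else l a)
    (by
      have := hεl a
      refine monotone_nat_of_le_succ fun n => ?_
      rcases n with _ | _ | _ | n <;> simp <;> linarith) (by simp) 2
  have hva : v (σ a) = v a + l a • u a := by rw [← hd]; abel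
  rw [hva]
  simp only [Nat.reduceAdd, OfNat.ofNat_ne_zero, OfNat.ofNat_ne_one, if_false,
    show (3 : ℕ) ≠ 2 by norm_num] at key
  rw [← key]
  refine iUnion_congr fun m => iUnion_congr fun hm => ?_
  have : m = 0 ∨ m = 1 ∨ m = 2 := by omega
  rcases this with rfl | rfl | rfl
  · simp [cutPoint]
  · simp only [cutPoint, hva]
    congr 1
    all_goals (simp; module)
  · simp only [cutPoint, hva]
    congr 1
    · simp; module
    · simp

end

section

/-! ### Staircases -/

variable {V : Type*}

/-- The path from `w a` to `w (next a)` that moves in the first coordinate, then in the third and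
by `e a` in the second, then in the second coordinate. -/
def stairPoint (next : V → V) (w : V → Space) (e : V → ℝ) (a : V) : ℕ → Space
  | 0 => w a
  | 1 => ![w (next a) 0, w a 1, w a 2]
  -- For `e a = 0` the middle edge is vertical. A nonzero `e a` tilts it, so that it has the
  -- horizontal extent needed when the path is drawn on tiles.
  | 2 => ![w (next a) 0, w a 1 + e a, w (next a) 2]
  | _ => w (next a)

/-- The cyclic order in which each edge is replaced by three edges. -/
abbrev next3 (next : V → V) : (Σ _ : V, Fin 3) → Σ _ : V, Fin 3 :=
  subdivNext (fun _ => 3) (fun _ => Nat.zero_lt_succ 2) next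

abbrev stair (next : V → V) (w : V → Space) (e : V → ℝ) : (Σ _ : V, Fin 3) → Space :=
  fun y => stairPoint next w e y.1 y.2

theorem stairPoint_closes (next : V → V) (w : V → Space) (e : V → ℝ) (a : V) :
    stairPoint next w e a 3 = stairPoint next w e (next a) 0 := rfl

theorem edgePoint_stair (next : V → V) (w : V → Space) (e : V → ℝ) (x : Σ _ : V, Fin 3) (t : ℝ) :
    edgePoint (next3 next) (stair next w e) x t = stairPoint next w e x.1 x.2 +
      t • (stairPoint next w e x.1 (x.2 + 1) - stairPoint next w e x.1 x.2) :=
  edgePoint_subdiv _ _ _ _ (stairPoint_closes next w e) x t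

theorem edgePoint_stair_zero (next : V → V) (w : V → Space) (e : V → ℝ) (a : V) (t : ℝ) :
    edgePoint (next3 next) (stair next w e) ⟨a, 0⟩ t 0 = w a 0 + t * (w (next a) 0 - w a 0) ∧
    edgePoint (next3 next) (stair next w e) ⟨a, 0⟩ t 1 = w a 1 ∧
    edgePoint (next3 next) (stair next w e) ⟨a, 0⟩ t 2 = w a 2 := by
  rw [edgePoint_stair]
  refine ⟨rfl, ?_, ?_⟩
  · change w a 1 + t * (w a 1 - w a 1) = _; ring
  · change w a 2 + t * (w a 2 - w a 2) = _; ring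

theorem edgePoint_stair_one (next : V → V) (w : V → Space) (e : V → ℝ) (a : V) (t : ℝ) :
    edgePoint (next3 next) (stair next w e) ⟨a, 1⟩ t 0 = w (next a) 0 ∧
    edgePoint (next3 next) (stair next w e) ⟨a, 1⟩ t 1 = w a 1 + t * e a ∧
    edgePoint (next3 next) (stair next w e) ⟨a, 1⟩ t 2 = w a 2 + t * (w (next a) 2 - w a 2) := by
  rw [edgePoint_stair]
  refine ⟨?_, ?_, rfl⟩
  · change w (next a) 0 + t * (w (next a) 0 - w (next a) 0) = _; ring
  · change w a 1 + t * (w a 1 + e a - w a 1) = _; ring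

theorem edgePoint_stair_two (next : V → V) (w : V → Space) (e : V → ℝ) (a : V) (t : ℝ) :
    edgePoint (next3 next) (stair next w e) ⟨a, 2⟩ t 0 = w (next a) 0 ∧
    edgePoint (next3 next) (stair next w e) ⟨a, 2⟩ t 1 =
      w a 1 + e a + t * (w (next a) 1 - (w a 1 + e a)) ∧
    edgePoint (next3 next) (stair next w e) ⟨a, 2⟩ t 2 = w (next a) 2 := by
  rw [edgePoint_stair]
  refine ⟨?_, rfl, ?_⟩
  · change w (next a) 0 + t * (w (next a) 0 - w (next a) 0) = _; ring
  · change w (next a) 2 + t * (w (next a) 2 - w (next a) 2) = _; ring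

theorem space_ext {p q : Space} (h0 : p 0 = q 0) (h1 : p 1 = q 1) (h2 : p 2 = q 2) : p = q := by
  funext j; fin_cases j <;> assumption

/-- A staircase over points with distinct coordinates visits no point twice. -/
theorem cycEmb_stair {next : V → V} (hn : Function.Injective next) (hne : ∀ a, next a ≠ a)
    {w : V → Space} (hw : ∀ j, Function.Injective fun a => w a j) {e : V → ℝ}
    (he : ∀ a b, a ≠ b → |e b| < |w a 1 - w b 1|) : CycEmb (next3 next) (stair next w e) := by
  have hx : ∀ a b, w a 0 = w b 0 → a = b := fun a b h => hw 0 h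
  have hz : ∀ a b, w a 2 = w b 2 → a = b := fun a b h => hw 2 h
  have hx' : ∀ a, w (next a) 0 - w a 0 ≠ 0 := fun a h => hne a (hx _ _ (sub_eq_zero.1 h))
  have hz' : ∀ a, w (next a) 2 - w a 2 ≠ 0 := fun a h => hne a (hz _ _ (sub_eq_zero.1 h))
  have hy' : ∀ a, w (next a) 1 - (w a 1 + e a) ≠ 0 := fun a h => by
    have := he (next a) a (hne a)
    rw [show w (next a) 1 - w a 1 = e a by linarith] at this
    exact this.ne rfl
  -- The tilt of one staircase is too small to reach the row of another one.
  have hy : ∀ a b t, 0 ≤ t → t < 1 → w a 1 = w b 1 + t * e b → a = b := fun a b t h0 h1 h => by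
    by_contra hab
    have := he a b hab
    rw [show w a 1 - w b 1 = t * e b by linarith, abs_mul, abs_of_nonneg h0] at this
    nlinarith [abs_nonneg (e b)]
  -- The first edge lies at the height and in the row of `a`; the other two lie in the plane given
  -- by the first coordinate of `next a`, and the third at the height of `next a`. Distinct
  -- coordinates thus identify the staircase; a meeting of different edges of it could only occur at
  -- an excluded end.
  have h01 : ∀ a b t t', 0 ≤ t → t < 1 → 0 ≤ t' → t' < 1 →
      edgePoint (next3 next) (stair next w e) ⟨a, 0⟩ t ≠
        edgePoint (next3 next) (stair next w e) ⟨b, 1⟩ t' := fun a b t t' h0 h1 h0' h1' h => by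
    obtain ⟨p0, p1, p2⟩ := edgePoint_stair_zero next w e a t
    obtain ⟨q0, q1, q2⟩ := edgePoint_stair_one next w e b t'
    rw [h] at p0 p1 p2
    obtain rfl := hy a b t' h0' h1' (by linarith)
    have : (t - 1) * (w (next a) 0 - w a 0) = 0 := by linarith
    rcases mul_eq_zero.1 this with h | h
    · linarith
    · exact hx' _ h
  have h12 : ∀ a b t t', 0 ≤ t → t < 1 → 0 ≤ t' → t' < 1 →
      edgePoint (next3 next) (stair next w e) ⟨a, 1⟩ t ≠
        edgePoint (next3 next) (stair next w e) ⟨b, 2⟩ t' := fun a b t t' h0 h1 h0' h1' h => by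
    obtain ⟨p0, p1, p2⟩ := edgePoint_stair_one next w e a t
    obtain ⟨q0, q1, q2⟩ := edgePoint_stair_two next w e b t'
    rw [h] at p0 p1 p2
    obtain rfl := hn (hx (next a) (next b) (by linarith))
    have : (t - 1) * (w (next a) 2 - w a 2) = 0 := by linarith
    rcases mul_eq_zero.1 this with h | h
    · linarith
    · exact hz' _ h
  have h02 : ∀ a b t t', 0 ≤ t → t < 1 → 0 ≤ t' → t' < 1 →
      edgePoint (next3 next) (stair next w e) ⟨a, 0⟩ t ≠
        edgePoint (next3 next) (stair next w e) ⟨b, 2⟩ t' := fun a b t t' h0 h1 h0' h1' h => by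
    obtain ⟨p0, p1, p2⟩ := edgePoint_stair_zero next w e a t
    obtain ⟨q0, q1, q2⟩ := edgePoint_stair_two next w e b t'
    rw [h] at p0 p1 p2
    obtain rfl := hz a (next b) (by linarith)
    have : (t' - 1) * (w (next b) 1 - (w b 1 + e b)) = 0 := by linarith
    rcases mul_eq_zero.1 this with h | h
    · linarith
    · exact hy' _ h
  rintro ⟨a, r⟩ ⟨b, r'⟩ t t' h0 h1 h0' h1' h
  fin_cases r <;> fin_cases r'
  · obtain ⟨p0, p1, p2⟩ := edgePoint_stair_zero next w e a t
    obtain ⟨q0, q1, q2⟩ := edgePoint_stair_zero next w e b t'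
    change edgePoint (next3 next) (stair next w e) ⟨a, 0⟩ t =
        edgePoint (next3 next) (stair next w e) ⟨b, 0⟩ t' at h
    rw [h] at p0 p1 p2
    obtain rfl := hz a b (by linarith)
    exact ⟨rfl, mul_right_cancel₀ (hx' a) (by linarith)⟩
  · exact absurd h (h01 a b t t' h0 h1 h0' h1')
  · exact absurd h (h02 a b t t' h0 h1 h0' h1')
  · exact absurd h.symm (h01 b a t' t h0' h1' h0 h1)
  · obtain ⟨p0, p1, p2⟩ := edgePoint_stair_one next w e a t
    obtain ⟨q0, q1, q2⟩ := edgePoint_stair_one next w e b t'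
    change edgePoint (next3 next) (stair next w e) ⟨a, 1⟩ t =
        edgePoint (next3 next) (stair next w e) ⟨b, 1⟩ t' at h
    rw [h] at p0 p1 p2
    obtain rfl := hn (hx (next a) (next b) (by linarith))
    exact ⟨rfl, mul_right_cancel₀ (hz' a) (by linarith)⟩
  · exact absurd h (h12 a b t t' h0 h1 h0' h1')
  · exact absurd h.symm (h02 b a t' t h0' h1' h0 h1)
  · exact absurd h.symm (h12 b a t' t h0' h1' h0 h1)
  · obtain ⟨p0, p1, p2⟩ := edgePoint_stair_two next w e a t
    obtain ⟨q0, q1, q2⟩ := edgePoint_stair_two next w e b t'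
    change edgePoint (next3 next) (stair next w e) ⟨a, 2⟩ t =
        edgePoint (next3 next) (stair next w e) ⟨b, 2⟩ t' at h
    rw [h] at p0 p1 p2
    obtain rfl := hn (hx (next a) (next b) (by linarith))
    exact ⟨rfl, mul_right_cancel₀ (hy' a) (by linarith)⟩

/-- Staircases depend affinely on vertices and tilts, so every stage of a straight motion is a
staircase and `cycEmb_stair` applies to it. -/
theorem interpolate_stair (next : V → V) (w w' : V → Space) (e e' : V → ℝ) (s : ℝ) :
    (fun y => (1 - s) • stair next w e y + s • stair next w' e' y) =
      stair next (fun a => (1 - s) • w a + s • w' a) (fun a => (1 - s) * e a + s * e' a) := by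
  funext ⟨a, r⟩
  fin_cases r
  · rfl
  · exact space_ext rfl rfl rfl
  · refine space_ext rfl ?_ rfl
    change (1 - s) * (w a 1 + e a) + s * (w' a 1 + e' a) =
      (1 - s) * w a 1 + s * w' a 1 + ((1 - s) * e a + s * e' a)
    ring

theorem norm_stair_sub_le [Fintype V] (next : V → V) (w w' : V → Space) :
    ‖stair next w' 0 - stair next w 0‖ ≤ ‖w' - w‖ := by
  have h : ∀ a j, |w' a j - w a j| ≤ ‖w' - w‖ := fun a j =>
    (norm_le_pi_norm ((w' - w) a) j).trans (norm_le_pi_norm (w' - w) a)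
  rw [pi_norm_le_iff_of_nonneg (norm_nonneg _)]
  rintro ⟨a, r⟩
  rw [pi_norm_le_iff_of_nonneg (norm_nonneg _)]
  intro j
  have h1 : |w' a 1 + 0 - (w a 1 + 0)| ≤ ‖w' - w‖ := by simpa using h a 1
  fin_cases r <;> fin_cases j <;> first | exact h a _ | exact h (next a) _ | exact h1

/-! ### Replacing straight edges by staircases -/

theorem CycEmb.exists_dist_pos_uniform [Fintype V] {next : V → V} {v : V → Space}
    (h : CycEmb next v) (hn : Function.Injective next) :
    ∃ δ > 0, ∀ a b, a ≠ b → next a ≠ b → next b ≠ a → ∀ t t' : ℝ, 0 ≤ t → t ≤ 1 → 0 ≤ t' →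
      t' ≤ 1 → δ ≤ ‖edgePoint next v a t - edgePoint next v b t'‖ := by
  have : ∀ p : V × V, ∃ δ > 0, p.1 ≠ p.2 → next p.1 ≠ p.2 → next p.2 ≠ p.1 → ∀ t t' : ℝ,
      0 ≤ t → t ≤ 1 → 0 ≤ t' → t' ≤ 1 →
      δ ≤ ‖edgePoint next v p.1 t - edgePoint next v p.2 t'‖ := by
    intro p
    by_cases hp : p.1 ≠ p.2 ∧ next p.1 ≠ p.2 ∧ next p.2 ≠ p.1
    · obtain ⟨δ, hδ, hle⟩ := h.exists_dist_pos hn hp.1 hp.2.1 hp.2.2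
      exact ⟨δ, hδ, fun _ _ _ => hle⟩
    · exact ⟨1, one_pos, fun h1 h2 h3 => absurd ⟨h1, h2, h3⟩ hp⟩
  choose f hf hle using this
  by_cases hV : Nonempty V
  · obtain ⟨p, hp⟩ := Finite.exists_min f
    exact ⟨f p, hf p, fun a b h1 h2 h3 t t' h4 h5 h6 h7 =>
      (hp (a, b)).trans (hle (a, b) h1 h2 h3 t t' h4 h5 h6 h7)⟩
  · exact ⟨1, one_pos, fun a => absurd ⟨a⟩ hV⟩

/-- The subdivision of each edge into `M` equal parts. -/
abbrev nextM (M : ℕ) (hM : 0 < M) (next : V → V) : (Σ _ : V, Fin M) → Σ _ : V, Fin M :=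
  subdivNext (fun _ => M) (fun _ => hM) next

abbrev equalParts (M : ℕ) (next : V → V) (v : V → Space) : (Σ _ : V, Fin M) → Space :=
  fun y => edgePoint next v y.1 ((y.2 : ℕ) / (M : ℝ))

/-- The polygon between a subdivided polygon and its staircase. -/
abbrev partialStair (M : ℕ) (hM : 0 < M) (next : V → V) (v : V → Space) (s : ℝ) :
    (Σ _ : (Σ _ : V, Fin M), Fin 3) → Space :=
  fun y => (1 - s) • edgePoint (nextM M hM next) (equalParts M next v) y.1 ((y.2 : ℕ) / (3 : ℝ)) +
    s • stair (nextM M hM next) (equalParts M next v) 0 y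

theorem equalParts_next (M : ℕ) (hM : 0 < M) (next : V → V) (v : V → Space)
    (x : Σ _ : V, Fin M) : equalParts M next v (nextM M hM next x) =
      edgePoint next v x.1 (((x.2 : ℕ) + 1) / (M : ℝ)) := by
  have := subdiv_next_apply (fun _ => M) (fun _ => hM) next
    (fun a m => edgePoint next v a ((m : ℕ) / (M : ℝ))) (fun a => by
      have : (M : ℝ) ≠ 0 := by positivity
      simp [this]) x
  push_cast at this
  exact this

/-- Position of a point of a partial staircase: it progresses in all three coordinates. -/
theorem edgePoint_partialStair (M : ℕ) (hM : 0 < M) (next : V → V) (v : V → Space) {s : ℝ}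
    (hs0 : 0 ≤ s) (hs1 : s ≤ 1) (y : Σ _ : (Σ _ : V, Fin M), Fin 3) {t : ℝ} (ht0 : 0 ≤ t)
    (ht1 : t < 1) :
    ∃ f : Fin 3 → ℝ, (∀ j, edgePoint (next3 (nextM M hM next)) (partialStair M hM next v s) y t j =
        v y.1.1 j + ((y.1.2 : ℕ) + f j) / M * (v (next y.1.1) j - v y.1.1 j)) ∧
      0 ≤ f 1 ∧ f 1 ≤ f 2 ∧ f 2 ≤ f 0 ∧ f 0 ≤ 1 ∧ f 0 + f 1 + f 2 = (y.2 : ℕ) + t := by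
  have hM' : (M : ℝ) ≠ 0 := by positivity
  have hpt := edgePoint_subdiv (fun _ => 3) (fun _ => Nat.zero_lt_succ 2) (nextM M hM next)
    (fun x r => (1 - s) • edgePoint (nextM M hM next) (equalParts M next v) x ((r : ℕ) / (3 : ℝ)) +
      s • stairPoint (nextM M hM next) (equalParts M next v) 0 x r)
    (fun x => by simp [stairPoint]) y t
  have hv : ∀ (x : Σ _ : V, Fin M) j, equalParts M next v (nextM M hM next x) j =
      v x.1 j + ((x.2 : ℕ) + 1) / M * (v (next x.1) j - v x.1 j) := fun x j => by
    rw [equalParts_next]; rfl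
  have hline : ∀ (x : Σ _ : V, Fin M) (r : ℝ) j,
      edgePoint (nextM M hM next) (equalParts M next v) x r j =
      v x.1 j + ((x.2 : ℕ) + r) / M * (v (next x.1) j - v x.1 j) := fun x r j => by
    change v x.1 j + (x.2 : ℕ) / (M : ℝ) * (v (next x.1) j - v x.1 j) +
      r * (equalParts M next v (nextM M hM next x) j -
        (v x.1 j + (x.2 : ℕ) / (M : ℝ) * (v (next x.1) j - v x.1 j))) = _
    rw [hv]
    field_simp
    ring
  have hcomb : ∀ (A B C D : Space) j, ((1 - s) • A + s • B + t • ((1 - s) • C + s • D -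
      ((1 - s) • A + s • B))) j = (1 - s) * A j + s * B j + t * ((1 - s) * C j + s * D j -
      ((1 - s) * A j + s * B j)) := fun _ _ _ _ _ => rfl
  have s0 : ∀ x j, stairPoint (nextM M hM next) (equalParts M next v) 0 x 0 j =
      v x.1 j + (x.2 : ℕ) / (M : ℝ) * (v (next x.1) j - v x.1 j) := fun _ _ => rfl
  have s1 : ∀ x j, stairPoint (nextM M hM next) (equalParts M next v) 0 x 1 j =
      v x.1 j + ((x.2 : ℕ) + ![1, 0, 0] j) / (M : ℝ) * (v (next x.1) j - v x.1 j) := fun x j => by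
    fin_cases j
    · exact hv x 0
    · exact (s0 x 1).trans (by simp)
    · exact (s0 x 2).trans (by simp)
  have s2 : ∀ x j, stairPoint (nextM M hM next) (equalParts M next v) 0 x 2 j =
      v x.1 j + ((x.2 : ℕ) + ![1, 0, 1] j) / (M : ℝ) * (v (next x.1) j - v x.1 j) := fun x j => by
    fin_cases j
    · exact hv x 0
    · exact (congrArg (· + (0 : ℝ)) (s0 x 1)).trans (by simp)
    · exact hv x 2
  have s3 : ∀ x j, stairPoint (nextM M hM next) (equalParts M next v) 0 x 3 j =
      v x.1 j + ((x.2 : ℕ) + 1) / (M : ℝ) * (v (next x.1) j - v x.1 j) := hv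
  -- Rows belong to the three edges, columns to the coordinates. The vertex number `r` interpolates
  -- between progress `r / 3` in all coordinates and the stair's `(1, 0, 0)` or `(1, 0, 1)`, so the
  -- progress always sums to `r + t`. The coordinates advance in the order `0`, `2`, `1`.
  refine ⟨fun j => ![![(1 + 2 * s) / 3 * t, (1 - s) / 3 * t, (1 - s) / 3 * t],
    ![(1 + 2 * s) / 3 + (1 - s) / 3 * t, (1 - s) / 3 + (1 - s) / 3 * t,
      (1 - s) / 3 + (1 + 2 * s) / 3 * t],
    ![(2 + s) / 3 + (1 - s) / 3 * t, (2 - 2 * s) / 3 + (1 + 2 * s) / 3 * t,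
      (2 + s) / 3 + (1 - s) / 3 * t]] y.2 j, fun j => ?_, ?_⟩
  · rw [show edgePoint (next3 (nextM M hM next)) (partialStair M hM next v s) y t = _ from hpt,
      hcomb]
    obtain ⟨x, r⟩ := y
    fin_cases r
    · simp only [hline, s0, s1, Fin.zero_eta, zero_add]
      fin_cases j <;> simp <;> field_simp <;> ring
    · simp only [hline, s1, s2, Fin.mk_one, Nat.reduceAdd]
      fin_cases j <;> simp <;> field_simp <;> ring
    · simp only [hline, s2, s3, Fin.reduceFinMk, Nat.reduceAdd]
      fin_cases j <;> simp <;> field_simp <;> ring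
  · have hst : 0 ≤ s * t := mul_nonneg hs0 ht0
    have hst1 : 0 ≤ (1 - s) * t := mul_nonneg (by linarith) ht0
    have hst2 : 0 ≤ (1 - s) * (1 - t) := mul_nonneg (by linarith) (by linarith)
    have hst3 : 0 ≤ s * (1 - t) := mul_nonneg hs0 (by linarith)
    obtain ⟨x, r⟩ := y
    fin_cases r <;> refine ⟨?_, ?_, ?_, ?_, ?_⟩ <;> simp <;> nlinarith

end

/-! ### Partial staircases of different edges do not meet -/

section

variable {V : Type*}

/-- Some coordinate does not change its direction at each vertex. -/
def MonotoneTurns (next : V → V) (v : V → Space) : Prop :=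
  ∀ a, ∃ j, 0 < (v (next a) j - v a j) * (v (next (next a)) j - v (next a) j)

/-- A positive dot product has a positive summand. -/
theorem GentleTurns.monotoneTurns {next : V → V} {v : V → Space} (h : GentleTurns next v) :
    MonotoneTurns next v := by
  intro a
  by_contra! hle
  have : (v (next a) - v a) ⬝ᵥ (v (next (next a)) - v (next a)) ≤ 0 :=
    Finset.sum_nonpos fun j _ => hle j
  exact absurd (h a) this.not_gt

/-- A point on a partial staircase does not lie on the partial staircase of the next edge. -/
theorem partialStair_adjacent_ne (M : ℕ) (hM : 0 < M) {next : V → V} {v : V → Space}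
    {a : V} (hmono : ∃ j, 0 < (v (next a) j - v a j) * (v (next (next a)) j - v (next a) j))
    (hd : ∀ a j, v (next a) j - v a j ≠ 0)
    {s : ℝ} (hs0 : 0 ≤ s) (hs1 : s ≤ 1) (y y' : Σ _ : (Σ _ : V, Fin M), Fin 3) (hy : y.1.1 = a)
    (hy' : y'.1.1 = next a) {t t' : ℝ} (ht0 : 0 ≤ t) (ht1 : t < 1) (ht0' : 0 ≤ t') (ht1' : t' < 1) :
    edgePoint (next3 (nextM M hM next)) (partialStair M hM next v s) y t ≠
      edgePoint (next3 (nextM M hM next)) (partialStair M hM next v s) y' t' := by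
  intro h
  have hM' : (0 : ℝ) < M := by exact_mod_cast hM
  obtain ⟨f, hf, h1, h2, h3, h4, h5⟩ := edgePoint_partialStair M hM next v hs0 hs1 y ht0 ht1
  obtain ⟨g, hg, k1, k2, k3, k4, k5⟩ := edgePoint_partialStair M hM next v hs0 hs1 y' ht0' ht1'
  have hm : ((y.1.2 : ℕ) : ℝ) + 1 ≤ M := by exact_mod_cast y.1.2.2
  have hm0 : (0 : ℝ) ≤ ((y'.1.2 : ℕ) : ℝ) := Nat.cast_nonneg _
  have hr : ((y.2 : ℕ) : ℝ) ≤ 2 := by exact_mod_cast Nat.lt_succ_iff.1 y.2.2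
  -- Both points are measured from the common vertex: in each coordinate, nonnegative multiples of
  -- the two edge components cancel.
  have e : ∀ j, (1 - ((y.1.2 : ℕ) + f j) / M) * (v (next a) j - v a j) +
      ((y'.1.2 : ℕ) + g j) / M * (v (next (next a)) j - v (next a) j) = 0 := fun j => by
    have := congrFun h j
    rw [hf, hg, hy, hy'] at this
    linarith
  have hfle : ∀ j, f j ≤ 1 := fun j => by fin_cases j <;> simp <;> linarith
  have hg0 : ∀ j, 0 ≤ g j := fun j => by fin_cases j <;> simp <;> linarith
  have hA : ∀ j, 0 ≤ 1 - ((y.1.2 : ℕ) + f j) / M := fun j => by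
    rw [sub_nonneg, div_le_one hM']; linarith [hfle j]
  have hB : ∀ j, 0 ≤ ((y'.1.2 : ℕ) + g j) / M := fun j => by
    have := hg0 j; positivity
  have hA1 : ∀ j, 1 - ((y.1.2 : ℕ) + f j) / M = 0 → f j = 1 := fun j h0 => by
    rw [sub_eq_zero, eq_comm, div_eq_one_iff_eq hM'.ne'] at h0
    linarith [hfle j]
  have hB0 : ∀ j, ((y'.1.2 : ℕ) + g j) / M = 0 → g j = 0 ∧ ((y'.1.2 : ℕ) : ℝ) = 0 := fun j h0 => by
    rw [div_eq_zero_iff, or_iff_left hM'.ne'] at h0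
    constructor <;> linarith [hg0 j]
  -- In the monotone coordinate both components have the same sign, so the first point has completed
  -- it. Coordinate `0` advances first, so it is completed too; hence the second point has not begun
  -- coordinate `0`, nor any other. Then coordinate `1`, the last one, is completed on the first
  -- edge, which requires `t = 1`.
  obtain ⟨j, hj⟩ := hmono
  have hAj : 1 - ((y.1.2 : ℕ) + f j) / M = 0 := by
    by_contra hne
    have hp : 0 < 1 - ((y.1.2 : ℕ) + f j) / M := lt_of_le_of_ne (hA j) (Ne.symm hne)
    have e' := congrArg (· * (v (next (next a)) j - v (next a) j)) (e j)
    simp only [zero_mul, add_mul] at e'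
    rw [mul_assoc, mul_assoc] at e'
    have := mul_pos hp hj
    have := mul_nonneg (hB j) (mul_self_nonneg (v (next (next a)) j - v (next a) j))
    linarith
  have hf0 : f 0 = 1 := by
    have := hA1 j hAj
    fin_cases j <;> simp at this <;> linarith
  have hA0 : 1 - ((y.1.2 : ℕ) + f 0) / M = 0 := by
    have h1 := hA1 j hAj
    rw [hf0]; rwa [h1] at hAj
  have e0 := e 0
  rw [hA0, zero_mul, zero_add] at e0
  obtain ⟨hg00, hk⟩ := hB0 0 ((mul_eq_zero.1 e0).resolve_right (hd _ _))
  have hgz : ∀ j, g j = 0 := fun j => by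
    have := hg0 j
    fin_cases j <;> simp at this ⊢ <;> linarith
  have e1 := e 1
  rw [hk, hgz, add_zero, zero_div, zero_mul, add_zero] at e1
  have := hA1 1 ((mul_eq_zero.1 e1).resolve_right (hd _ _))
  linarith

/-- Three cases. On one edge, every coordinate determines its own progress, and the total progress
determines the point. Consecutive edges are treated in `partialStair_adjacent_ne`. For all other
edges, each stair stays within `2 * ‖v‖ / M` of its edge, less than half the distance `δ`. -/
theorem cycEmb_partialStair [Fintype V] {next : V → V} {v : V → Space} (M : ℕ) (hM : 0 < M)
    (hmono : MonotoneTurns next v) (hd : ∀ a j, v (next a) j - v a j ≠ 0) {δ : ℝ}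
    (hδ : ∀ a b, a ≠ b → next a ≠ b → next b ≠ a → ∀ t t' : ℝ, 0 ≤ t → t ≤ 1 → 0 ≤ t' →
      t' ≤ 1 → δ ≤ ‖edgePoint next v a t - edgePoint next v b t'‖) (hMδ : 4 * ‖v‖ / M < δ)
    {s : ℝ} (hs0 : 0 ≤ s) (hs1 : s ≤ 1) :
    CycEmb (next3 (nextM M hM next)) (partialStair M hM next v s) := by
  have hM' : (0 : ℝ) < M := by exact_mod_cast hM
  intro y y' t t' ht0 ht1 ht0' ht1' h
  by_cases hab : y.1.1 = y'.1.1
  · obtain ⟨f, hf, h1, h2, h3, h4, h5⟩ := edgePoint_partialStair M hM next v hs0 hs1 y ht0 ht1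
    obtain ⟨g, hg, k1, k2, k3, k4, k5⟩ := edgePoint_partialStair M hM next v hs0 hs1 y' ht0' ht1'
    have e : ∀ j, ((y.1.2 : ℕ) : ℝ) + f j = ((y'.1.2 : ℕ) : ℝ) + g j := fun j => by
      have := congrFun h j
      rw [hf, hg, hab] at this
      have := mul_right_cancel₀ (hd _ j) (add_left_cancel this)
      rwa [div_left_inj' hM'.ne'] at this
    have hsum : ((3 * (y.1.2 : ℕ) + (y.2 : ℕ) : ℕ) : ℝ) + t =
        ((3 * (y'.1.2 : ℕ) + (y'.2 : ℕ) : ℕ) : ℝ) + t' := by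
      push_cast
      linarith [e 0, e 1, e 2]
    -- The integral part of the total progress is the number of the small edge, its fractional part
    -- is the parameter.
    have hnat : 3 * (y.1.2 : ℕ) + (y.2 : ℕ) = 3 * (y'.1.2 : ℕ) + (y'.2 : ℕ) := by
      have := congrArg Nat.floor hsum
      rwa [add_comm, add_comm _ t', Nat.floor_add_natCast ht0, Nat.floor_add_natCast ht0',
        Nat.floor_eq_zero.2 ht1, Nat.floor_eq_zero.2 ht1', zero_add, zero_add] at this
    rw [hnat] at hsum
    obtain ⟨⟨a, m⟩, r⟩ := y
    obtain ⟨⟨b, k⟩, r'⟩ := y'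
    simp only at hab hnat
    subst hab
    obtain rfl : r = r' := Fin.ext (by omega)
    obtain rfl : m = k := Fin.ext (by omega)
    exact ⟨rfl, by linarith⟩
  exfalso
  by_cases h1 : next y.1.1 = y'.1.1
  · exact partialStair_adjacent_ne M hM (hmono _) hd hs0 hs1 y y' rfl h1.symm ht0 ht1 ht0' ht1' h
  by_cases h2 : next y'.1.1 = y.1.1
  · exact partialStair_adjacent_ne M hM (hmono _) hd hs0 hs1 y' y rfl h2.symm ht0' ht1' ht0 ht1
      h.symm
  have hclose : ∀ (y : Σ _ : (Σ _ : V, Fin M), Fin 3) (t : ℝ), 0 ≤ t → t < 1 →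
      ‖edgePoint (next3 (nextM M hM next)) (partialStair M hM next v s) y t -
        edgePoint next v y.1.1 ((y.1.2 : ℕ) / M)‖ ≤ 2 * ‖v‖ / M := by
    intro y t ht0 ht1
    obtain ⟨f, hf, h1, h2, h3, h4, h5⟩ := edgePoint_partialStair M hM next v hs0 hs1 y ht0 ht1
    rw [pi_norm_le_iff_of_nonneg (by positivity)]
    intro j
    have e : (edgePoint (next3 (nextM M hM next)) (partialStair M hM next v s) y t -
        edgePoint next v y.1.1 ((y.1.2 : ℕ) / M)) j = f j / M * (v (next y.1.1) - v y.1.1) j := by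
      rw [Pi.sub_apply, hf, edgePoint]
      simp only [Pi.add_apply, Pi.smul_apply, Pi.sub_apply, smul_eq_mul]
      ring
    have hf0 : 0 ≤ f j := by fin_cases j <;> simp <;> linarith
    have hf1 : f j ≤ 1 := by fin_cases j <;> simp <;> linarith
    rw [e, norm_mul, Real.norm_of_nonneg (by positivity)]
    have h6 := (norm_le_pi_norm (v (next y.1.1) - v y.1.1) j).trans (norm_edge_le next v y.1.1)
    calc _ ≤ 1 / M * (2 * ‖v‖) := by gcongr
      _ = _ := by ring
  have c1 := hclose y t ht0 ht1
  have c2 := hclose y' t' ht0' ht1'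
  have hfrac : ∀ m : Fin M, 0 ≤ ((m : ℕ) : ℝ) / M ∧ ((m : ℕ) : ℝ) / M ≤ 1 := fun m =>
    ⟨by positivity, by rw [div_le_one hM']; exact_mod_cast m.2.le⟩
  have c3 := hδ _ _ hab h1 h2 _ _ (hfrac y.1.2).1 (hfrac y.1.2).2 (hfrac y'.1.2).1 (hfrac y'.1.2).2
  rw [h] at c1
  rw [norm_sub_rev] at c1
  have c4 := norm_sub_le_norm_sub_add_norm_sub (edgePoint next v y.1.1 ((y.1.2 : ℕ) / M))
    (edgePoint (next3 (nextM M hM next)) (partialStair M hM next v s) y' t')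
    (edgePoint next v y'.1.1 ((y'.1.2 : ℕ) / M))
  have : 4 * ‖v‖ / M = 2 * ‖v‖ / M + 2 * ‖v‖ / M := by ring
  linarith

/-- Small perturbations keep turns gentle. -/
theorem GentleTurns.exists_nhds [Fintype V] {next : V → V} {v : V → Space}
    (h : GentleTurns next v) : ∃ ε > 0, ∀ w : V → Space, ‖w - v‖ < ε → GentleTurns next w := by
  have hopen : IsOpen {w : V → Space | GentleTurns next w} := by
    have : {w : V → Space | GentleTurns next w} =
        ⋂ a, {w | 0 < (w (next a) - w a) ⬝ᵥ (w (next (next a)) - w (next a))} := by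
      ext w; simp [GentleTurns]
    rw [this]
    refine isOpen_iInter_of_finite fun a => isOpen_lt continuous_const ?_
    simp only [dotProduct]
    fun_prop
  obtain ⟨ε, hε, hball⟩ := Metric.isOpen_iff.1 hopen v h
  exact ⟨ε, hε, fun w hw => hball (by simpa [dist_eq_norm] using hw)⟩

theorem cycCurve_equalParts (M : ℕ) (hM : 0 < M) (next : V → V) (v : V → Space) :
    cycCurve (nextM M hM next) (equalParts M next v) = cycCurve next v := by
  have hM' : (0 : ℝ) < M := by exact_mod_cast hM
  exact cycCurve_linearSubdiv (fun _ => M) (fun _ => hM) next v (fun _ m => (m : ℝ) / M)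
    (fun _ m n h => by
      have : (m : ℝ) ≤ n := by exact_mod_cast h
      exact div_le_div_of_nonneg_right this hM'.le)
    (fun _ => by simp) (fun _ => div_self hM'.ne')

theorem cycCurve_partialStair_zero (M : ℕ) (hM : 0 < M) (next : V → V) (v : V → Space) :
    cycCurve (next3 (nextM M hM next)) (partialStair M hM next v 0) = cycCurve next v := by
  have h3 : (0 : ℝ) < 3 := by norm_num
  rw [← cycCurve_equalParts M hM next v]
  have := cycCurve_linearSubdiv (fun _ : (Σ _ : V, Fin M) => 3) (fun _ => Nat.zero_lt_succ 2)
    (nextM M hM next) (equalParts M next v) (fun _ m => (m : ℝ) / 3)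
    (fun _ m n h => by
      have : (m : ℝ) ≤ n := by exact_mod_cast h
      exact div_le_div_of_nonneg_right this h3.le)
    (fun _ => by simp) (fun _ => by norm_num)
  rw [← this]
  congr 1
  funext y
  simp [partialStair]

/-- Every polygonal link is isotopic to a staircase over points with distinct coordinates. -/
theorem CycEmb.exists_stair {V : Type} [Fintype V] {next : V → V} {v : V → Space}
    (h : CycEmb next v) (hn : Function.Injective next) (hg : GentleTurns next v) :
    ∃ (W : Type) (_ : Fintype W) (next' : W → W) (w : W → Space), Function.Injective next' ∧
      (∀ a, next' a ≠ a) ∧ (∀ j, Function.Injective fun a => w a j) ∧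
      AmbientIsotopic (cycCurve next v) (cycCurve (next3 next') (stair next' w 0)) ∧
      (Nonempty V → Nonempty W) := by
  obtain ⟨ε₁, hε₁, hε₁'⟩ := h.exists_nhds hn
  obtain ⟨ε₂, hε₂, hε₂'⟩ := hg.exists_nhds
  -- After this no edge is perpendicular to an axis, so progress along an edge can be read off every
  -- coordinate.
  obtain ⟨v', hv', hinj⟩ := exists_perturbation v (lt_min hε₁ hε₂)
  obtain ⟨hemb, hiso⟩ := hε₁' v' (hv'.trans_le (min_le_left _ _))
  have hmono := (hε₂' v' (hv'.trans_le (min_le_right _ _))).monotoneTurns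
  obtain ⟨δ, hδ, hδ'⟩ := hemb.exists_dist_pos_uniform hn
  obtain ⟨M, hM⟩ := exists_nat_gt (4 * ‖v'‖ / δ)
  have hMpos : (0 : ℝ) < M := lt_of_le_of_lt (by positivity) hM
  have hM0 : 0 < M := by exact_mod_cast hMpos
  have hMδ : 4 * ‖v'‖ / M < δ := by
    rw [div_lt_iff₀ hδ] at hM
    rw [div_lt_iff₀ hMpos]
    linarith
  have hd : ∀ a j, v' (next a) j - v' a j ≠ 0 := fun a j e =>
    hemb.next_ne a (hinj j (sub_eq_zero.1 e))
  have hps := fun s hs0 hs1 => cycEmb_partialStair (s := s) M hM0 hmono hd hδ' hMδ hs0 hs1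
  have hnM : Function.Injective (nextM M hM0 next) := subdivNext_injective _ _ _ hn
  have hn3 : Function.Injective (next3 (nextM M hM0 next)) := subdivNext_injective _ _ _ hnM
  have hps1 : partialStair M hM0 next v' 1 =
      stair (nextM M hM0 next) (equalParts M next v') 0 := by
    funext y; simp [partialStair]
  have hiso2 : AmbientIsotopic (cycCurve next v')
      (cycCurve (next3 (nextM M hM0 next)) (stair (nextM M hM0 next) (equalParts M next v') 0)) := by
    rw [← cycCurve_partialStair_zero M hM0 next v', ← hps1]
    refine ambientIsotopic_of_cycEmb hn3 _ _ fun s hs0 hs1 => ?_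
    convert hps s hs0 hs1 using 1
    funext y
    simp [partialStair]
  have hemb1 := hps 1 zero_le_one le_rfl
  rw [hps1] at hemb1
  obtain ⟨ε₃, hε₃, hε₃'⟩ := hemb1.exists_nhds hn3
  -- The second perturbation is needed because division points of different edges can share a
  -- coordinate.
  obtain ⟨w, hw, hwinj⟩ := exists_perturbation (equalParts M next v') hε₃
  obtain ⟨hemb2, hiso3⟩ := hε₃' (stair (nextM M hM0 next) w 0)
    ((norm_stair_sub_le _ _ _).trans_lt hw)
  refine ⟨Σ _ : V, Fin M, inferInstance, nextM M hM0 next, w, hnM, fun a e => ?_, hwinj,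
    hiso.trans (hiso2.trans hiso3), fun ⟨a⟩ => ⟨⟨a, ⟨0, hM0⟩⟩⟩⟩
  -- If `a` were its own successor, the first edge of its staircase would be a point.
  have h01 : stair (nextM M hM0 next) w 0 ⟨a, 1⟩ = stair (nextM M hM0 next) w 0 ⟨a, 0⟩ := by
    refine space_ext ?_ rfl rfl
    change w (nextM M hM0 next a) 0 = w a 0
    rw [e]
  have := hemb2.vertex_injective h01
  simp at this

end

/-! ### Closed paths in the square grid -/

/-- Disjoint closed paths through the squares of a grid, without reversals, which meet only in
transversal crossings of different heights. The square `(X, Y)` has the centre `(2X, 2Y)`. -/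
structure GridPath (V : Type) where
  σ : Equiv.Perm V
  q : V → ℤ × ℤ
  D : V → Fin 4
  h : V → ℝ
  q_next : ∀ a, q (σ a) = q a + edgeMidpoints (D a)
  no_reversal : ∀ a, D (σ a) ≠ D a + 2
  crossing : ∀ a b, a ≠ b → q (σ a) = q (σ b) → D (σ a) = D a ∧ D (σ b) = D b ∧
    (D a : ℕ) % 2 ≠ (D b : ℕ) % 2 ∧ h (σ a) ≠ h (σ b)

namespace GridPath
variable {V : Type} (G : GridPath V)

/-- The side of the square at which the path enters. -/
def inn (c : V) : Fin 4 := G.D (G.σ.symm c) + 2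

/-- The path is the upper one at a crossing. -/
def IsUpper (c : V) : Prop := ∃ b, G.q b = G.q c ∧ G.h b < G.h c

open Classical in
def upper (c : V) : Bool := decide (G.IsUpper c)

theorem edgeMidpoints_add_two (d : Fin 4) : edgeMidpoints (d + 2) = -edgeMidpoints d := by
  fin_cases d <;> rfl

theorem edgeMidpoints_injective : Function.Injective edgeMidpoints := by decide

theorem add_two_add_two (d : Fin 4) : d + 2 + 2 = d := by fin_cases d <;> rfl

theorem inn_ne (c : V) : G.inn c ≠ G.D c := by
  have := G.no_reversal (G.σ.symm c)
  rw [Equiv.apply_symm_apply] at this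
  exact this.symm

theorem inn_next (a : V) : G.inn (G.σ a) = G.D a + 2 := by simp [inn]

theorem crossing' {c c' : V} (hne : c ≠ c') (hq : G.q c = G.q c') :
    G.inn c = G.D c + 2 ∧ G.inn c' = G.D c' + 2 ∧ (G.D c : ℕ) % 2 ≠ (G.D c' : ℕ) % 2 ∧
      G.h c ≠ G.h c' := by
  obtain ⟨a, rfl⟩ := G.σ.surjective c
  obtain ⟨b, rfl⟩ := G.σ.surjective c'
  obtain ⟨h1, h2, h3, h4⟩ := G.crossing a b (fun e => hne (by rw [e])) hq
  exact ⟨by rw [inn_next, h1], by rw [inn_next, h2], by rw [h1, h2]; exact h3, h4⟩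

/-- A square is visited at most twice: among three visits, two would have directions of the same
parity. So nothing lies below the lower visit of a crossing. -/
theorem upper_eq {c c' : V} (hq : G.q c = G.q c') (hh : G.h c < G.h c') :
    G.upper c = false ∧ G.upper c' = true := by
  have hne : c ≠ c' := fun e => by rw [e] at hh; exact lt_irrefl _ hh
  constructor
  · rw [upper, decide_eq_false_iff_not]
    rintro ⟨b, hb, hbh⟩
    have h1 := (G.crossing' (fun e => by rw [e] at hbh; exact lt_irrefl _ hbh) hb).2.2.1
    have h2 := (G.crossing' hne hq).2.2.1
    have h3 := (G.crossing' (c := b) (c' := c')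
      (fun e => by rw [e] at hbh; exact lt_asymm hbh hh) (hb.trans hq)).2.2.1
    omega
  · have : G.IsUpper c' := ⟨c, hq, hh⟩
    simpa [upper] using this

/-- The curve drawn in the square of `c`. -/
def visitCurve (c : V) : Set Space :=
  strandCurve edgeMidpoints (2 • G.q c) ⟨G.inn c, G.D c, G.upper c⟩

/-- An edge midpoint used by two strands is used by one that leaves and one that enters. -/
theorem not_opposite (a b : V) (h1 : G.q a = G.q (G.σ b))
    (hD : G.D b = G.D a + 2) : False := by
  by_cases hab : G.σ b = a
  · have := G.no_reversal b
    rw [hab, hD, add_two_add_two] at this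
    exact this rfl
  · have h := (G.crossing' (fun e => hab e.symm) h1)
    have h3 := h.2.1
    rw [inn_next] at h3
    have h4 : G.D b = G.D (G.σ b) := add_right_cancel h3
    rw [← h4, hD] at h
    have : ∀ d : Fin 4, (d : ℕ) % 2 = ((d + 2 : Fin 4) : ℕ) % 2 := by decide
    exact h.2.2.1 (this _)

/-- The polygon between the grid path, with heights `k` at the sides of the squares, and the curve
of a mosaic. -/
def polygonPoint (k : V → ℝ) (s : ℝ) (a : V) : ℕ → Space
  | 0 => ![2 * (G.q a).1 + s * (((edgeMidpoints (G.D a)).1 + (edgeMidpoints (G.inn a)).1) / 4),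
      2 * (G.q a).2 + s * (((edgeMidpoints (G.D a)).2 + (edgeMidpoints (G.inn a)).2) / 4),
      (1 - s) * G.h a + s * if G.upper a then 1 else 0]
  | 1 => ![2 * (G.q a).1 + (edgeMidpoints (G.D a)).1, 2 * (G.q a).2 + (edgeMidpoints (G.D a)).2,
      (1 - s) * k a]
  | _ => ![2 * (G.q (G.σ a)).1 + s * (((edgeMidpoints (G.D (G.σ a))).1 +
        (edgeMidpoints (G.inn (G.σ a))).1) / 4),
      2 * (G.q (G.σ a)).2 + s * (((edgeMidpoints (G.D (G.σ a))).2 +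
        (edgeMidpoints (G.inn (G.σ a))).2) / 4),
      (1 - s) * G.h (G.σ a) + s * if G.upper (G.σ a) then 1 else 0]

abbrev next2 (next : V → V) : (Σ _ : V, Fin 2) → Σ _ : V, Fin 2 :=
  subdivNext (fun _ => 2) (fun _ => Nat.zero_lt_succ 1) next

abbrev polygon (k : V → ℝ) (s : ℝ) : (Σ _ : V, Fin 2) → Space :=
  fun y => G.polygonPoint k s y.1 y.2

theorem polygonPoint_closes (k : V → ℝ) (s : ℝ) (a : V) :
    G.polygonPoint k s a 2 = G.polygonPoint k s (G.σ a) 0 := rfl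

/-- The position of a point of the polygon relative to the centre of its square. -/
theorem polygon_position (k : V → ℝ) {s : ℝ} (hs0 : 0 ≤ s) (hs1 : s ≤ 1) (y : Σ _ : V, Fin 2)
    {t : ℝ} (ht0 : 0 ≤ t) (ht1 : t < 1) :
    ∃ (c : V) (A B : ℝ), 0 ≤ A ∧ 0 ≤ B ∧ A + B ≤ 1 ∧ (A + B = 1 → A = 0 ∧ B = 1) ∧
      edgePoint (next2 G.σ) (G.polygon k s) y t 0 = 2 * (G.q c).1 +
        (A * (edgeMidpoints (G.D c)).1 + B * (edgeMidpoints (G.inn c)).1) ∧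
      edgePoint (next2 G.σ) (G.polygon k s) y t 1 = 2 * (G.q c).2 +
        (A * (edgeMidpoints (G.D c)).2 + B * (edgeMidpoints (G.inn c)).2) ∧
      (A = B → edgePoint (next2 G.σ) (G.polygon k s) y t 2 =
        (1 - s) * G.h c + s * if G.upper c then 1 else 0) ∧
      (y = ⟨c, 0⟩ ∧ A - B = t ∨ y = ⟨G.σ.symm c, 1⟩ ∧ A - B = -(1 - t)) := by
  have hpt := edgePoint_subdiv (fun _ => 2) (fun _ => Nat.zero_lt_succ 1) G.σ
    (G.polygonPoint k s) (G.polygonPoint_closes k s) y t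
  rw [show edgePoint (next2 G.σ) (G.polygon k s) y t = _ from hpt]
  have hst : 0 ≤ (1 - t) * s := mul_nonneg (by linarith) hs0
  have hst' : (1 - t) * s ≤ 1 - t := by nlinarith
  have hts : 0 ≤ t * s := mul_nonneg ht0 hs0
  have hts' : t * s ≤ t := by nlinarith
  obtain ⟨a, r⟩ := y
  fin_cases r
  -- The numbers `A` and `B` are the weights of the exit and the entrance side. The shift of the
  -- middle point contributes equally to both, so `A - B` is the position along the strand and `A =
  -- B` marks the middle point.
  · refine ⟨a, t + (1 - t) * s / 4, (1 - t) * s / 4, by positivity, by positivity, by linarith,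
      fun h => by linarith, ?_, ?_, fun h => ?_, Or.inl ⟨rfl, by ring⟩⟩
    · simp only [zero_add, polygonPoint, Pi.add_apply, Pi.smul_apply,
        Pi.sub_apply, smul_eq_mul, Matrix.cons_val_zero]
      ring
    · simp only [zero_add, polygonPoint, Pi.add_apply, Pi.smul_apply,
        Pi.sub_apply, smul_eq_mul, Matrix.cons_val_one, Matrix.cons_val_zero]
      ring
    · have : t = 0 := by linarith
      subst this
      simp [polygonPoint]
  · have hx : (2 * (G.q a).1 + (edgeMidpoints (G.D a)).1 : ℝ) =
        2 * (G.q (G.σ a)).1 + (edgeMidpoints (G.inn (G.σ a))).1 := by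
      rw [inn_next, edgeMidpoints_add_two, G.q_next, Prod.fst_add, Prod.fst_neg]
      push_cast
      ring
    have hy : (2 * (G.q a).2 + (edgeMidpoints (G.D a)).2 : ℝ) =
        2 * (G.q (G.σ a)).2 + (edgeMidpoints (G.inn (G.σ a))).2 := by
      rw [inn_next, edgeMidpoints_add_two, G.q_next, Prod.snd_add, Prod.snd_neg]
      push_cast
      ring
    refine ⟨G.σ a, t * s / 4, (1 - t) + t * s / 4, by positivity, by linarith, by linarith,
      fun h => ?_, ?_, ?_, fun h => by linarith, Or.inr ⟨by simp, by ring⟩⟩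
    · have : t = 0 := by linarith
      subst this
      simp
    · change 2 * ((G.q a).1 : ℝ) + (edgeMidpoints (G.D a)).1 +
        t * (2 * ((G.q (G.σ a)).1 : ℝ) + s * (((edgeMidpoints (G.D (G.σ a))).1 +
          (edgeMidpoints (G.inn (G.σ a))).1) / 4) -
          (2 * ((G.q a).1 : ℝ) + (edgeMidpoints (G.D a)).1)) = _
      rw [hx]
      ring
    · change 2 * ((G.q a).2 : ℝ) + (edgeMidpoints (G.D a)).2 +
        t * (2 * ((G.q (G.σ a)).2 : ℝ) + s * (((edgeMidpoints (G.D (G.σ a))).2 +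
          (edgeMidpoints (G.inn (G.σ a))).2) / 4) -
          (2 * ((G.q a).2 : ℝ) + (edgeMidpoints (G.D a)).2)) = _
      rw [hy]
      ring

/-- Different sides of a square. -/
theorem edgeMidpoints_independent {d e : Fin 4} (hde : e ≠ d) {A B A' B' : ℝ}
    (h1 : A * (edgeMidpoints d).1 + B * (edgeMidpoints e).1 =
      A' * (edgeMidpoints d).1 + B' * (edgeMidpoints e).1)
    (h2 : A * (edgeMidpoints d).2 + B * (edgeMidpoints e).2 =
      A' * (edgeMidpoints d).2 + B' * (edgeMidpoints e).2) : A - B = A' - B' := by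
  fin_cases d <;> fin_cases e <;> simp [edgeMidpoints] at hde h1 h2 <;> linarith

theorem abs_edgeMidpoints (d : Fin 4) :
    |((edgeMidpoints d).1 : ℝ)| + |((edgeMidpoints d).2 : ℝ)| = 1 := by
  fin_cases d <;> simp [edgeMidpoints]

theorem abs_offset_le (d e : Fin 4) {A B : ℝ} (hA : 0 ≤ A) (hB : 0 ≤ B) :
    |A * (edgeMidpoints d).1 + B * (edgeMidpoints e).1| +
      |A * (edgeMidpoints d).2 + B * (edgeMidpoints e).2| ≤ A + B := by
  have h1 := abs_add_le (A * ((edgeMidpoints d).1 : ℝ)) (B * (edgeMidpoints e).1)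
  have h2 := abs_add_le (A * ((edgeMidpoints d).2 : ℝ)) (B * (edgeMidpoints e).2)
  rw [abs_mul, abs_mul, abs_of_nonneg hA, abs_of_nonneg hB] at h1 h2
  have h3 := congrArg (A * ·) (abs_edgeMidpoints d)
  have h4 := congrArg (B * ·) (abs_edgeMidpoints e)
  simp only [mul_add, mul_one] at h3 h4
  linarith

/-- Points of different squares that coincide lie on a common side of the squares. -/
theorem opposite_of_eq {p p' : ℤ × ℤ} (hp : p ≠ p') {x y x' y' : ℝ} (h : |x| + |y| ≤ 1)
    (h' : |x'| + |y'| ≤ 1) (h1 : 2 * (p.1 : ℝ) + x = 2 * p'.1 + x')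
    (h2 : 2 * (p.2 : ℝ) + y = 2 * p'.2 + y') :
    |x| + |y| = 1 ∧ |x'| + |y'| = 1 ∧ x' = -x ∧ y' = -y ∧ (p'.1 : ℝ) = p.1 + x ∧
      (p'.2 : ℝ) = p.2 + y := by
  have hx := abs_nonneg x
  have hy := abs_nonneg y
  have hx' := abs_nonneg x'
  have hy' := abs_nonneg y'
  have zero : ∀ z : ℝ, |z| ≤ 0 → z = 0 := fun z hz => abs_eq_zero.1 (le_antisymm hz (abs_nonneg z))
  rcases ne_or_eq p.1 p'.1 with hne | heq
  · have hd : (1 : ℝ) ≤ |(p'.1 : ℝ) - p.1| := by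
      rw [← Int.cast_sub, ← Int.cast_abs]
      exact_mod_cast Int.one_le_abs (sub_ne_zero.2 hne.symm)
    have e : 2 * ((p'.1 : ℝ) - p.1) = x - x' := by linarith
    have hle : 2 * |(p'.1 : ℝ) - p.1| ≤ |x| + |x'| := by
      rw [← abs_two, ← abs_mul, e]; exact abs_sub x x'
    have a1 : |x| = 1 := by linarith
    have a2 : |x'| = 1 := by linarith
    have a3 : y = 0 := zero y (by linarith)
    have a4 : y' = 0 := zero y' (by linarith)
    have a5 : x' = -x := by
      rcases (abs_eq zero_le_one).1 a1 with r | r <;> rcases (abs_eq zero_le_one).1 a2 with r' | r'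
      · rw [r, r', sub_self] at e; rw [show (p'.1 : ℝ) - p.1 = 0 by linarith] at hd; simp at hd; linarith
      · linarith
      · linarith
      · rw [r, r', sub_self] at e; rw [show (p'.1 : ℝ) - p.1 = 0 by linarith] at hd; simp at hd; linarith
    subst a3 a4 a5
    refine ⟨by simpa using a1, by simpa using a1, rfl, by simp, by linarith, by linarith⟩
  · have hne : p.2 ≠ p'.2 := fun h => hp (Prod.ext heq h)
    have hd : (1 : ℝ) ≤ |(p'.2 : ℝ) - p.2| := by
      rw [← Int.cast_sub, ← Int.cast_abs]
      exact_mod_cast Int.one_le_abs (sub_ne_zero.2 hne.symm)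
    have e : 2 * ((p'.2 : ℝ) - p.2) = y - y' := by linarith
    have hle : 2 * |(p'.2 : ℝ) - p.2| ≤ |y| + |y'| := by
      rw [← abs_two, ← abs_mul, e]; exact abs_sub y y'
    have a1 : |y| = 1 := by linarith
    have a2 : |y'| = 1 := by linarith
    have a3 : x = 0 := zero x (by linarith)
    have a4 : x' = 0 := zero x' (by linarith)
    have a5 : y' = -y := by
      rcases (abs_eq zero_le_one).1 a1 with r | r <;> rcases (abs_eq zero_le_one).1 a2 with r' | r'
      · rw [r, r', sub_self] at e; rw [show (p'.2 : ℝ) - p.2 = 0 by linarith] at hd; simp at hd; linarith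
      · linarith
      · linarith
      · rw [r, r', sub_self] at e; rw [show (p'.2 : ℝ) - p.2 = 0 by linarith] at hd; simp at hd; linarith
    subst a3 a4 a5
    refine ⟨by simpa using a1, by simpa using a1, by simp, rfl, by linarith, by linarith⟩

/-- Within one visit, `A - B` is a parameter. Two visits of a square are perpendicular and meet only
over the centre, where `h` and `upper` order them the same way, so at all stages their heights
differ. Different squares meet only in a midpoint of a common side, and `not_opposite` leaves no
second visit there; therefore the heights `k` at the sides may be arbitrary. -/
theorem cycEmb_polygon (k : V → ℝ) {s : ℝ} (hs0 : 0 ≤ s) (hs1 : s ≤ 1) :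
    CycEmb (next2 G.σ) (G.polygon k s) := by
  intro y y' t t' ht0 ht1 ht0' ht1' h
  obtain ⟨c, A, B, hA, hB, hAB, hAB1, hx, hy, hz, hc⟩ := G.polygon_position k hs0 hs1 y ht0 ht1
  obtain ⟨c', A', B', hA', hB', hAB', hAB1', hx', hy', hz', hc'⟩ :=
    G.polygon_position k hs0 hs1 y' ht0' ht1'
  rw [h, hx'] at hx
  rw [h, hy'] at hy
  by_cases hcc : c = c'
  · subst hcc
    have := edgeMidpoints_independent (G.inn_ne c) (add_left_cancel hx) (add_left_cancel hy)
    rcases hc with ⟨e, hc⟩ | ⟨e, hc⟩ <;> rcases hc' with ⟨e', hc'⟩ | ⟨e', hc'⟩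
    · exact ⟨e.trans e'.symm, by linarith⟩
    · exfalso; linarith
    · exfalso; linarith
    · exact ⟨e.trans e'.symm, by linarith⟩
  exfalso
  by_cases hq : G.q c = G.q c'
  · obtain ⟨e1, e2, e3, e4⟩ := G.crossing' hcc hq
    rw [hq, e1, e2, edgeMidpoints_add_two, edgeMidpoints_add_two] at hx hy
    have hx2 := add_left_cancel hx
    have hy2 := add_left_cancel hy
    have hzero : A = B ∧ A' = B' := by
      generalize G.D c = d at *
      generalize G.D c' = d' at *
      fin_cases d <;> fin_cases d' <;> simp [edgeMidpoints] at e3 hx2 hy2 <;>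
        constructor <;> linarith
    have hzz := (hz hzero.1).symm.trans ((congrFun h 2).trans (hz' hzero.2))
    have key : ∀ c c', G.q c = G.q c' → G.h c < G.h c' →
        (1 - s) * G.h c + s * (if G.upper c then 1 else 0) <
          (1 - s) * G.h c' + s * (if G.upper c' then 1 else 0) := by
      intro c c' hq hlt
      obtain ⟨u1, u2⟩ := G.upper_eq hq hlt
      rw [u1, u2]
      simp only [Bool.false_eq_true, if_false, if_true, mul_zero, mul_one, add_zero]
      rcases hs0.eq_or_lt with rfl | hs
      · linarith
      · nlinarith
    rcases lt_or_gt_of_ne e4 with hlt | hlt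
    · exact (key c c' hq hlt).ne hzz
    · exact (key c' c hq.symm hlt).ne hzz.symm
  · have o1 := abs_offset_le (G.D c) (G.inn c) hA hB
    have o2 := abs_offset_le (G.D c') (G.inn c') hA' hB'
    obtain ⟨p1, p2, p3, p4, p5, p6⟩ :=
      opposite_of_eq hq (o1.trans hAB) (o2.trans hAB') hx.symm hy.symm
    obtain ⟨rfl, rfl⟩ := hAB1 (by linarith)
    obtain ⟨rfl, rfl⟩ := hAB1' (by linarith)
    simp only [zero_mul, one_mul, zero_add] at p3 p4 p5 p6
    have hi : edgeMidpoints (G.inn c') = edgeMidpoints (G.inn c + 2) := by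
      rw [edgeMidpoints_add_two]
      exact Prod.ext (by exact_mod_cast p3) (by exact_mod_cast p4)
    have hi' := edgeMidpoints_injective hi
    have hq' : G.q c' = G.q c + edgeMidpoints (G.inn c) :=
      Prod.ext (by exact_mod_cast p5) (by exact_mod_cast p6)
    obtain ⟨a, rfl⟩ := G.σ.surjective c
    obtain ⟨b, rfl⟩ := G.σ.surjective c'
    rw [inn_next, edgeMidpoints_add_two, G.q_next a, add_neg_cancel_right] at hq'
    rw [inn_next, inn_next] at hi'
    exact G.not_opposite a b hq'.symm (add_right_cancel hi')

end GridPath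

/-- Tiles fix a direction of each strand, while a path may run through it either way. -/
theorem strandCurve_swap (o : Fin 4 → ℤ × ℤ) (c : ℤ × ℤ) (p p' : Fin 4) (b : Bool) :
    strandCurve o c ⟨p, p', b⟩ = strandCurve o c ⟨p', p, b⟩ := by
  simp only [strandCurve]
  rw [union_comm, segment_symm ℝ (![((c.1 + (o p).1 : ℤ) : ℝ), _, _] : Space),
    segment_symm ℝ _ (![((c.1 + (o p').1 : ℤ) : ℝ), _, _] : Space),
    add_comm ((o p).1 : ℝ), add_comm ((o p).2 : ℝ)]

/-- The tile with a single curve between two given connection points. -/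
theorem exists_tile_strands : ∀ p p' : Fin 4, p ≠ p' → ∃ T : Tile,
    T.strands = [⟨p, p', false⟩] ∨ T.strands = [⟨p', p, false⟩] := by
  intro p p' h
  by_cases h1 : p' = p + 1
  · subst h1; exact ⟨.arc p, Or.inl rfl⟩
  by_cases h2 : p = p' + 1
  · subst h2; exact ⟨.arc p', Or.inr rfl⟩
  · fin_cases p <;> fin_cases p' <;> first
      | exact absurd rfl h
      | exact absurd rfl h1
      | exact absurd rfl h2
      | exact ⟨.line false, Or.inl rfl⟩
      | exact ⟨.line false, Or.inr rfl⟩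
      | exact ⟨.line true, Or.inl rfl⟩
      | exact ⟨.line true, Or.inr rfl⟩

/-! ### Tiles for the squares of a grid path -/

namespace GridPath
variable {V : Type} (G : GridPath V)

/-- The tile at `p` shows the strands of the path in the square `p`. -/
structure Shows (T : Tile) (p : ℤ × ℤ) : Prop where
  exists_visit : ∀ s ∈ T.strands, ∃ c, G.q c = p ∧
    strandCurve edgeMidpoints (2 • p) s = G.visitCurve c
  exists_strand : ∀ c, G.q c = p → ∃ s ∈ T.strands,
    strandCurve edgeMidpoints (2 • p) s = G.visitCurve c
  hasEnd_iff : ∀ x, T.HasEnd x ↔ ∃ c, G.q c = p ∧ (x = G.D c ∨ x = G.inn c)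

theorem horizontal_or_vertical : ∀ d : Fin 4,
    ((d : ℕ) % 2 = 0 → (d = 0 ∧ d + 2 = 2 ∨ d = 2 ∧ d + 2 = 0)) ∧
    ((d : ℕ) % 2 ≠ 0 → (d = 1 ∧ d + 2 = 3 ∨ d = 3 ∧ d + 2 = 1)) := by decide

theorem visitCurve_of_straight {c : V} (h : G.inn c = G.D c + 2) :
    ((G.D c : ℕ) % 2 = 0 → G.visitCurve c =
      strandCurve edgeMidpoints (2 • G.q c) ⟨0, 2, G.upper c⟩ ∧
      ∀ x, (x = G.D c ∨ x = G.inn c) ↔ x = 0 ∨ x = 2) ∧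
    ((G.D c : ℕ) % 2 ≠ 0 → G.visitCurve c =
      strandCurve edgeMidpoints (2 • G.q c) ⟨1, 3, G.upper c⟩ ∧
      ∀ x, (x = G.D c ∨ x = G.inn c) ↔ x = 1 ∨ x = 3) := by
  obtain ⟨h1, h2⟩ := horizontal_or_vertical (G.D c)
  unfold visitCurve
  rw [h]
  refine ⟨fun e => ?_, fun e => ?_⟩
  · rcases h1 e with ⟨e1, e2⟩ | ⟨e1, e2⟩ <;> rw [e2, e1]
    · exact ⟨strandCurve_swap _ _ _ _ _, fun x => Iff.rfl⟩
    · exact ⟨rfl, fun x => or_comm⟩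
  · rcases h2 e with ⟨e1, e2⟩ | ⟨e1, e2⟩ <;> rw [e2, e1]
    · exact ⟨strandCurve_swap _ _ _ _ _, fun x => Iff.rfl⟩
    · exact ⟨rfl, fun x => or_comm⟩

theorem exists_shows_crossing {a b : V} (hab : a ≠ b) (hq : G.q a = G.q b)
    (ha : (G.D a : ℕ) % 2 = 0) : ∃ T, G.Shows T (G.q a) := by
  obtain ⟨i1, i2, i3, i4⟩ := G.crossing' hab hq
  have hb : (G.D b : ℕ) % 2 ≠ 0 := fun e => i3 (ha.trans e.symm)
  obtain ⟨va, ea⟩ := (G.visitCurve_of_straight i1).1 ha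
  obtain ⟨vb, eb⟩ := (G.visitCurve_of_straight i2).2 hb
  have hup : G.upper b = !G.upper a := by
    rcases lt_or_gt_of_ne i4 with h | h
    · rw [(G.upper_eq hq h).1, (G.upper_eq hq h).2]; rfl
    · rw [(G.upper_eq hq.symm h).1, (G.upper_eq hq.symm h).2]; rfl
  have honly : ∀ c, G.q c = G.q a → c = a ∨ c = b := by
    intro c hc
    by_contra! hne
    have j1 := (G.crossing' hne.1 hc).2.2.1
    have j2 := (G.crossing' hne.2 (hc.trans hq)).2.2.1
    omega
  refine ⟨.crossing (G.upper a), ?_, ?_, ?_⟩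
  · intro s hs
    simp only [Tile.strands, List.mem_cons, List.not_mem_nil, or_false] at hs
    rcases hs with rfl | rfl
    · exact ⟨a, rfl, va.symm⟩
    · exact ⟨b, hq.symm, by rw [vb, hup, hq]⟩
  · intro c hc
    simp only [Tile.strands, List.mem_cons, List.not_mem_nil, or_false]
    rcases honly c hc with rfl | rfl
    · exact ⟨_, Or.inl rfl, va.symm⟩
    · exact ⟨_, Or.inr rfl, by rw [vb, hup, hq]⟩
  · intro x
    simp only [Tile.HasEnd, Tile.strands, List.mem_cons, List.not_mem_nil, or_false,
      exists_eq_or_imp, exists_eq_left]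
    rw [← ea, ← eb]
    constructor
    · rintro (h | h)
      · exact ⟨a, rfl, h⟩
      · exact ⟨b, hq.symm, h⟩
    · rintro ⟨c, hc, h⟩
      rcases honly c hc with rfl | rfl
      · exact Or.inl h
      · exact Or.inr h

/-- A square is visited not at all, once or twice: this calls for the blank tile, a tile with one
curve, or a crossing. Tiles with two arcs do not occur, because two visits of a square cross
transversally. -/
theorem exists_shows (p : ℤ × ℤ) : ∃ T, G.Shows T p := by
  by_cases h1 : ∃ a, G.q a = p
  · obtain ⟨a, rfl⟩ := h1
    by_cases h2 : ∃ b, a ≠ b ∧ G.q a = G.q b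
    · obtain ⟨b, hab, hq⟩ := h2
      by_cases ha : (G.D a : ℕ) % 2 = 0
      · exact G.exists_shows_crossing hab hq ha
      · have := (G.crossing' hab hq).2.2.1
        rw [hq]
        exact G.exists_shows_crossing hab.symm hq.symm (by omega)
    · push Not at h2
      have honly : ∀ c, G.q c = G.q a → c = a := fun c hc => by
        by_contra hne
        exact h2 c (Ne.symm hne) hc.symm
      have hup : G.upper a = false := by
        rw [upper, decide_eq_false_iff_not]
        rintro ⟨b, hb, hlt⟩
        rw [honly b hb] at hlt
        exact lt_irrefl _ hlt
      obtain ⟨T, hT⟩ := exists_tile_strands _ _ (G.inn_ne a)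
      have hcurve : ∀ s ∈ T.strands, strandCurve edgeMidpoints (2 • G.q a) s = G.visitCurve a := by
        intro s hs
        rcases hT with hT | hT <;> rw [hT] at hs <;>
          simp only [List.mem_cons, List.not_mem_nil, or_false] at hs <;> subst hs <;>
          rw [visitCurve, hup]
        exact strandCurve_swap _ _ _ _ _
      refine ⟨T, fun s hs => ⟨a, rfl, hcurve s hs⟩, fun c hc => ?_, fun x => ?_⟩
      · rw [honly c hc]
        rcases hT with hT | hT
        · exact ⟨_, by rw [hT]; exact List.mem_cons_self, hcurve _ (by rw [hT]; exact List.mem_cons_self)⟩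
        · exact ⟨_, by rw [hT]; exact List.mem_cons_self, hcurve _ (by rw [hT]; exact List.mem_cons_self)⟩
      · have : T.HasEnd x ↔ (x = G.D a ∨ x = G.inn a) := by
          rcases hT with hT | hT <;> simp [Tile.HasEnd, hT, or_comm]
        rw [this]
        exact ⟨fun h => ⟨a, rfl, h⟩, fun ⟨c, hc, h⟩ => honly c hc ▸ h⟩
  · push Not at h1
    exact ⟨.blank, by simp [Tile.strands], fun c hc => absurd hc (h1 c), fun x => by
      simp only [Tile.HasEnd, Tile.strands, List.not_mem_nil, false_and, exists_false, false_iff]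
      rintro ⟨c, hc, -⟩
      exact h1 c hc⟩

/-- The square of a tile. -/
def square {n : ℕ} (t : Fin n × Fin n) : ℤ × ℤ := ((t.2 : ℕ), -((t.1 : ℕ) : ℤ))

theorem centre_eq {n : ℕ} (t : Fin n × Fin n) : centre t = 2 • square t := by
  simp only [centre, square, Prod.smul_mk, nsmul_eq_mul]
  push_cast
  ring_nf

theorem square_injective {n : ℕ} : Function.Injective (square (n := n)) := by
  rintro ⟨i, j⟩ ⟨i', j'⟩ h
  simp only [square, Prod.mk.injEq, neg_inj, Nat.cast_inj] at h
  exact Prod.ext (Fin.ext h.2) (Fin.ext h.1)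

theorem exists_square {n : ℕ} {p : ℤ × ℤ} (h1 : 0 ≤ p.1) (h2 : p.1 < n) (h3 : p.2 ≤ 0)
    (h4 : -(n : ℤ) < p.2) : ∃ t : Fin n × Fin n, square t = p :=
  ⟨(⟨(-p.2).toNat, by omega⟩, ⟨p.1.toNat, by omega⟩), by
    refine Prod.ext ?_ ?_ <;> simp only [square] <;> omega⟩

theorem edgeMidpoints_ne_zero (d : Fin 4) : edgeMidpoints d ≠ 0 := by
  fin_cases d <;> decide

/-- A grid path is the curve of a mosaic of traditional tiles. -/
theorem exists_mosaic [Fintype V] (k : V → ℝ) (n : ℕ)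
    (hG : ∀ a, ∃ t : Fin n × Fin n, square t = G.q a) :
    ∃ M : TileArray n, IsMosaic edgeMidpoints M ∧
      AmbientIsotopic (cycCurve (next2 G.σ) (G.polygon k 0)) (curve edgeMidpoints M) := by
  choose T hT using G.exists_shows
  refine ⟨fun t => T (square t), ?_, ?_⟩
  · rintro t x ⟨p, hp, rfl⟩
    rw [(hT (square t)).hasEnd_iff] at hp
    obtain ⟨c, hc, rfl | rfl⟩ := hp
    · obtain ⟨t', ht'⟩ := hG (G.σ c)
      refine ⟨t', fun e => ?_, G.D c + 2, ?_, ?_⟩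
      · rw [e, ← hc, G.q_next, left_eq_add] at ht'
        exact edgeMidpoints_ne_zero _ ht'
      · rw [(hT (square t')).hasEnd_iff]
        exact ⟨G.σ c, ht'.symm, Or.inr (G.inn_next c).symm⟩
      · rw [centre_eq, centre_eq, ht', G.q_next, hc, edgeMidpoints_add_two]
        abel
    · obtain ⟨a, rfl⟩ := G.σ.surjective c
      obtain ⟨t', ht'⟩ := hG a
      refine ⟨t', fun e => ?_, G.D a, ?_, ?_⟩
      · rw [e, ← hc, G.q_next, add_eq_left] at ht'
        exact edgeMidpoints_ne_zero _ ht'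
      · rw [(hT (square t')).hasEnd_iff]
        exact ⟨a, ht'.symm, Or.inl rfl⟩
      · rw [centre_eq, centre_eq, ht', ← hc, G.q_next, inn_next, edgeMidpoints_add_two]
        abel
  · have hcurve : curve edgeMidpoints (fun t : Fin n × Fin n => T (square t)) = ⋃ c, G.visitCurve c := by
      ext x
      simp only [curve, mem_iUnion, centre_eq]
      constructor
      · rintro ⟨t, s, hs, hx⟩
        obtain ⟨c, -, hc⟩ := (hT (square t)).exists_visit s hs
        exact ⟨c, hc ▸ hx⟩
      · rintro ⟨c, hx⟩
        obtain ⟨t, ht⟩ := hG c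
        obtain ⟨s, hs, hc⟩ := (hT (square t)).exists_strand c ht.symm
        exact ⟨t, s, hs, hc ▸ hx⟩
    -- At `s = 1` the vertices are the middle points of the strands and the side midpoints at height
    -- `0`, exactly as in `strandCurve`.
    have hpoly : cycCurve (next2 G.σ) (G.polygon k 1) = ⋃ c, G.visitCurve c := by
      have hmid : ∀ a, G.polygonPoint k 1 a 1 =
          ![(((2 • G.q (G.σ a)).1 + (edgeMidpoints (G.inn (G.σ a))).1 : ℤ) : ℝ),
            (((2 • G.q (G.σ a)).2 + (edgeMidpoints (G.inn (G.σ a))).2 : ℤ) : ℝ), 0] := by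
        intro a
        rw [inn_next, edgeMidpoints_add_two, G.q_next]
        refine space_ext ?_ ?_ ?_ <;> simp [polygonPoint] <;> ring
      have hmid' : ∀ a, G.polygonPoint k 1 a 1 =
          ![(((2 • G.q a).1 + (edgeMidpoints (G.D a)).1 : ℤ) : ℝ),
            (((2 • G.q a).2 + (edgeMidpoints (G.D a)).2 : ℤ) : ℝ), 0] := by
        intro a
        refine space_ext ?_ ?_ ?_ <;> simp [polygonPoint]
      have hW : ∀ a, G.polygonPoint k 1 a 0 =
          ![((2 • G.q a).1 : ℝ) +
              (((edgeMidpoints (G.inn a)).1 : ℝ) + ((edgeMidpoints (G.D a)).1 : ℝ)) / 4,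
            ((2 • G.q a).2 : ℝ) +
              (((edgeMidpoints (G.inn a)).2 : ℝ) + ((edgeMidpoints (G.D a)).2 : ℝ)) / 4,
            if G.upper a then 1 else 0] := by
        intro a
        refine space_ext ?_ ?_ ?_ <;> simp [polygonPoint, add_comm]
      rw [cycCurve_subdiv _ _ _ _ (G.polygonPoint_closes k 1)]
      ext x
      simp only [mem_iUnion]
      constructor
      · rintro ⟨a, m, hm, hx⟩
        have : m = 0 ∨ m = 1 := by omega
        rcases this with rfl | rfl
        · refine ⟨a, Or.inr ?_⟩
          rw [zero_add, hW, hmid'] at hx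
          exact hx
        · refine ⟨G.σ a, Or.inl ?_⟩
          change x ∈ segment ℝ (G.polygonPoint k 1 a 1) (G.polygonPoint k 1 (G.σ a) 0) at hx
          rw [hW, hmid] at hx
          exact hx
      · rintro ⟨c, hx | hx⟩
        · obtain ⟨a, rfl⟩ := G.σ.surjective c
          refine ⟨a, 1, by norm_num, ?_⟩
          change x ∈ segment ℝ (G.polygonPoint k 1 a 1) (G.polygonPoint k 1 (G.σ a) 0)
          rw [hW, hmid]
          exact hx
        · refine ⟨c, 0, by norm_num, ?_⟩
          rw [zero_add, hW, hmid']
          exact hx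
    rw [hcurve, ← hpoly]
    refine ambientIsotopic_of_cycEmb (subdivNext_injective _ _ _ G.σ.injective) _ _
      fun s hs0 hs1 => ?_
    convert G.cycEmb_polygon k hs0 hs1 using 1
    funext ⟨a, r⟩
    fin_cases r
    · refine space_ext ?_ ?_ ?_ <;> simp [polygon, polygonPoint] <;> ring
    · refine space_ext ?_ ?_ ?_ <;> simp [polygon, polygonPoint] <;> ring

end GridPath

/-! ### From staircases to grid paths -/

/-- Ranks of the values of a function. -/
theorem exists_rank {W : Type*} [Fintype W] (f : W → ℝ) :
    ∃ r : W → ℕ, (∀ a, r a < Fintype.card W) ∧ ∀ a b, f a < f b → r a < r b := by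
  classical
  refine ⟨fun a => (Finset.univ.filter fun b => f b < f a).card, fun a => ?_, fun a b h => ?_⟩
  · refine Finset.card_lt_univ_of_notMem (x := a) ?_
    simp
  · refine Finset.card_lt_card ⟨fun c hc => ?_, fun hs => ?_⟩
    · simp only [Finset.mem_filter, Finset.mem_univ, true_and] at hc ⊢
      exact hc.trans h
    · have := hs (show a ∈ _ by simpa using h)
      simp at this

section Grid
variable {W : Type} (next : W → W) (X Y : W → ℤ) (z : W → ℝ)

/-- The distance from `a` to the next vertex in one coordinate. -/
def arm (f : W → ℤ) (a : W) : ℕ := (f (next a) - f a).natAbs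

/-- The direction from `a` to the next vertex in one coordinate. -/
def dir (f : W → ℤ) (a : W) : ℤ := (f (next a) - f a).sign

theorem dir_mul_arm (f : W → ℤ) (a : W) : dir next f a * arm next f a = f (next a) - f a :=
  Int.sign_mul_natAbs _

variable {next} in
theorem arm_pos {f : W → ℤ} {a : W} (h : f (next a) ≠ f a) : 0 < arm next f a :=
  Int.natAbs_pos.2 (sub_ne_zero.2 h)

variable {next} in
theorem dir_ne_zero {f : W → ℤ} {a : W} (h : f (next a) ≠ f a) : dir next f a ≠ 0 :=
  fun e => h (sub_eq_zero.1 (Int.sign_eq_zero_iff_zero.1 e))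

variable {next} in
theorem dir_cases {f : W → ℤ} {a : W} (h : f (next a) ≠ f a) :
    f a < f (next a) ∧ dir next f a = 1 ∨ ¬ f a < f (next a) ∧ dir next f a = -1 := by
  rcases lt_or_gt_of_ne h with h | h
  · exact Or.inr ⟨h.not_gt, Int.sign_eq_neg_one_of_neg (by omega)⟩
  · exact Or.inl ⟨h, Int.sign_eq_one_of_pos (by omega)⟩

/-- The number of steps from `a` to the next vertex. -/
def gridLength (a : W) : ℕ := arm next X a + arm next Y a

/-- The `m`-th square on the way from `a` to the next vertex. -/
def gridPoint (a : W) (m : ℕ) : ℤ × ℤ :=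
  (X a + dir next X a * (min m (arm next X a) : ℕ), Y a + dir next Y a * (m - arm next X a : ℕ))

/-- The direction of the `m`-th step. -/
def gridDir (a : W) (m : ℕ) : Fin 4 :=
  if m < arm next X a then (if X a < X (next a) then 0 else 2)
  else if Y a < Y (next a) then 1 else 3

/-- The height at the `m`-th square. -/
def gridHeight (a : W) (m : ℕ) : ℝ := if m ≤ arm next X a then z a else z (next a)

theorem gridPoint_closes (a : W) :
    gridPoint next X Y a (gridLength next X Y a) = gridPoint next X Y (next a) 0 := by
  simp [gridPoint, gridLength, dir_mul_arm]

/-- The bend itself still has the old height, so at least one vertical step is needed to arrive at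
the new one. -/
theorem gridHeight_closes {a : W} (hY : 0 < arm next Y a) :
    gridHeight next X z a (gridLength next X Y a) = gridHeight next X z (next a) 0 := by
  rw [gridHeight, if_neg (by unfold gridLength; omega), gridHeight, if_pos (Nat.zero_le _)]

variable {next X Y}

theorem edgeMidpoints_gridDir {a : W} (hX : X (next a) ≠ X a) (hY : Y (next a) ≠ Y a) (m : ℕ) :
    edgeMidpoints (gridDir next X Y a m) =
      if m < arm next X a then (dir next X a, 0) else (0, dir next Y a) := by
  unfold gridDir
  split_ifs with h h1 h1
  · rcases dir_cases hX with e | e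
    · rw [e.2]; rfl
    · exact absurd h1 e.1
  · rcases dir_cases hX with e | e
    · exact absurd e.1 h1
    · rw [e.2]; rfl
  · rcases dir_cases hY with e | e
    · rw [e.2]; rfl
    · exact absurd h1 e.1
  · rcases dir_cases hY with e | e
    · exact absurd e.1 h1
    · rw [e.2]; rfl

theorem gridPoint_succ {a : W} (hX : X (next a) ≠ X a) (hY : Y (next a) ≠ Y a) (m : ℕ) :
    gridPoint next X Y a (m + 1) =
      gridPoint next X Y a m + edgeMidpoints (gridDir next X Y a m) := by
  rw [edgeMidpoints_gridDir hX hY]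
  split_ifs with h
  · refine Prod.ext ?_ ?_
    · simp only [gridPoint, Prod.fst_add]
      rw [min_eq_left (by omega), min_eq_left (by omega)]
      push_cast; ring
    · simp only [gridPoint, Prod.snd_add]
      rw [Nat.sub_eq_zero_of_le (by omega), Nat.sub_eq_zero_of_le (by omega), add_zero]
  · refine Prod.ext ?_ ?_
    · simp only [gridPoint, Prod.fst_add]
      rw [min_eq_right (by omega), min_eq_right (by omega), add_zero]
    · simp only [gridPoint, Prod.snd_add]
      rw [Nat.succ_sub (by omega)]
      push_cast; ring

theorem gridDir_mod (a : W) (m : ℕ) :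
    (gridDir next X Y a m : ℕ) % 2 = if m < arm next X a then 0 else 1 := by
  unfold gridDir
  split_ifs <;> rfl

theorem gridDir_eq {a : W} {m m' : ℕ} (h : m < arm next X a ↔ m' < arm next X a) :
    gridDir next X Y a m = gridDir next X Y a m' := by
  simp only [gridDir, h]

/-- Two visits of one square: one moves straight on in a horizontal, one in a vertical way. -/
theorem gridPoint_crossing (hn : Function.Injective next) (hX : Function.Injective X)
    (hY : Function.Injective Y) (hne : ∀ a, next a ≠ a) {a b : W} {m m' : ℕ}
    (hm : m < gridLength next X Y a) (hm' : m' < gridLength next X Y b)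
    (h : gridPoint next X Y a m = gridPoint next X Y b m') :
    (a = b ∧ m = m') ∨
      (0 < m ∧ m < arm next X a ∧ arm next X b < m' ∧ a ≠ next b) ∨
      (0 < m' ∧ m' < arm next X b ∧ arm next X a < m ∧ b ≠ next a) := by
  have hX' : ∀ a, X (next a) ≠ X a := fun a e => hne a (hX e)
  have hY' : ∀ a, Y (next a) ≠ Y a := fun a e => hne a (hY e)
  -- A horizontal part fills the row of `a`, a vertical part the column of `next b`. By injectivity
  -- two parts of the same kind coincide only for the same index, so only mixed pairs can cross. The
  -- case `a = next b` is excluded because the vertical part reaches that row only at its end, which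
  -- counts as the start of the next part.
  have cross : ∀ a b m m', m ≤ arm next X a → arm next X b < m' → m' < gridLength next X Y b →
      gridPoint next X Y a m = gridPoint next X Y b m' →
      0 < m ∧ m < arm next X a ∧ arm next X b < m' ∧ a ≠ next b := by
    intro a b m m' h1 h2 h3 h
    have e1 := congrArg Prod.fst h
    have e2 := congrArg Prod.snd h
    simp only [gridPoint] at e1 e2
    rw [min_eq_left h1, min_eq_right h2.le, dir_mul_arm, add_sub_cancel] at e1
    rw [Nat.sub_eq_zero_of_le h1, Nat.cast_zero, mul_zero, add_zero] at e2
    have key : a ≠ next b := by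
      intro e
      have e3 := dir_mul_arm next Y b
      rw [e] at e2
      have : dir next Y b * ((m' - arm next X b : ℕ) - arm next Y b : ℤ) = 0 := by
        rw [mul_sub]; linarith
      rcases mul_eq_zero.1 this with h | h
      · exact dir_ne_zero (hY' b) h
      · unfold gridLength at h3; omega
    have hm0 : m ≠ 0 := by
      rintro rfl
      rw [Nat.cast_zero, mul_zero, add_zero] at e1
      exact key (hX e1)
    refine ⟨Nat.pos_of_ne_zero hm0, lt_of_le_of_ne h1 ?_, h2, key⟩
    rintro rfl
    rw [dir_mul_arm, add_sub_cancel] at e1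
    obtain rfl := hn (hX e1)
    have : dir next Y a * (m' - arm next X a : ℕ) = 0 := by linarith
    rcases mul_eq_zero.1 this with h | h
    · exact dir_ne_zero (hY' a) h
    · omega
  by_cases h1 : m ≤ arm next X a <;> by_cases h2 : m' ≤ arm next X b
  · left
    have e1 := congrArg Prod.fst h
    have e2 := congrArg Prod.snd h
    simp only [gridPoint] at e1 e2
    rw [Nat.sub_eq_zero_of_le h1, Nat.sub_eq_zero_of_le h2, Nat.cast_zero, mul_zero, mul_zero,
      add_zero, add_zero] at e2
    obtain rfl := hY e2
    rw [min_eq_left h1, min_eq_left h2] at e1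
    refine ⟨rfl, ?_⟩
    exact_mod_cast mul_left_cancel₀ (dir_ne_zero (hX' a)) (add_left_cancel e1)
  · exact Or.inr (Or.inl (cross a b m m' h1 (not_le.1 h2) hm' h))
  · exact Or.inr (Or.inr (cross b a m' m h2 (not_le.1 h1) hm h.symm))
  · left
    push Not at h1 h2
    have e1 := congrArg Prod.fst h
    have e2 := congrArg Prod.snd h
    simp only [gridPoint] at e1 e2
    rw [min_eq_right h1.le, min_eq_right h2.le, dir_mul_arm, dir_mul_arm, add_sub_cancel,
      add_sub_cancel] at e1
    obtain rfl := hn (hX e1)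
    refine ⟨rfl, ?_⟩
    have := mul_left_cancel₀ (dir_ne_zero (hY' a)) (add_left_cancel e2)
    omega

variable (hn : Function.Injective next) (hX : Function.Injective X)
  (hY : Function.Injective Y) (hz : Function.Injective z) (hne : ∀ a, next a ≠ a)

theorem gridLength_pos (hX : Function.Injective X) (hne : ∀ a, next a ≠ a) (a : W) :
    0 < gridLength next X Y a :=
  Nat.add_pos_left (arm_pos fun e => hne a (hX e)) _

/-- The grid path over a staircase. -/
def stairGrid [Finite W] : GridPath (Σ a, Fin (gridLength next X Y a)) where
  σ := Equiv.ofBijective _ (Finite.injective_iff_bijective.1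
    (subdivNext_injective (gridLength next X Y) (gridLength_pos hX hne) next hn))
  q y := gridPoint next X Y y.1 y.2
  D y := gridDir next X Y y.1 y.2
  h y := gridHeight next X z y.1 y.2
  q_next y := by
    rw [Equiv.ofBijective_apply, subdiv_next_apply _ _ _ _ (gridPoint_closes next X Y),
      gridPoint_succ (fun e => hne _ (hX e)) (fun e => hne _ (hY e))]
  no_reversal := by
    -- A reversal keeps the parity of the direction. The parity changes at every bend and at every
    -- vertex, and elsewhere the direction is constant.
    have hpar : ∀ d e : Fin 4, d = e + 2 → (d : ℕ) % 2 = (e : ℕ) % 2 := by decide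
    have hself : ∀ d : Fin 4, d ≠ d + 2 := by decide
    rintro ⟨a, m, hm⟩ h
    rw [Equiv.ofBijective_apply] at h
    have h' := hpar _ _ h
    by_cases hlt : m + 1 < gridLength next X Y a
    · rw [subdivNext_of_lt _ _ _ hm hlt] at h h'
      simp only [gridDir_mod] at h'
      refine hself _ ((gridDir_eq ?_).trans h)
      split_ifs at h' with h1 h2 h2 <;> simp [h1, h2]
    · have heq : m + 1 = gridLength next X Y a := by omega
      rw [subdivNext_of_eq _ _ _ hm heq] at h'
      simp only [gridDir_mod] at h'
      have h1 := arm_pos (next := next) (f := X) (a := next a) fun e => hne _ (hX e)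
      have h2 := arm_pos (next := next) (f := Y) (a := a) fun e => hne _ (hY e)
      rw [if_pos h1, if_neg (by unfold gridLength at heq; omega)] at h'
      exact zero_ne_one h'
  crossing := by
    -- The path goes straight on except at the start of a part (`0`) and at its bend (`arm`); by
    -- `gridPoint_crossing` no crossing lies there.
    have hD : ∀ x : Σ a, Fin (gridLength next X Y a), ∀ y,
        subdivNext (gridLength next X Y) (gridLength_pos hX hne) next x = y → 0 < (y.2 : ℕ) →
        (y.2 : ℕ) ≠ arm next X y.1 → gridDir next X Y y.1 y.2 = gridDir next X Y x.1 x.2 := by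
      rintro ⟨a, m, hm⟩ y rfl h1 h2
      by_cases hlt : m + 1 < gridLength next X Y a
      · rw [subdivNext_of_lt _ _ _ hm hlt] at h1 h2 ⊢
        refine gridDir_eq ?_
        simp only at h2 ⊢
        omega
      · have heq : m + 1 = gridLength next X Y a := by omega
        rw [subdivNext_of_eq _ _ _ hm heq] at h1
        exact absurd h1 (lt_irrefl _)
    have main : ∀ x x' : Σ a, Fin (gridLength next X Y a), ∀ y y',
        subdivNext (gridLength next X Y) (gridLength_pos hX hne) next x = y →
        subdivNext (gridLength next X Y) (gridLength_pos hX hne) next x' = y' →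
        x ≠ x' → gridPoint next X Y y.1 y.2 = gridPoint next X Y y'.1 y'.2 →
        gridDir next X Y y.1 y.2 = gridDir next X Y x.1 x.2 ∧
        gridDir next X Y y'.1 y'.2 = gridDir next X Y x'.1 x'.2 ∧
        (gridDir next X Y x.1 x.2 : ℕ) % 2 ≠ (gridDir next X Y x'.1 x'.2 : ℕ) % 2 ∧
        gridHeight next X z y.1 y.2 ≠ gridHeight next X z y'.1 y'.2 := by
      intro x x' y y' hxy hxy' hne' hq
      have hxx : y ≠ y' := fun e =>
        hne' (subdivNext_injective _ _ _ hn (hxy.trans (e.trans hxy'.symm)))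
      have hDx := hD x _ hxy
      have hDx' := hD x' _ hxy'
      rcases gridPoint_crossing hn hX hY hne y.2.2 y'.2.2 hq with h | h | h
      · refine absurd ?_ hxx
        obtain ⟨a, m⟩ := y
        obtain ⟨a', m'⟩ := y'
        obtain ⟨h1, h2⟩ := h
        simp only at h1 h2
        subst h1
        rw [Fin.ext h2]
      · have e1 := hDx h.1 h.2.1.ne
        have e2 := hDx' (by omega) (by omega)
        refine ⟨e1, e2, ?_, ?_⟩
        · rw [← e1, ← e2, gridDir_mod, gridDir_mod, if_pos h.2.1, if_neg (by omega)]
          exact zero_ne_one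
        · rw [gridHeight, gridHeight, if_pos h.2.1.le, if_neg (by omega)]
          exact fun e => h.2.2.2 (hz e)
      · have e1 := hDx (by omega) (by omega)
        have e2 := hDx' h.1 h.2.1.ne
        refine ⟨e1, e2, ?_, ?_⟩
        · rw [← e1, ← e2, gridDir_mod, gridDir_mod, if_pos h.2.1, if_neg (by omega)]
          exact one_ne_zero
        · rw [gridHeight, gridHeight, if_pos h.2.1.le, if_neg (by omega)]
          exact fun e => h.2.2.2 (hz e.symm)
    exact fun x x' => main x x' _ _ rfl rfl

end Grid

/-! ### The grid path lies under the staircase -/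

section
variable {W : Type} (next : W → W) (X Y : W → ℤ) (z : W → ℝ)

/-- The staircase over the centres of grid squares. -/
def gridVertex (a : W) : Space := ![2 * X a, 2 * Y a, z a]

/-- Half steps along the grid path. -/
def halfStep (a : W) (r : ℕ) : Space :=
  if r ≤ 2 * arm next X a then ![2 * X a + dir next X a * r, 2 * Y a, z a]
  else ![2 * X (next a), 2 * Y a + dir next Y a * (r - 2 * arm next X a), z (next a)]

theorem cast_dir_mul_arm (f : W → ℤ) (a : W) :
    (dir next f a : ℝ) * arm next f a = f (next a) - f a := by
  exact_mod_cast dir_mul_arm next f a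

theorem halfStep_even (a : W) (m : ℕ) :
    halfStep next X Y z a (2 * m) =
      (![2 * (gridPoint next X Y a m).1, 2 * (gridPoint next X Y a m).2,
        gridHeight next X z a m] : Space) := by
  have := cast_dir_mul_arm next X a
  unfold halfStep gridPoint gridHeight
  by_cases h : m ≤ arm next X a
  · rw [if_pos (by omega), if_pos h, min_eq_left h, Nat.sub_eq_zero_of_le h]
    refine space_ext ?_ ?_ ?_ <;> simp
    ring
  · rw [if_neg (by omega), if_neg h, min_eq_right (by omega)]
    have hc : ((m - arm next X a : ℕ) : ℝ) = m - arm next X a := Nat.cast_sub (by omega)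
    refine space_ext ?_ ?_ ?_
    · simp; linarith
    · simp [hc]; ring
    · simp

variable {next} in
theorem halfStep_odd {a : W} (hX : X (next a) ≠ X a) (hY : Y (next a) ≠ Y a) (m : ℕ) :
    halfStep next X Y z a (2 * m + 1) =
      (![2 * (gridPoint next X Y a m).1 + (edgeMidpoints (gridDir next X Y a m)).1,
        2 * (gridPoint next X Y a m).2 + (edgeMidpoints (gridDir next X Y a m)).2,
        if m < arm next X a then z a else z (next a)] : Space) := by
  have := cast_dir_mul_arm next X a
  rw [edgeMidpoints_gridDir hX hY]
  unfold halfStep gridPoint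
  by_cases h : m < arm next X a
  · rw [if_pos (by omega), if_pos h, if_pos h, min_eq_left h.le, Nat.sub_eq_zero_of_le h.le]
    refine space_ext ?_ ?_ ?_ <;> simp
    ring
  · rw [if_neg (by omega), if_neg h, if_neg h, min_eq_right (by omega)]
    have hc : ((m - arm next X a : ℕ) : ℝ) = m - arm next X a := Nat.cast_sub (by omega)
    refine space_ext ?_ ?_ ?_
    · simp; linarith
    · simp [hc]; ring
    · simp

-- The tilt `dir next Y a` of the staircase is exactly one half step. So its three edges consist of
-- `2 * arm next X a` half steps, one half step, and the remaining `2 * arm next Y a - 1` half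
-- steps; the height changes only in the middle one.
variable {next} in
theorem iUnion_halfStep {a : W} (hX : X (next a) ≠ X a) (hY : Y (next a) ≠ Y a) :
    ⋃ r, ⋃ _ : r < 2 * gridLength next X Y a,
        segment ℝ (halfStep next X Y z a r) (halfStep next X Y z a (r + 1)) =
      ⋃ m, ⋃ _ : m < 3, segment ℝ
        (stairPoint next (gridVertex X Y z) (fun a => dir next Y a) a m)
        (stairPoint next (gridVertex X Y z) (fun a => dir next Y a) a (m + 1)) := by
  have eX := cast_dir_mul_arm next X a
  have eY := cast_dir_mul_arm next Y a
  have pX := arm_pos hX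
  have pY := arm_pos hY
  set P := stairPoint next (gridVertex X Y z) (fun a => dir next Y a) a with hP
  have h1 : ∀ r ≤ 2 * arm next X a,
      halfStep next X Y z a r = P 0 + (r : ℝ) • ![(dir next X a : ℝ), 0, 0] := by
    intro r hr
    rw [halfStep, if_pos hr]
    refine space_ext ?_ ?_ ?_ <;> simp [hP, stairPoint, gridVertex]
    ring
  have h2 : ∀ r, halfStep next X Y z a (2 * arm next X a + 1 + r) =
      P 2 + (r : ℝ) • ![0, (dir next Y a : ℝ), 0] := by
    intro r
    rw [halfStep, if_neg (by omega)]
    refine space_ext ?_ ?_ ?_ <;> simp [hP, stairPoint, gridVertex]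
    ring
  have h3 : P 0 + ((2 * arm next X a : ℕ) : ℝ) • ![(dir next X a : ℝ), 0, 0] = P 1 := by
    refine space_ext ?_ ?_ ?_ <;> simp [hP, stairPoint, gridVertex]
    linarith
  have h4 : P 2 + ((2 * arm next Y a - 1 : ℕ) : ℝ) • ![0, (dir next Y a : ℝ), 0] = P 3 := by
    have hc : ((2 * arm next Y a - 1 : ℕ) : ℝ) = 2 * arm next Y a - 1 := by
      rw [Nat.cast_sub (by omega)]; simp
    refine space_ext ?_ ?_ ?_ <;> simp [hP, stairPoint, gridVertex, hc]
    linarith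
  have s1 := iUnion_segment_eq (P 0) ![(dir next X a : ℝ), 0, 0] (fun r => (r : ℝ))
    Nat.mono_cast Nat.cast_zero (2 * arm next X a - 1)
  have s2 := iUnion_segment_eq (P 2) ![0, (dir next Y a : ℝ), 0] (fun r => (r : ℝ))
    Nat.mono_cast Nat.cast_zero (2 * arm next Y a - 2)
  rw [show 2 * arm next X a - 1 + 1 = 2 * arm next X a by omega, h3] at s1
  rw [show 2 * arm next Y a - 2 + 1 = 2 * arm next Y a - 1 by omega, h4] at s2
  ext x
  have t1 := Set.ext_iff.1 s1 x
  have t2 := Set.ext_iff.1 s2 x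
  simp only [mem_iUnion, exists_prop] at t1 t2 ⊢
  constructor
  · rintro ⟨r, hr, hx⟩
    rcases lt_trichotomy r (2 * arm next X a) with h | rfl | h
    · refine ⟨0, by norm_num, t1.1 ⟨r, h, ?_⟩⟩
      rwa [h1 r h.le, h1 (r + 1) h] at hx
    · refine ⟨1, by norm_num, ?_⟩
      have := h2 0
      rw [Nat.cast_zero, zero_smul, add_zero, add_zero] at this
      rwa [h1 _ le_rfl, h3, this] at hx
    · obtain ⟨j, rfl⟩ := Nat.exists_eq_add_of_le (show 2 * arm next X a + 1 ≤ r from h)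
      refine ⟨2, by norm_num, t2.1 ⟨j, ?_, ?_⟩⟩
      · unfold gridLength at hr; omega
      · rwa [add_assoc (2 * arm next X a + 1), h2, h2] at hx
  · rintro ⟨m, hm, hx⟩
    obtain rfl | rfl | rfl : m = 0 ∨ m = 1 ∨ m = 2 := by omega
    · obtain ⟨r, hr, hx⟩ := t1.2 hx
      refine ⟨r, by unfold gridLength; omega, ?_⟩
      rwa [h1 r hr.le, h1 (r + 1) hr]
    · refine ⟨2 * arm next X a, by unfold gridLength; omega, ?_⟩
      have := h2 0
      rw [Nat.cast_zero, zero_smul, add_zero, add_zero] at this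
      rwa [h1 _ le_rfl, h3, this]
    · obtain ⟨j, hj, hx⟩ := t2.2 hx
      refine ⟨2 * arm next X a + 1 + j, by unfold gridLength; omega, ?_⟩
      rwa [add_assoc (2 * arm next X a + 1), h2, h2]

variable {next X Y z} [Finite W] (hn : Function.Injective next) (hX : Function.Injective X)
  (hY : Function.Injective Y) (hz : Function.Injective z) (hne : ∀ a, next a ≠ a)

theorem cycCurve_stairGrid :
    cycCurve (GridPath.next2 (stairGrid z hn hX hY hz hne).σ) ((stairGrid z hn hX hY hz hne).polygon
      (fun y => if y.2 < arm next X y.1 then z y.1 else z (next y.1)) 0) =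
    cycCurve (next3 next) (stair next (gridVertex X Y z) fun a => dir next Y a) := by
  set G := stairGrid z hn hX hY hz hne with hG
  set k : (Σ a, Fin (gridLength next X Y a)) → ℝ :=
    fun y => if y.2 < arm next X y.1 then z y.1 else z (next y.1) with hk
  have hX' : ∀ a, X (next a) ≠ X a := fun a e => hne a (hX e)
  have hY' : ∀ a, Y (next a) ≠ Y a := fun a e => hne a (hY e)
  have e0 : ∀ y, G.polygonPoint k 0 y 0 = halfStep next X Y z y.1 (2 * y.2) := by
    intro y
    rw [halfStep_even]
    refine space_ext ?_ ?_ ?_ <;> simp [GridPath.polygonPoint, hG, stairGrid]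
  have e1 : ∀ y, G.polygonPoint k 0 y 1 = halfStep next X Y z y.1 (2 * y.2 + 1) := by
    intro y
    rw [halfStep_odd X Y z (hX' _) (hY' _)]
    refine space_ext ?_ ?_ ?_ <;> simp [GridPath.polygonPoint, hG, stairGrid, hk]
  have hcl : ∀ a, halfStep next X Y z a (2 * gridLength next X Y a) =
      halfStep next X Y z (next a) (2 * 0) := by
    intro a
    rw [halfStep_even, halfStep_even,
      gridPoint_closes, gridHeight_closes next X Y z (arm_pos (hY' a))]
  have e2 : ∀ y, G.polygonPoint k 0 (G.σ y) 0 = halfStep next X Y z y.1 (2 * y.2 + 1 + 1) := by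
    intro y
    rw [e0]
    exact subdiv_next_apply _ (gridLength_pos hX hne) next
      (fun a m => halfStep next X Y z a (2 * m)) hcl y
  rw [cycCurve_subdiv _ _ _ _ (G.polygonPoint_closes k 0),
    cycCurve_subdiv _ _ _ _ (stairPoint_closes next _ _)]
  simp_rw [← iUnion_halfStep X Y z (hX' _) (hY' _)]
  ext x
  simp only [mem_iUnion, exists_prop]
  constructor
  · rintro ⟨⟨a, m⟩, i, hi, hx⟩
    obtain rfl | rfl : i = 0 ∨ i = 1 := by omega
    · rw [zero_add, e0, e1] at hx
      exact ⟨a, 2 * m, by omega, hx⟩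
    · change x ∈ segment ℝ (G.polygonPoint k 0 _ 1) (G.polygonPoint k 0 (G.σ _) 0) at hx
      rw [e1, e2] at hx
      exact ⟨a, 2 * m + 1, by omega, hx⟩
  · rintro ⟨a, r, hr, hx⟩
    obtain ⟨m, rfl | rfl⟩ := Nat.even_or_odd' r
    · refine ⟨⟨a, m, by omega⟩, 0, by norm_num, ?_⟩
      rw [zero_add, e0, e1]
      exact hx
    · refine ⟨⟨a, m, by omega⟩, 1, by norm_num, ?_⟩
      change x ∈ segment ℝ (G.polygonPoint k 0 _ 1) (G.polygonPoint k 0 (G.σ _) 0)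
      rw [e1, e2]
      exact hx
end

/-- A staircase can be moved onto a grid path. -/
theorem exists_mosaic_of_stair {W : Type} [Fintype W] {next : W → W} {w : W → Space}
    (hn : Function.Injective next) (hne : ∀ a, next a ≠ a)
    (hw : ∀ j, Function.Injective fun a => w a j) :
    ∃ (n : ℕ) (M : TileArray n), IsMosaic edgeMidpoints M ∧
      AmbientIsotopic (cycCurve (next3 next) (stair next w 0)) (curve edgeMidpoints M) := by
  obtain ⟨col, hcol, hcol'⟩ := exists_rank fun a => w a 0
  -- The second coordinate is negated because rows are counted downwards.
  obtain ⟨row, hrow, hrow'⟩ := exists_rank fun a => -w a 1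
  set X : W → ℤ := fun a => col a with hX
  set Y : W → ℤ := fun a => -row a with hY
  set z : W → ℝ := fun a => w a 2 with hz
  have hXX : ∀ a b, w a 0 < w b 0 → X a + 1 ≤ X b := fun a b h => by
    have := hcol' a b h
    simp only [hX]; omega
  have hYY : ∀ a b, w a 1 < w b 1 → Y a + 1 ≤ Y b := fun a b h => by
    have := hrow' b a (neg_lt_neg h)
    simp only [hY]; omega
  have inj : ∀ (f : W → ℤ) (j : Fin 3), (∀ a b, w a j < w b j → f a + 1 ≤ f b) →
      Function.Injective f := by
    intro f j hf a b h
    by_contra hab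
    rcases lt_or_gt_of_ne (fun e => hab (hw j e) : w a j ≠ w b j) with h' | h'
    · have := hf a b h'; omega
    · have := hf b a h'; omega
  have hXi := inj X 0 hXX
  have hYi := inj Y 1 hYY
  have hzi : Function.Injective z := hw 2
  set G := stairGrid z hn hXi hYi hzi hne with hG
  obtain ⟨M, hM, hiso⟩ := G.exists_mosaic
    (fun y => if y.2 < arm next X y.1 then z y.1 else z (next y.1)) (Fintype.card W) (by
      rintro ⟨a, m⟩
      have b1 := hcol a
      have b2 := hcol (next a)
      have b3 := hrow a
      have b4 := hrow (next a)
      have hm : (m : ℕ) < arm next X a + arm next Y a := m.2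
      have hXn : X (next a) ≠ X a := fun e => hne a (hXi e)
      have hYn : Y (next a) ≠ Y a := fun e => hne a (hYi e)
      have c1 := dir_mul_arm next X a
      have c2 := dir_mul_arm next Y a
      have d1 := dir_cases hXn
      have d2 := dir_cases hYn
      have x1 : X a = col a := rfl
      have x2 : X (next a) = col (next a) := rfl
      have y1 : Y a = -row a := rfl
      have y2 : Y (next a) = -row (next a) := rfl
      have hq : G.q ⟨a, m⟩ = gridPoint next X Y a m := rfl
      rw [hq]
      have hx : 0 ≤ (gridPoint next X Y a m).1 ∧
          (gridPoint next X Y a m).1 < Fintype.card W := by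
        simp only [gridPoint]
        rcases d1 with ⟨_, d1⟩ | ⟨_, d1⟩ <;> rw [d1] at c1 ⊢ <;> omega
      have hy : (gridPoint next X Y a m).2 ≤ 0 ∧
          -(Fintype.card W : ℤ) < (gridPoint next X Y a m).2 := by
        simp only [gridPoint]
        rcases d2 with ⟨_, d2⟩ | ⟨_, d2⟩ <;> rw [d2] at c2 ⊢ <;> omega
      exact GridPath.exists_square hx.1 hx.2 hy.1 hy.2)
  refine ⟨_, M, hM, AmbientIsotopic.trans ?_ hiso⟩
  rw [hG, cycCurve_stairGrid]
  refine ambientIsotopic_of_cycEmb (subdivNext_injective _ _ _ hn) _ _ fun s hs0 hs1 => ?_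
  rw [interpolate_stair]
  have hs1' : 0 ≤ 1 - s := by linarith
  -- Ranks preserve the order and neighbouring grid lines are `2` apart, so at time `s` two rows are
  -- more than `s` apart. The tilt has size at most `s` then, as `cycEmb_stair` demands. Heights do
  -- not move.
  have combine : ∀ x y p q : ℝ, x < y → p + 2 ≤ q →
      s < ((1 - s) * y + s * q) - ((1 - s) * x + s * p) := by
    intro x y p q h1 h2
    rcases hs0.eq_or_lt with rfl | hs
    · linarith
    · nlinarith [mul_nonneg hs1' (sub_nonneg.2 h1.le), mul_le_mul_of_nonneg_left h2 hs0]
  have cast : ∀ f : W → ℤ, ∀ a b, f a + 1 ≤ f b → 2 * (f a : ℝ) + 2 ≤ 2 * f b := by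
    intro f a b h
    have : (f a : ℝ) + 1 ≤ f b := by exact_mod_cast h
    linarith
  have sep : ∀ (j : Fin 3) (f : W → ℤ), (∀ a, gridVertex X Y z a j = 2 * f a) →
      (∀ a b, w a j < w b j → f a + 1 ≤ f b) → ∀ a b, a ≠ b →
      s < |((1 - s) • w a + s • gridVertex X Y z a) j -
        ((1 - s) • w b + s • gridVertex X Y z b) j| := by
    intro j f hf hf' a b hab
    simp only [Pi.add_apply, Pi.smul_apply, smul_eq_mul, hf]
    rcases lt_or_gt_of_ne (fun e => hab (hw j e) : w a j ≠ w b j) with h' | h'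
    · rw [abs_sub_comm]
      exact (combine _ _ _ _ h' (cast f _ _ (hf' a b h'))).trans_le (le_abs_self _)
    · exact (combine _ _ _ _ h' (cast f _ _ (hf' b a h'))).trans_le (le_abs_self _)
  have sepX := sep 0 X (fun a => rfl) hXX
  have sepY := sep 1 Y (fun a => rfl) hYY
  have inj' : ∀ j : Fin 3, (∀ a b, a ≠ b →
      s < |((1 - s) • w a + s • gridVertex X Y z a) j -
        ((1 - s) • w b + s • gridVertex X Y z b) j|) →
      Function.Injective fun a => ((1 - s) • w a + s • gridVertex X Y z a) j := by
    intro j h a b hab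
    by_contra hne
    have := h a b hne
    rw [show ((1 - s) • w a + s • gridVertex X Y z a) j =
      ((1 - s) • w b + s • gridVertex X Y z b) j from hab, sub_self, abs_zero] at this
    linarith
  refine cycEmb_stair hn hne (fun j => ?_) fun a b hab => ?_
  · fin_cases j
    · exact inj' 0 sepX
    · exact inj' 1 sepY
    · intro a b hab
      refine hw 2 ?_
      simp [gridVertex, hz] at hab
      simp only
      linarith
  · refine lt_of_le_of_lt ?_ (sepY a b hab)
    have hd : |(dir next Y b : ℝ)| ≤ 1 := by
      rcases dir_cases (next := next) (f := Y) (a := b) (fun e => hne b (hYi e)) with e | e <;>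
        rw [e.2] <;> simp
    simp only [Pi.zero_apply, mul_zero, zero_add]
    rw [abs_mul, abs_of_nonneg hs0]
    nlinarith

/-- Every link is depicted by a mosaic of traditional tiles. -/
theorem IsLink.exists_mosaic {K : Set Space} (hK : IsLink K) :
    K.Nonempty ∧ ∃ (n : ℕ) (M : TileArray n),
      IsMosaic edgeMidpoints M ∧ AmbientIsotopic K (curve edgeMidpoints M) := by
  obtain ⟨k, hk, P, hP, hKP⟩ := hK
  obtain ⟨V, _, next, v, hn, hv, rfl, hne⟩ := hP.exists_cycEmb
  obtain ⟨V', _, next', v', hn', hv', hg, hiso, -⟩ := hv.exists_gentleTurns hn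
  obtain ⟨W, _, next'', w, hn'', hne'', hw, hiso', -⟩ := hv'.exists_stair hn' hg
  obtain ⟨n, M, hM, hiso''⟩ := exists_mosaic_of_stair hn'' hne'' hw
  refine ⟨?_, n, M, hM, hKP.trans (hiso.trans (hiso'.trans hiso''))⟩
  obtain ⟨a⟩ := hne hk
  obtain ⟨H, -, -, hH⟩ := hKP
  have : (cycCurve next v).Nonempty := ⟨v a, mem_iUnion.2 ⟨a, left_mem_segment _ _ _⟩⟩
  rw [← hH] at this
  exact this.of_image

/-! ### Some explicit isotopies -/

theorem continuous_space {α : Type*} [TopologicalSpace α] {f g h : α → ℝ} (hf : Continuous f)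
    (hg : Continuous g) (hh : Continuous h) : Continuous fun x => (![f x, g x, h x] : Space) :=
  continuous_pi fun j => by fin_cases j <;> assumption

/-- A preliminary stretch of the first coordinate makes the push of a row flat enough to be a
displacement of Lipschitz constant less than `1`. -/
theorem ambientIsotopic_stretch (A : Set Space) :
    AmbientIsotopic A ((fun p : Space => (![10 * p 0, p 1, p 2] : Space)) '' A) := by
  have hpos : ∀ t : unitInterval, (1 + 9 * (t : ℝ)) ≠ 0 := fun t => by
    have := t.2.1
    positivity
  refine .of_family (fun t p => ![(1 + 9 * (t : ℝ)) * p 0, p 1, p 2])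
    (fun t p => ![(1 + 9 * (t : ℝ))⁻¹ * p 0, p 1, p 2]) ?_ (fun t => ?_) (fun t x => ?_)
    (fun t x => ?_) (fun x => ?_) (image_congr fun x _ => ?_)
  · exact continuous_space (by fun_prop) (by fun_prop) (by fun_prop)
  · exact continuous_space (by fun_prop) (by fun_prop) (by fun_prop)
  · exact space_ext (inv_mul_cancel_left₀ (hpos t) _) rfl rfl
  · exact space_ext (mul_inv_cancel_left₀ (hpos t) _) rfl rfl
  · refine space_ext ?_ rfl rfl
    simp
  · refine space_ext ?_ rfl rfl
    norm_num

/-- A vertical displacement of the plane that keeps the order on vertical lines. -/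
theorem ambientIsotopic_shear (b : ℝ → ℝ → ℝ)
    (hb : ∀ x y x' y', |b x y - b x' y'| ≤ 9 / 2 * |x - x'| + 1 / 2 * |y - y'|) (A : Set Space) :
    AmbientIsotopic A ((fun p : Space => (![p 0, p 1 - b (p 0) (p 1), p 2] : Space)) '' A) := by
  have h1 := ambientIsotopic_stretch A
  have h2 := ambientIsotopic_stretch ((fun p : Space => (![p 0, p 1 - b (p 0) (p 1), p 2] : Space)) '' A)
  refine h1.trans (AmbientIsotopic.trans ?_ h2.symm)
  -- After the stretch the constant is `9 / 2 / 10 + 1 / 2 = 19 / 20`.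
  have hlip : LipschitzWith (19 / 20) fun p : Space => (![0, -b (p 0 / 10) (p 1), 0] : Space) := by
    refine LipschitzWith.of_dist_le_mul fun p q => ?_
    have h0 := dist_le_pi_dist p q 0
    have h1 := dist_le_pi_dist p q 1
    rw [Real.dist_eq] at h0 h1
    have hpq : 0 ≤ dist p q := dist_nonneg
    have hc : ((19 / 20 : ℝ≥0) : ℝ) = 19 / 20 := by norm_num
    rw [hc]
    refine (dist_pi_le_iff (by positivity)).2 fun j => ?_
    fin_cases j
    · change dist (0 : ℝ) 0 ≤ _; rw [dist_self]; positivity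
    · change dist (-b (p 0 / 10) (p 1)) (-b (q 0 / 10) (q 1)) ≤ _
      rw [dist_neg_neg, Real.dist_eq]
      refine (hb _ _ _ _).trans ?_
      rw [← sub_div, abs_div, abs_of_pos (by norm_num : (0 : ℝ) < 10)]
      linarith
    · change dist (0 : ℝ) 0 ≤ _; rw [dist_self]; positivity
  have := ambientIsotopic_add_lipschitz _ hlip (by
    rw [← NNReal.coe_lt_coe]; norm_num) ((fun p : Space => (![10 * p 0, p 1, p 2] : Space)) '' A)
  convert this using 1
  rw [image_image, image_image]
  refine image_congr fun p _ => space_ext ?_ ?_ ?_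
  · simp
  · simp [sub_eq_add_neg]
  · simp

/-- The quarter turn with stretching that takes the edge midpoints of a tile to the corners. -/
def turn (c : ℝ) (p : Space) : Space := ![p 0 - p 1, p 0 + p 1 - c, p 2]

/-- The planar part at time `t` has the determinant `1 + t ^ 2`, so the linear path from the
identity to `turn` consists of invertible maps. -/
theorem ambientIsotopic_turn (c : ℝ) (A : Set Space) : AmbientIsotopic A (turn c '' A) := by
  have hpos : ∀ t : unitInterval, (1 + (t : ℝ) * t) ≠ 0 := fun t => by
    have := t.2.1
    positivity
  refine .of_family (fun t p => ![p 0 - t * p 1, t * p 0 + p 1 - t * c, p 2])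
    (fun t p => ![(1 + (t : ℝ) * t)⁻¹ * (p 0 + t * (p 1 + t * c)),
      (1 + (t : ℝ) * t)⁻¹ * (p 1 + t * c - t * p 0), p 2]) ?_ (fun t => ?_) (fun t x => ?_)
    (fun t x => ?_) (fun x => ?_) (image_congr fun x _ => ?_)
  · exact continuous_space (by fun_prop) (by fun_prop) (by fun_prop)
  · exact continuous_space (by fun_prop) (by fun_prop) (by fun_prop)
  · have := hpos t
    refine space_ext ?_ ?_ rfl
    · simp; field_simp; ring
    · simp; field_simp; ring
  · have := hpos t
    refine space_ext ?_ ?_ rfl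
    · simp; field_simp; ring
    · simp; field_simp; ring
  · refine space_ext ?_ ?_ rfl <;> simp
  · refine space_ext ?_ ?_ rfl <;> simp [turn]

/-! ### The push that flattens the top row -/

/-- The shape of a row of tiles that bounds a disk from above. -/
def bump (x₁ x₂ x : ℝ) : ℝ :=
  max 0 (min (min (3 * (x - x₁)) (2 / 3 + (x - x₁) / 3))
    (min (min (3 * (x₂ - x)) (2 / 3 + (x₂ - x) / 3)) 1))

/-- The displacement that pushes the graph of `bump` over the line at `y₀` onto that line. -/
def push (x₁ x₂ y₀ x y : ℝ) : ℝ := max 0 (bump x₁ x₂ x - |y - y₀ - bump x₁ x₂ x| / 2)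

theorem abs_bump_sub_le (x₁ x₂ x x' : ℝ) : |bump x₁ x₂ x - bump x₁ x₂ x'| ≤ 3 * |x - x'| := by
  have h := abs_nonneg (x - x')
  unfold bump
  refine (abs_max_sub_max_le_max _ _ _ _).trans (max_le (by simp) ?_)
  refine (abs_min_sub_min_le_max _ _ _ _).trans (max_le ?_ ?_)
  · refine (abs_min_sub_min_le_max _ _ _ _).trans (max_le ?_ ?_)
    · rw [← mul_sub, abs_mul, sub_sub_sub_cancel_right, abs_of_pos (three_pos : (0 : ℝ) < 3)]
    · rw [add_sub_add_left_eq_sub, ← sub_div, sub_sub_sub_cancel_right, abs_div,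
        abs_of_pos (three_pos : (0 : ℝ) < 3)]
      linarith
  · refine (abs_min_sub_min_le_max _ _ _ _).trans (max_le ?_ (by simp))
    refine (abs_min_sub_min_le_max _ _ _ _).trans (max_le ?_ ?_)
    · rw [← mul_sub, abs_mul, sub_sub_sub_cancel_left, abs_sub_comm, abs_of_pos (three_pos : (0 : ℝ) < 3)]
    · rw [add_sub_add_left_eq_sub, ← sub_div, sub_sub_sub_cancel_left, abs_div,
        abs_of_pos (three_pos : (0 : ℝ) < 3), abs_sub_comm]
      linarith

/-- The slope of `bump`, at most `3`, enters once directly and once halved: `3 + 3 / 2 = 9 / 2`. The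
slope `1 / 2` in `y` keeps the order on vertical lines. -/
theorem abs_push_sub_le (x₁ x₂ y₀ x y x' y' : ℝ) :
    |push x₁ x₂ y₀ x y - push x₁ x₂ y₀ x' y'| ≤ 9 / 2 * |x - x'| + 1 / 2 * |y - y'| := by
  have h := abs_bump_sub_le x₁ x₂ x x'
  unfold push
  generalize bump x₁ x₂ x = B at *
  generalize bump x₁ x₂ x' = B' at *
  refine (abs_max_sub_max_le_max _ _ _ _).trans (max_le ?_ ?_)
  · rw [sub_self, abs_zero]; positivity
  · have h1 := abs_abs_sub_abs_le_abs_sub (y - y₀ - B) (y' - y₀ - B')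
    have h2 : |y - y₀ - B - (y' - y₀ - B')| ≤ |y - y'| + |B - B'| := by
      rw [show y - y₀ - B - (y' - y₀ - B') = (y - y') - (B - B') by ring]
      exact abs_sub _ _
    rw [show B - |y - y₀ - B| / 2 - (B' - |y' - y₀ - B'| / 2) =
      (B - B') - (|y - y₀ - B| - |y' - y₀ - B'|) / 2 by ring]
    refine (abs_sub _ _).trans ?_
    rw [abs_div, abs_of_pos (two_pos : (0 : ℝ) < 2)]
    linarith

theorem bump_nonneg (x₁ x₂ x : ℝ) : 0 ≤ bump x₁ x₂ x := le_max_left _ _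

theorem bump_le {x₁ x₂ x c : ℝ} (hc : 0 ≤ c) (h : 3 * (x - x₁) ≤ c ∨ 2 / 3 + (x - x₁) / 3 ≤ c ∨
    3 * (x₂ - x) ≤ c ∨ 2 / 3 + (x₂ - x) / 3 ≤ c ∨ 1 ≤ c) : bump x₁ x₂ x ≤ c := by
  refine max_le hc ?_
  simp only [min_le_iff]
  tauto

theorem bump_eq {x₁ x₂ x c : ℝ} (h1 : c ≤ 3 * (x - x₁)) (h2 : c ≤ 2 / 3 + (x - x₁) / 3)
    (h3 : c ≤ 3 * (x₂ - x)) (h4 : c ≤ 2 / 3 + (x₂ - x) / 3) (h5 : c ≤ 1) (hc : 0 ≤ c)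
    (h : 3 * (x - x₁) ≤ c ∨ 2 / 3 + (x - x₁) / 3 ≤ c ∨
      3 * (x₂ - x) ≤ c ∨ 2 / 3 + (x₂ - x) / 3 ≤ c ∨ 1 ≤ c) : bump x₁ x₂ x = c :=
  le_antisymm (bump_le hc h)
    (le_max_of_le_right (le_min (le_min h1 h2) (le_min (le_min h3 h4) h5)))

/-- Nothing moves outside the interval of `bump`, nor on or below the mirror image of its graph in
the line at `y₀`: there `|y - y₀ - bump|` is at least twice `bump`. -/
theorem push_eq_zero {x₁ x₂ y₀ x y : ℝ} (h : x ≤ x₁ ∨ x₂ ≤ x ∨ y ≤ y₀ ∧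
    (3 * (x - x₁) ≤ y₀ - y ∨ 2 / 3 + (x - x₁) / 3 ≤ y₀ - y ∨
      3 * (x₂ - x) ≤ y₀ - y ∨ 2 / 3 + (x₂ - x) / 3 ≤ y₀ - y ∨ 1 ≤ y₀ - y)) :
    push x₁ x₂ y₀ x y = 0 := by
  have h0 := bump_nonneg x₁ x₂ x
  have key : bump x₁ x₂ x = 0 ∨ bump x₁ x₂ x ≤ y₀ - y := by
    rcases h with h | h | ⟨h, h'⟩
    · exact Or.inl (le_antisymm (bump_le le_rfl (Or.inl (by linarith))) h0)
    · exact Or.inl (le_antisymm (bump_le le_rfl (Or.inr (Or.inr (Or.inl (by linarith))))) h0)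
    · exact Or.inr (bump_le (by linarith) h')
  refine max_eq_left ?_
  rcases key with h | h
  · rw [h]
    have := abs_nonneg (y - y₀ - 0)
    linarith
  · have := neg_le_abs (y - y₀ - bump x₁ x₂ x)
    linarith

theorem push_eq {x₁ x₂ y₀ x y : ℝ} (h : bump x₁ x₂ x = y - y₀) : push x₁ x₂ y₀ x y = y - y₀ := by
  have h0 := bump_nonneg x₁ x₂ x
  rw [push, h, sub_self, abs_zero, zero_div, sub_zero]
  exact max_eq_right (h ▸ h0)

/-! ### The top left corner of a mosaic -/

theorem Tile.hasEnd_arc (p x : Fin 4) : (Tile.arc p).HasEnd x ↔ x = p ∨ x = p + 1 := by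
  simp [Tile.HasEnd, Tile.strands]

theorem Tile.hasEnd_line_false (x : Fin 4) : (Tile.line false).HasEnd x ↔ x = 0 ∨ x = 2 := by
  simp [Tile.HasEnd, Tile.strands]

theorem Tile.not_hasEnd_blank (x : Fin 4) : ¬ Tile.blank.HasEnd x := by
  simp [Tile.HasEnd, Tile.strands]

theorem Tile.HasEnd.ne_blank {T : Tile} {x : Fin 4} (h : T.HasEnd x) : T ≠ .blank := by
  rintro rfl
  exact Tile.not_hasEnd_blank x h

theorem Tile.eq_arc_three {T : Tile} (h0 : T ≠ .blank) (h1 : ¬ T.HasEnd 1) (h2 : ¬ T.HasEnd 2) :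
    T = .arc 3 := by
  rcases T with _ | p | b | b | b
  · exact absurd rfl h0
  · fin_cases p <;> simp [Tile.HasEnd, Tile.strands] at h1 h2 ⊢
  all_goals cases b <;> simp [Tile.HasEnd, Tile.strands] at h1 h2

theorem Tile.eq_line_or_arc {T : Tile} (h1 : ¬ T.HasEnd 1) (h2 : T.HasEnd 2) :
    T = .line false ∨ T = .arc 2 := by
  rcases T with _ | p | b | b | b
  · exact absurd h2 (Tile.not_hasEnd_blank 2)
  · fin_cases p <;> simp [Tile.HasEnd, Tile.strands] at h1 h2 ⊢
  all_goals cases b <;> simp [Tile.HasEnd, Tile.strands] at h1 h2 ⊢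

theorem Tile.strands_cases {T : Tile} {s : Strand} (hs : s ∈ T.strands) :
    T.HasEnd s.src ∧ T.HasEnd s.tgt ∧
    (s.src = 0 ∧ s.tgt = 1 ∨ s.src = 1 ∧ s.tgt = 2 ∨ s.src = 2 ∧ s.tgt = 3 ∨
      s.src = 3 ∧ s.tgt = 0 ∨ s.src = 0 ∧ s.tgt = 2 ∨ s.src = 1 ∧ s.tgt = 3) := by
  refine ⟨⟨s, hs, Or.inl rfl⟩, ⟨s, hs, Or.inr rfl⟩, ?_⟩
  rcases T with _ | p | b | b | b
  · simp [Tile.strands] at hs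
  · fin_cases p <;> simp [Tile.strands] at hs <;> subst hs <;> simp
  · cases b <;> simp [Tile.strands] at hs <;> subst hs <;> simp
  · cases b <;> simp [Tile.strands] at hs <;> rcases hs with rfl | rfl <;> simp
  · cases b <;> simp [Tile.strands] at hs <;> rcases hs with rfl | rfl <;> simp

/-- Each curve goes on in the neighbouring square. The square `q` has the centre `2 • q`. -/
def Closed (T : ℤ × ℤ → Tile) : Prop :=
  ∀ q p, (T q).HasEnd p → (T (q + edgeMidpoints p)).HasEnd (p + 2)

/-- The tile of an array at a square of the plane. -/
def planeTile {n : ℕ} (M : TileArray n) : ℤ × ℤ → Tile :=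
  Function.extend GridPath.square M fun _ => .blank

theorem planeTile_square {n : ℕ} (M : TileArray n) (t : Fin n × Fin n) :
    planeTile M (GridPath.square t) = M t :=
  GridPath.square_injective.extend_apply _ _ _

theorem exists_square_of_planeTile {n : ℕ} {M : TileArray n} {q : ℤ × ℤ}
    (h : planeTile M q ≠ .blank) : ∃ t : Fin n × Fin n, GridPath.square t = q := by
  by_contra hq
  exact h (Function.extend_apply' _ _ _ hq)

theorem curve_eq_iUnion {n : ℕ} (o : Fin 4 → ℤ × ℤ) (M : TileArray n) :
    curve o M = ⋃ q, ⋃ s ∈ (planeTile M q).strands, strandCurve o (2 • q) s := by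
  ext x
  simp only [curve, mem_iUnion, GridPath.centre_eq]
  constructor
  · rintro ⟨t, s, hs, hx⟩
    exact ⟨GridPath.square t, s, by rwa [planeTile_square], hx⟩
  · rintro ⟨q, s, hs, hx⟩
    obtain ⟨t, rfl⟩ := exists_square_of_planeTile (M := M) (q := q)
      (fun h => by rw [h] at hs; simp [Tile.strands] at hs)
    rw [planeTile_square] at hs
    exact ⟨t, s, hs, hx⟩

/-- An edge midpoint belongs to just two squares, so the mosaic condition for traditional tiles
names the neighbour. -/
theorem edgeMidpoint_unique {q q' : ℤ × ℤ} (hq : q ≠ q') {p p' : Fin 4}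
    (h : 2 • q + edgeMidpoints p = 2 • q' + edgeMidpoints p') :
    q' = q + edgeMidpoints p ∧ p' = p + 2 := by
  obtain ⟨a, b⟩ := q
  obtain ⟨a', b'⟩ := q'
  fin_cases p <;> fin_cases p' <;>
    simp [edgeMidpoints, Prod.ext_iff] at h hq ⊢ <;> omega

theorem IsMosaic.closed {n : ℕ} {M : TileArray n} (hM : IsMosaic edgeMidpoints M) :
    Closed (planeTile M) := by
  intro q p hp
  obtain ⟨t, rfl⟩ := exists_square_of_planeTile hp.ne_blank
  rw [planeTile_square] at hp
  obtain ⟨s, hst, p', hp', h⟩ := hM t _ ⟨p, hp, rfl⟩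
  rw [GridPath.centre_eq, GridPath.centre_eq] at h
  obtain ⟨h1, rfl⟩ := edgeMidpoint_unique (fun e => hst (GridPath.square_injective e).symm) h
  rwa [← h1, planeTile_square]

/-- The topmost row starts with an arc that bounds, with the next tiles, a disk from above. -/
structure TopRun (T : ℤ × ℤ → Tile) (X₁ X₂ Y : ℤ) : Prop where
  lt : X₁ < X₂
  left : T (X₁, Y) = .arc 3
  right : T (X₂, Y) = .arc 2
  between : ∀ X, X₁ < X → X < X₂ → T (X, Y) = .line false
  above : ∀ X Y', Y < Y' → T (X, Y') = .blank

/-- No curve in the topmost non-blank row leaves upwards. Its leftmost tile has no end on the left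
either, so it is the arc from bottom to right. The first later tile that is not a horizontal line is
entered from the left and has no end above, so it is the arc that leads down. -/
theorem Closed.exists_topRun {T : ℤ × ℤ → Tile} (hT : Closed T)
    (hfin : {q | T q ≠ .blank}.Finite) (hne : {q | T q ≠ .blank}.Nonempty) :
    ∃ X₁ X₂ Y, TopRun T X₁ X₂ Y := by
  obtain ⟨⟨X₀, Y⟩, hq₀, hmax⟩ := exists_max_image _ Prod.snd hfin hne
  have habove : ∀ X Y', Y < Y' → T (X, Y') = .blank := fun X Y' h => by
    by_contra hb
    exact absurd (hmax (X, Y') hb) (not_le.2 h)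
  have hrow : {X | T (X, Y) ≠ .blank}.Finite :=
    hfin.preimage (f := fun X => (X, Y)) fun a _ b _ h => (Prod.ext_iff.1 h).1
  obtain ⟨X₁, hX₁, hmin⟩ := exists_min_image _ id hrow ⟨X₀, hq₀⟩
  have hbefore : ∀ X, X < X₁ → T (X, Y) = .blank := fun X h => by
    by_contra hb
    exact absurd (hmin X hb) (not_le.2 h)
  have htop : ∀ X, ¬ (T (X, Y)).HasEnd 1 := fun X h => by
    have := (hT _ _ h).ne_blank
    rw [show ((X, Y) + edgeMidpoints 1 : ℤ × ℤ) = (X, Y + 1) by simp [edgeMidpoints]] at this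
    exact this (habove _ _ (by omega))
  have hleft : T (X₁, Y) = .arc 3 := Tile.eq_arc_three hX₁ (htop X₁) fun h => by
    have := (hT _ _ h).ne_blank
    rw [show ((X₁, Y) + edgeMidpoints 2 : ℤ × ℤ) = (X₁ - 1, Y) by
      simp [edgeMidpoints, sub_eq_add_neg]] at this
    exact this (hbefore _ (by omega))
  obtain ⟨B, hB⟩ := hrow.bddAbove
  -- Such a tile exists: the column `max B X₁ + 1` lies to the right of all non-blank tiles of the
  -- row.
  obtain ⟨X₂, ⟨hlt, hX₂⟩, hleast⟩ := Int.exists_least_of_bdd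
    (P := fun X => X₁ < X ∧ T (X, Y) ≠ .line false) ⟨X₁, fun z hz => hz.1.le⟩
    ⟨max B X₁ + 1, by omega, fun h => by
      have : max B X₁ + 1 ≤ B := hB (show T (max B X₁ + 1, Y) ≠ .blank by rw [h]; simp)
      omega⟩
  have hbetween : ∀ X, X₁ < X → X < X₂ → T (X, Y) = .line false := fun X h1 h2 => by
    by_contra hb
    exact absurd (hleast X ⟨h1, hb⟩) (not_le.2 h2)
  refine ⟨X₁, X₂, Y, hlt, hleft, ?_, hbetween, habove⟩
  have hend : (T (X₂ - 1, Y)).HasEnd 0 := by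
    rcases (show X₁ ≤ X₂ - 1 by omega).eq_or_lt with h | h
    · rw [← h, hleft, Tile.hasEnd_arc]; right; rfl
    · rw [hbetween _ h (by omega), Tile.hasEnd_line_false]; left; rfl
  have := hT _ _ hend
  rw [show ((X₂ - 1, Y) + edgeMidpoints 0 : ℤ × ℤ) = (X₂, Y) by simp [edgeMidpoints]] at this
  exact (Tile.eq_line_or_arc (htop X₂) this).resolve_left hX₂

/-! ### Pushing the top row onto its lower boundary -/

theorem exists_of_mem_strandCurve {o : Fin 4 → ℤ × ℤ} {c : ℤ × ℤ} {s : Strand} {x : Space}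
    (hx : x ∈ strandCurve o c s) : ∃ e t, (e = s.src ∨ e = s.tgt) ∧ 0 ≤ t ∧ t ≤ 1 ∧
      x 0 = c.1 + ((1 - t) * (o e).1 + t * (((o s.src).1 + (o s.tgt).1) / 4)) ∧
      x 1 = c.2 + ((1 - t) * (o e).2 + t * (((o s.src).2 + (o s.tgt).2) / 4)) := by
  rcases hx with hx | hx
  · rw [segment_eq_image'] at hx
    obtain ⟨t, ⟨h0, h1⟩, rfl⟩ := hx
    refine ⟨s.src, t, Or.inl rfl, h0, h1, ?_, ?_⟩ <;> simp <;> ring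
  · rw [segment_symm, segment_eq_image'] at hx
    obtain ⟨t, ⟨h0, h1⟩, rfl⟩ := hx
    refine ⟨s.tgt, t, Or.inr rfl, h0, h1, ?_, ?_⟩ <;> simp <;> ring

theorem abs_sub_centre_le {T : Tile} {s : Strand} (hs : s ∈ T.strands) {c : ℤ × ℤ} {x : Space}
    (hx : x ∈ strandCurve edgeMidpoints c s) :
    c.1 - 1 ≤ x 0 ∧ x 0 ≤ c.1 + 1 ∧ x 1 ≤ c.2 + 1 ∧ (¬ T.HasEnd 1 → x 1 ≤ c.2) := by
  obtain ⟨e, t, he, h0, h1, hx0, hx1⟩ := exists_of_mem_strandCurve hx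
  obtain ⟨e1, e2, h⟩ := Tile.strands_cases hs
  rw [hx0, hx1]
  generalize s.src = p at *
  generalize s.tgt = p' at *
  rcases h with ⟨rfl, rfl⟩ | ⟨rfl, rfl⟩ | ⟨rfl, rfl⟩ | ⟨rfl, rfl⟩ | ⟨rfl, rfl⟩ | ⟨rfl, rfl⟩ <;>
    rcases he with rfl | rfl <;> refine ⟨?_, ?_, ?_, ?_⟩ <;> simp [edgeMidpoints] <;> first
    | linarith
    | (intro h; first
      | exact absurd e1 h
      | exact absurd e2 h
      | linarith)

/-- A curve in the square below the start of the run lies outside its mirror image. -/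
theorem below_left {T : Tile} {s : Strand} (hs : s ∈ T.strands) {c : ℤ × ℤ} {x : Space}
    (hx : x ∈ strandCurve edgeMidpoints c s) :
    x 0 ≤ c.1 ∨ x 1 ≤ c.2 + 1 ∧ (3 * (x 0 - c.1) ≤ c.2 + 1 - x 1 ∨
      2 / 3 + (x 0 - c.1) / 3 ≤ c.2 + 1 - x 1 ∨ 1 ≤ c.2 + 1 - x 1) := by
  obtain ⟨e, t, he, h0, h1, hx0, hx1⟩ := exists_of_mem_strandCurve hx
  obtain ⟨e1, e2, h⟩ := Tile.strands_cases hs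
  rw [hx0, hx1]
  generalize s.src = p at *
  generalize s.tgt = p' at *
  rcases h with ⟨rfl, rfl⟩ | ⟨rfl, rfl⟩ | ⟨rfl, rfl⟩ | ⟨rfl, rfl⟩ | ⟨rfl, rfl⟩ | ⟨rfl, rfl⟩ <;>
    rcases he with rfl | rfl <;> simp [edgeMidpoints] <;> first
    | (left; linarith)
    | (right; refine ⟨by linarith, ?_⟩; first
      | (left; linarith)
      | (right; left; linarith))

/-- A curve in the square below the end of the run lies outside its mirror image. -/
theorem below_right {T : Tile} {s : Strand} (hs : s ∈ T.strands) {c : ℤ × ℤ} {x : Space}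
    (hx : x ∈ strandCurve edgeMidpoints c s) :
    c.1 ≤ x 0 ∨ x 1 ≤ c.2 + 1 ∧ (3 * (c.1 - x 0) ≤ c.2 + 1 - x 1 ∨
      2 / 3 + (c.1 - x 0) / 3 ≤ c.2 + 1 - x 1 ∨ 1 ≤ c.2 + 1 - x 1) := by
  obtain ⟨e, t, he, h0, h1, hx0, hx1⟩ := exists_of_mem_strandCurve hx
  obtain ⟨e1, e2, h⟩ := Tile.strands_cases hs
  rw [hx0, hx1]
  generalize s.src = p at *
  generalize s.tgt = p' at *
  rcases h with ⟨rfl, rfl⟩ | ⟨rfl, rfl⟩ | ⟨rfl, rfl⟩ | ⟨rfl, rfl⟩ | ⟨rfl, rfl⟩ | ⟨rfl, rfl⟩ <;>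
    rcases he with rfl | rfl <;> simp [edgeMidpoints] <;> first
    | (left; linarith)
    | (right; refine ⟨by linarith, ?_⟩; first
      | (left; linarith)
      | (right; left; linarith))

/-- The squares of the run. -/
def runSquares (X₁ X₂ Y : ℤ) : Set (ℤ × ℤ) := {q | X₁ ≤ q.1 ∧ q.1 ≤ X₂ ∧ q.2 = Y}

/-- The rest of the mosaic stays fixed. Only the row just below the run could be touched. Under a
horizontal line no curve reaches the upper edge, so all curves lie at depth at least `1`, the
maximum of `bump`. Under the two arcs, `below_left` and `below_right` keep the curves off the mirror
image of the run. -/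
theorem TopRun.push_eq_zero {T : ℤ × ℤ → Tile} (hT : Closed T) {X₁ X₂ Y : ℤ}
    (h : TopRun T X₁ X₂ Y) {q : ℤ × ℤ} (hq : q ∉ runSquares X₁ X₂ Y) {s : Strand}
    (hs : s ∈ (T q).strands) {x : Space} (hx : x ∈ strandCurve edgeMidpoints (2 • q) s) :
    push (2 * X₁) (2 * X₂) (2 * Y - 1) (x 0) (x 1) = 0 := by
  obtain ⟨b1, b2, b3, b4⟩ := abs_sub_centre_le hs hx
  have hl := below_left hs hx
  have hr := below_right hs hx
  have hb : T q ≠ .blank := fun e => by rw [e] at hs; simp [Tile.strands] at hs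
  obtain ⟨X, Z⟩ := q
  simp only [Prod.smul_mk, nsmul_eq_mul, Nat.cast_ofNat, Int.cast_mul, Int.cast_ofNat]
    at b1 b2 b3 b4 hl hr
  have hXlt : ∀ {A B : ℤ}, A < B → (A : ℝ) + 1 ≤ B := fun h => by exact_mod_cast h
  refine KnotMosaic.push_eq_zero ?_
  rcases lt_or_ge X X₁ with h1 | h1
  · left; linarith [hXlt h1]
  rcases lt_or_ge X₂ X with h2 | h2
  · right; left; linarith [hXlt h2]
  rcases lt_or_ge Y Z with h3 | h3
  · exact absurd (h.above X Z h3) hb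
  rcases h3.lt_or_eq with h3 | rfl
  swap
  · exact absurd ⟨h1, h2, rfl⟩ hq
  rcases (show Z + 1 ≤ Y from h3).lt_or_eq with h4 | h4
  · have h5 : (Z : ℝ) + 2 ≤ Y := by exact_mod_cast (show Z + 2 ≤ Y by omega)
    right; right
    exact ⟨by linarith, by right; right; right; right; linarith⟩
  have h5 : (Y : ℝ) = Z + 1 := by exact_mod_cast h4.symm
  rcases h1.eq_or_lt with rfl | h1
  · rcases hl with hl | ⟨hl, hl'⟩
    · left; exact hl
    · right; right
      refine ⟨by linarith, ?_⟩
      rcases hl' with h | h | h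
      · left; linarith
      · right; left; linarith
      · right; right; right; right; linarith
  rcases h2.eq_or_lt with rfl | h2
  · rcases hr with hl | ⟨hl, hl'⟩
    · right; left; exact hl
    · right; right
      refine ⟨by linarith, ?_⟩
      rcases hl' with h | h | h
      · right; right; left; linarith
      · right; right; right; left; linarith
      · right; right; right; right; linarith
  have hend : ¬ (T (X, Z)).HasEnd 1 := fun he => by
    have := hT _ _ he
    rw [show ((X, Z) + edgeMidpoints 1 : ℤ × ℤ) = (X, Y) by simp [edgeMidpoints, h4],
      h.between X h1 h2, Tile.hasEnd_line_false] at this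
    revert this; decide
  right; right
  have := b4 hend
  exact ⟨by linarith, by right; right; right; right; linarith⟩

/-- A horizontal segment. -/
def flat (y a b : ℝ) : Set Space := {x | a ≤ x 0 ∧ x 0 ≤ b ∧ x 1 = y ∧ x 2 = 0}

theorem segment_flat (y : ℝ) {a b : ℝ} (hab : a ≤ b) :
    segment ℝ (![a, y, 0] : Space) ![b, y, 0] = flat y a b := by
  ext x
  rw [segment_eq_image']
  constructor
  · rintro ⟨t, ⟨h0, h1⟩, rfl⟩
    refine ⟨?_, ?_, ?_, ?_⟩ <;> simp <;> nlinarith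
  · rintro ⟨h1, h2, h3, h4⟩
    rcases hab.eq_or_lt with rfl | hab
    · exact ⟨0, by simp, space_ext (by simp; linarith) (by simp [h3]) (by simp [h4])⟩
    · have hpos : 0 < b - a := sub_pos.2 hab
      refine ⟨(x 0 - a) / (b - a), ⟨by apply div_nonneg <;> linarith,
        (div_le_one hpos).2 (by linarith)⟩, space_ext ?_ ?_ ?_⟩
      · simp [div_mul_cancel₀ _ hpos.ne']
      · simp [h3]
      · simp [h4]

theorem flat_union_flat (y : ℝ) {a b c : ℝ} (hab : a ≤ b) (hbc : b ≤ c) :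
    flat y a b ∪ flat y b c = flat y a c := by
  ext x
  constructor
  · rintro (⟨h1, h2, h3⟩ | ⟨h1, h2, h3⟩)
    · exact ⟨h1, h2.trans hbc, h3⟩
    · exact ⟨hab.trans h1, h2, h3⟩
  · rintro ⟨h1, h2, h3⟩
    rcases le_total (x 0) b with h | h
    · exact Or.inl ⟨h1, h, h3⟩
    · exact Or.inr ⟨h, h2, h3⟩

theorem strandCurve_line (c : ℤ × ℤ) :
    strandCurve edgeMidpoints c ⟨0, 2, false⟩ = flat c.2 (c.1 - 1) (c.1 + 1) := by
  rw [← flat_union_flat _ (show (c.1 : ℝ) - 1 ≤ c.1 by linarith) (by linarith),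
    ← segment_flat _ (by linarith), ← segment_flat _ (by linarith), union_comm, segment_symm,
    segment_symm ℝ (![(c.1 : ℝ) - 1, _, _] : Space)]
  simp [strandCurve, edgeMidpoints, sub_eq_add_neg]

/-- The push of the plane by `push`. -/
def pushMap (x₁ x₂ y₀ : ℝ) (p : Space) : Space := ![p 0, p 1 - push x₁ x₂ y₀ (p 0) (p 1), p 2]

/-- The push takes a segment of the graph of `bump` onto a horizontal segment. -/
theorem pushMap_image_segment {x₁ x₂ y₀ a y b y' : ℝ} (hab : a ≤ b)
    (h : ∀ t, 0 ≤ t → t ≤ 1 →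
      bump x₁ x₂ (a + t * (b - a)) = y + t * (y' - y) - y₀) :
    pushMap x₁ x₂ y₀ '' segment ℝ ![a, y, 0] ![b, y', 0] = flat y₀ a b := by
  rw [← segment_flat _ hab, segment_eq_image', segment_eq_image', image_image]
  refine image_congr fun t ht => ?_
  have := h t ht.1 ht.2
  have hp := push_eq this
  refine space_ext ?_ ?_ ?_
  · simp [pushMap]
  · simp [pushMap, hp]
  · simp [pushMap]

/-- The middle point of this arc has the offset `(1/4, -1/4)`, so the arc rises with slope `3` and
then `1/3`: these are the two pieces of the left flank of `bump`. -/
theorem pushMap_image_arc_three {X₁ X₂ Y : ℤ} (h : X₁ < X₂) :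
    pushMap (2 * X₁) (2 * X₂) (2 * Y - 1) ''
      strandCurve edgeMidpoints (2 • (X₁, Y)) ⟨3, 3 + 1, false⟩ =
      flat (2 * Y - 1) (2 * X₁) (2 * X₁ + 1) := by
  have hX : (X₁ : ℝ) + 1 ≤ X₂ := by exact_mod_cast h
  rw [← flat_union_flat _ (show (2 * X₁ : ℝ) ≤ 2 * X₁ + 1 / 4 by linarith) (by linarith),
    ← pushMap_image_segment (x₁ := 2 * X₁) (x₂ := 2 * X₂) (y := 2 * Y - 1) (y' := 2 * Y - 1 / 4)
      (by linarith) (fun t h0 h1 => ?_),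
    ← pushMap_image_segment (x₁ := 2 * X₁) (x₂ := 2 * X₂) (y := 2 * Y - 1 / 4) (y' := 2 * Y)
      (by linarith) (fun t h0 h1 => ?_), ← image_union]
  · congr 1
    simp only [strandCurve, edgeMidpoints]
    congr 2 <;> (refine space_ext ?_ ?_ ?_ <;> simp <;> ring)
  · refine bump_eq ?_ ?_ ?_ ?_ ?_ ?_ (Or.inr (Or.inl ?_)) <;> linarith
  · refine bump_eq ?_ ?_ ?_ ?_ ?_ ?_ (Or.inl ?_) <;> linarith

theorem pushMap_image_arc_two {X₁ X₂ Y : ℤ} (h : X₁ < X₂) :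
    pushMap (2 * X₁) (2 * X₂) (2 * Y - 1) ''
      strandCurve edgeMidpoints (2 • (X₂, Y)) ⟨2, 2 + 1, false⟩ =
      flat (2 * Y - 1) (2 * X₂ - 1) (2 * X₂) := by
  have hX : (X₁ : ℝ) + 1 ≤ X₂ := by exact_mod_cast h
  rw [← flat_union_flat _ (show (2 * X₂ - 1 : ℝ) ≤ 2 * X₂ - 1 / 4 by linarith) (by linarith),
    ← pushMap_image_segment (x₁ := 2 * X₁) (x₂ := 2 * X₂) (y := 2 * Y) (y' := 2 * Y - 1 / 4)
      (by linarith) (fun t h0 h1 => ?_),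
    ← pushMap_image_segment (x₁ := 2 * X₁) (x₂ := 2 * X₂) (y := 2 * Y - 1 / 4) (y' := 2 * Y - 1)
      (by linarith) (fun t h0 h1 => ?_), ← image_union]
  · congr 1
    simp only [strandCurve, edgeMidpoints]
    congr 2 <;> (refine space_ext ?_ ?_ ?_ <;> simp <;> ring)
  · refine bump_eq ?_ ?_ ?_ ?_ ?_ ?_ (Or.inr (Or.inr (Or.inl ?_))) <;> linarith
  · refine bump_eq ?_ ?_ ?_ ?_ ?_ ?_ (Or.inr (Or.inr (Or.inr (Or.inl ?_)))) <;> linarith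

theorem pushMap_image_line {X₁ X₂ X Y : ℤ} (h1 : X₁ < X) (h2 : X < X₂) :
    pushMap (2 * X₁) (2 * X₂) (2 * Y - 1) ''
      strandCurve edgeMidpoints (2 • (X, Y)) ⟨0, 2, false⟩ =
      flat (2 * Y - 1) (2 * X - 1) (2 * X + 1) := by
  have hX : (X₁ : ℝ) + 1 ≤ X := by exact_mod_cast h1
  have hX' : (X : ℝ) + 1 ≤ X₂ := by exact_mod_cast h2
  rw [strandCurve_line, ← segment_flat _ (by linarith),
    ← pushMap_image_segment (x₁ := 2 * X₁) (x₂ := 2 * X₂) (y := 2 * Y) (y' := 2 * Y)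
      (by linarith) (fun t h0 h1 => ?_)]
  · congr 2 <;> (refine space_ext ?_ ?_ ?_ <;> simp)
  · refine bump_eq ?_ ?_ ?_ ?_ ?_ ?_ (Or.inr (Or.inr (Or.inr (Or.inr ?_)))) <;> linarith

theorem exists_int_between {a b : ℤ} {x : ℝ} (hab : a < b) (h1 : 2 * a ≤ x) (h2 : x ≤ 2 * b) :
    ∃ X : ℤ, a ≤ X ∧ X < b ∧ 2 * X ≤ x ∧ x ≤ 2 * X + 2 := by
  rcases lt_or_ge x (2 * b) with h | h
  · refine ⟨⌊x / 2⌋, Int.le_floor.2 (by linarith), Int.floor_lt.2 (by linarith), ?_, ?_⟩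
    · linarith [Int.floor_le (x / 2)]
    · linarith [Int.lt_floor_add_one (x / 2)]
  · refine ⟨b - 1, by omega, by omega, ?_, ?_⟩ <;> push_cast <;> linarith

/-- The flattened run is cut into lines centred at vertices of the old grid. There are `X₂ - X₁` of
them, one less than the run has tiles. -/
theorem iUnion_line_eq_flat {X₁ X₂ : ℤ} (h : X₁ < X₂) (Y : ℤ) :
    ⋃ X : ℤ, ⋃ _ : X₁ ≤ X ∧ X < X₂, strandCurve edgeMidpoints (2 * X + 1, 2 * Y - 1) ⟨0, 2, false⟩ =
      flat (2 * Y - 1) (2 * X₁) (2 * X₂) := by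
  ext x
  simp only [mem_iUnion, exists_prop, strandCurve_line]
  constructor
  · rintro ⟨X, ⟨h1, h2⟩, hx1, hx2, hx3, hx4⟩
    have h1' : (X₁ : ℝ) ≤ X := by exact_mod_cast h1
    have h2' : (X : ℝ) + 1 ≤ X₂ := by exact_mod_cast h2
    push_cast at hx1 hx2 hx3
    exact ⟨by linarith, by linarith, hx3, hx4⟩
  · rintro ⟨hx1, hx2, hx3, hx4⟩
    obtain ⟨X, h1, h2, h3, h4⟩ := exists_int_between h hx1 hx2
    refine ⟨X, ⟨h1, h2⟩, ?_, ?_, ?_, hx4⟩ <;> push_cast <;> linarith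

theorem TopRun.pushMap_image_run {T : ℤ × ℤ → Tile} {X₁ X₂ Y : ℤ} (h : TopRun T X₁ X₂ Y) :
    pushMap (2 * X₁) (2 * X₂) (2 * Y - 1) '' ⋃ q ∈ runSquares X₁ X₂ Y, ⋃ s ∈ (T q).strands,
      strandCurve edgeMidpoints (2 • q) s = flat (2 * Y - 1) (2 * X₁) (2 * X₂) := by
  have hlt : (X₁ : ℝ) + 1 ≤ X₂ := by exact_mod_cast h.lt
  simp_rw [image_iUnion]
  have hl := pushMap_image_arc_three (Y := Y) h.lt
  have hr := pushMap_image_arc_two (Y := Y) h.lt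
  ext x
  simp only [mem_iUnion]
  constructor
  · rintro ⟨⟨X, Z⟩, ⟨h1, h2, rfl⟩, s, hs, hx⟩
    simp only at h1 h2 hs
    rcases h1.eq_or_lt with rfl | h1
    · rw [h.left] at hs
      simp only [Tile.strands, List.mem_cons, List.not_mem_nil, or_false] at hs
      subst hs
      rw [hl] at hx
      exact ⟨hx.1, by linarith [hx.2.1], hx.2.2⟩
    rcases h2.eq_or_lt with rfl | h2
    · rw [h.right] at hs
      simp only [Tile.strands, List.mem_cons, List.not_mem_nil, or_false] at hs
      subst hs
      rw [hr] at hx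
      exact ⟨by linarith [hx.1], hx.2⟩
    · rw [h.between X h1 h2] at hs
      simp only [Tile.strands, List.mem_cons, List.not_mem_nil, or_false] at hs
      subst hs
      rw [pushMap_image_line h1 h2] at hx
      have h1' : (X₁ : ℝ) + 1 ≤ X := by exact_mod_cast h1
      have h2' : (X : ℝ) + 1 ≤ X₂ := by exact_mod_cast h2
      exact ⟨by linarith [hx.1], by linarith [hx.2.1], hx.2.2⟩
  · rintro ⟨hx1, hx2, hx3⟩
    -- The floor is the column whose square, reaching from `2 * X - 1` to `2 * X + 1`, contains the
    -- point.
    have f1 := Int.floor_le ((x 0 + 1) / 2)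
    have f2 := Int.lt_floor_add_one ((x 0 + 1) / 2)
    have h1 : X₁ ≤ ⌊(x 0 + 1) / 2⌋ := Int.le_floor.2 (by linarith)
    have h2 : ⌊(x 0 + 1) / 2⌋ < X₂ + 1 := Int.floor_lt.2 (by push_cast; linarith)
    generalize ⌊(x 0 + 1) / 2⌋ = X at *
    refine ⟨(X, Y), ⟨h1, by omega, rfl⟩, ?_⟩
    rcases h1.eq_or_lt with rfl | h1
    · rw [h.left]
      refine ⟨_, List.mem_cons_self, ?_⟩
      rw [hl]
      exact ⟨hx1, by linarith, hx3⟩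
    rcases (show X ≤ X₂ by omega).eq_or_lt with rfl | h2
    · rw [h.right]
      refine ⟨_, List.mem_cons_self, ?_⟩
      rw [hr]
      exact ⟨by linarith, hx2, hx3⟩
    · rw [h.between X h1 h2]
      refine ⟨_, List.mem_cons_self, ?_⟩
      rw [pushMap_image_line h1 h2]
      exact ⟨by linarith, by linarith, hx3⟩

/-- The top row of tiles can be pushed onto its lower boundary. -/
theorem TopRun.ambientIsotopic {T : ℤ × ℤ → Tile} (hT : Closed T) {X₁ X₂ Y : ℤ}
    (h : TopRun T X₁ X₂ Y) :
    AmbientIsotopic (⋃ q, ⋃ s ∈ (T q).strands, strandCurve edgeMidpoints (2 • q) s)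
      ((⋃ q ∈ (runSquares X₁ X₂ Y)ᶜ, ⋃ s ∈ (T q).strands, strandCurve edgeMidpoints (2 • q) s) ∪
        ⋃ X : ℤ, ⋃ _ : X₁ ≤ X ∧ X < X₂,
          strandCurve edgeMidpoints (2 * X + 1, 2 * Y - 1) ⟨0, 2, false⟩) := by
  have hrest : pushMap (2 * X₁) (2 * X₂) (2 * Y - 1) '' ⋃ q ∈ (runSquares X₁ X₂ Y)ᶜ,
      ⋃ s ∈ (T q).strands, strandCurve edgeMidpoints (2 • q) s =
      ⋃ q ∈ (runSquares X₁ X₂ Y)ᶜ, ⋃ s ∈ (T q).strands, strandCurve edgeMidpoints (2 • q) s := by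
    refine (image_congr fun x hx => ?_).trans (image_id _)
    simp only [mem_iUnion] at hx
    obtain ⟨q, hq, s, hs, hx⟩ := hx
    have := h.push_eq_zero hT hq hs hx
    refine space_ext rfl ?_ rfl
    simp [pushMap, this]
  rw [iUnion_line_eq_flat h.lt, ← h.pushMap_image_run, ← hrest, ← image_union, union_comm,
    ← biUnion_union, union_compl_self, biUnion_univ]
  exact ambientIsotopic_shear (push (2 * X₁) (2 * X₂) (2 * Y - 1))
    (fun x y x' y' => abs_push_sub_le _ _ _ x y x' y') _

/-! ### Turning edge midpoints into corners -/

/-- The affine map `turn` keeps heights and takes the offset of each edge midpoint to that of the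
corner with the same number; the middle points follow, being averages. -/
theorem turn_image_strandCurve (n a b : ℤ) (s : Strand) :
    turn (2 * n) '' strandCurve edgeMidpoints (a, b) s =
      strandCurve corners (a - b, a + b - 2 * n) s := by
  have hseg : ∀ P Q : Space, turn (2 * n) '' segment ℝ P Q =
      segment ℝ (turn (2 * n) P) (turn (2 * n) Q) := by
    intro P Q
    rw [segment_eq_image', segment_eq_image', image_image]
    refine image_congr fun t _ => ?_
    refine space_ext ?_ ?_ ?_ <;> simp [turn] <;> ring
  have hcorner : ∀ p : Fin 4, corners p =
      ((edgeMidpoints p).1 - (edgeMidpoints p).2, (edgeMidpoints p).1 + (edgeMidpoints p).2) := by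
    intro p; fin_cases p <;> rfl
  simp only [strandCurve]
  rw [image_union, hseg, hseg]
  congr 2 <;> (refine space_ext ?_ ?_ ?_ <;> simp [turn, hcorner] <;> ring)

/-- The square that is filled by the turned square `q`. -/
def turnedSquare (n : ℤ) (q : ℤ × ℤ) : ℤ × ℤ := (q.1 - q.2, q.1 + q.2 - n)

/-- The square that is filled by the turned square around the lower right corner of `q`. -/
def turnedVertex (n : ℤ) (q : ℤ × ℤ) : ℤ × ℤ := (q.1 - q.2 + 1, q.1 + q.2 - n)

/-- The corner connection tiles after a push of the run and a turn. -/
def turnedTile (T : ℤ × ℤ → Tile) (X₁ X₂ Y n : ℤ) (r : ℤ × ℤ) : Tile :=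
  -- The sum `r.1 + r.2 + n` is `2 * q.1` for a turned square and `2 * q.1 + 1` for a turned vertex,
  -- so its parity separates the two kinds.
  if (r.1 + r.2 + n) % 2 = 0 then
    if X₁ ≤ (r.1 + r.2 + n) / 2 ∧ (r.1 + r.2 + n) / 2 ≤ X₂ ∧ (r.2 + n - r.1) / 2 = Y then .blank
    else T ((r.1 + r.2 + n) / 2, (r.2 + n - r.1) / 2)
  else if X₁ ≤ (r.1 + r.2 + n) / 2 ∧ (r.1 + r.2 + n) / 2 < X₂ ∧ (r.2 + n - r.1 + 1) / 2 = Y then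
    .line false
  else .blank

section
variable (T : ℤ × ℤ → Tile) {X₁ X₂ Y : ℤ} (n : ℤ)

theorem turnedTile_turnedSquare {q : ℤ × ℤ} (hq : q ∉ runSquares X₁ X₂ Y) :
    turnedTile T X₁ X₂ Y n (turnedSquare n q) = T q := by
  have h1 : (turnedSquare n q).1 + (turnedSquare n q).2 + n = 2 * q.1 := by
    simp only [turnedSquare]; ring
  have h2 : (turnedSquare n q).2 + n - (turnedSquare n q).1 = 2 * q.2 := by
    simp only [turnedSquare]; ring
  unfold turnedTile
  rw [h1, h2, if_pos (by omega), Int.mul_ediv_cancel_left _ two_ne_zero,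
    Int.mul_ediv_cancel_left _ two_ne_zero]
  exact if_neg hq

theorem turnedTile_turnedVertex {X : ℤ} (h1 : X₁ ≤ X) (h2 : X < X₂) :
    turnedTile T X₁ X₂ Y n (turnedVertex n (X, Y)) = .line false := by
  unfold turnedTile turnedVertex
  rw [if_neg (by simp only; omega), if_pos (by simp only; omega)]

variable {T n} in
theorem turnedTile_cases {r : ℤ × ℤ} (hr : turnedTile T X₁ X₂ Y n r ≠ .blank) :
    (∃ q, q ∉ runSquares X₁ X₂ Y ∧ r = turnedSquare n q) ∨
      ∃ X, X₁ ≤ X ∧ X < X₂ ∧ r = turnedVertex n (X, Y) := by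
  obtain ⟨a, b⟩ := r
  unfold turnedTile at hr
  simp only at hr
  split_ifs at hr with h1 h2 h2
  · exact absurd rfl hr
  · refine Or.inl ⟨((a + b + n) / 2, (b + n - a) / 2), h2, ?_⟩
    simp only [turnedSquare, Prod.mk.injEq]
    omega
  · refine Or.inr ⟨_, h2.1, h2.2.1, ?_⟩
    simp only [turnedVertex, Prod.mk.injEq]
    omega
  · exact absurd rfl hr

theorem turnedSquare_corner (q : ℤ × ℤ) (p : Fin 4) :
    turnedSquare n (q + edgeMidpoints p) ≠ turnedSquare n q ∧
      2 • turnedSquare n q + corners p =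
        2 • turnedSquare n (q + edgeMidpoints p) + corners (p + 2) := by
  obtain ⟨a, b⟩ := q
  fin_cases p <;> simp [turnedSquare, edgeMidpoints, corners] <;> omega

variable {T} in
/-- The turned tiles form a mosaic. -/
theorem TopRun.turned_closed (hT : Closed T) (h : TopRun T X₁ X₂ Y) {r : ℤ × ℤ} {p : Fin 4}
    (hp : (turnedTile T X₁ X₂ Y n r).HasEnd p) :
    ∃ r' p', r' ≠ r ∧ (turnedTile T X₁ X₂ Y n r').HasEnd p' ∧
      2 • r + corners p = 2 • r' + corners p' := by
  have hlt := h.lt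
  rcases turnedTile_cases hp.ne_blank with ⟨q, hq, rfl⟩ | ⟨X, h1, h2, rfl⟩
  · rw [turnedTile_turnedSquare T n hq] at hp
    have hp' := hT q p hp
    by_cases hq' : q + edgeMidpoints p ∈ runSquares X₁ X₂ Y
    · obtain ⟨a, b⟩ := q
      obtain ⟨m1, m2, m3⟩ := hq'
      simp only [Prod.fst_add, Prod.snd_add] at m1 m2 m3
      have hnot : ¬ (X₁ ≤ a ∧ a ≤ X₂ ∧ b = Y) := hq
      have hsq : (a, b) + edgeMidpoints p = (a + (edgeMidpoints p).1, Y) :=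
        Prod.ext rfl m3
      rw [hsq] at hp'
      -- The run has no outward ends besides the lower ends of its two arcs, so the rest can only
      -- meet it from below, at its first or last square.
      have hp1 : p = 1 ∧ (a = X₁ ∨ a = X₂) := by
        rcases m1.eq_or_lt with e | m1
        · rw [← e, h.left, Tile.hasEnd_arc] at hp'
          fin_cases p <;> simp [edgeMidpoints] at hp' m1 m2 m3 e ⊢ <;> omega
        · rcases m2.eq_or_lt with e | m2
          · rw [e, h.right, Tile.hasEnd_arc] at hp'
            fin_cases p <;> simp [edgeMidpoints] at hp' m1 m2 m3 e ⊢ <;> omega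
          · rw [h.between _ m1 m2, Tile.hasEnd_line_false] at hp'
            fin_cases p <;> simp [edgeMidpoints] at hp' m1 m2 m3 ⊢ <;> omega
      obtain ⟨rfl, rfl | rfl⟩ := hp1
      · refine ⟨turnedVertex n (a, Y), 2, ?_, ?_, ?_⟩
        · simp [edgeMidpoints] at m3
          simp [turnedVertex, turnedSquare]; omega
        · rw [turnedTile_turnedVertex T n le_rfl hlt, Tile.hasEnd_line_false]; right; rfl
        · simp [edgeMidpoints] at m3
          simp [turnedVertex, turnedSquare, corners]; omega
      · refine ⟨turnedVertex n (a - 1, Y), 0, ?_, ?_, ?_⟩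
        · simp [edgeMidpoints] at m3
          simp [turnedVertex, turnedSquare]; omega
        · rw [turnedTile_turnedVertex T n (by omega) (by omega), Tile.hasEnd_line_false]
          left; rfl
        · simp [edgeMidpoints] at m3
          simp [turnedVertex, turnedSquare, corners]; omega
    · obtain ⟨c1, c2⟩ := turnedSquare_corner n q p
      exact ⟨_, p + 2, c1, by rwa [turnedTile_turnedSquare T n hq'], c2⟩
  · have hbelow : ∀ X, (T (X, Y)).HasEnd 3 → (T (X, Y - 1)).HasEnd 1 := fun X hX => by
      have := hT _ _ hX
      rwa [show ((X, Y) + edgeMidpoints 3 : ℤ × ℤ) = (X, Y - 1) by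
        simp [edgeMidpoints, sub_eq_add_neg]] at this
    have hnot : ∀ X, (X, Y - 1) ∉ runSquares X₁ X₂ Y := fun X hX => by
      have := hX.2.2
      simp only at this
      omega
    rw [turnedTile_turnedVertex T n h1 h2, Tile.hasEnd_line_false] at hp
    rcases hp with rfl | rfl
    · rcases (show X + 1 ≤ X₂ by omega).eq_or_lt with rfl | h3
      · refine ⟨turnedSquare n (X + 1, Y - 1), 1, ?_, ?_, ?_⟩
        · simp [turnedVertex, turnedSquare]; omega
        · rw [turnedTile_turnedSquare T n (hnot _)]
          refine hbelow _ ?_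
          rw [h.right, Tile.hasEnd_arc]; right; rfl
        · simp [turnedVertex, turnedSquare, corners]; omega
      · refine ⟨turnedVertex n (X + 1, Y), 2, ?_, ?_, ?_⟩
        · simp [turnedVertex]
        · rw [turnedTile_turnedVertex T n (by omega) h3, Tile.hasEnd_line_false]; right; rfl
        · simp [turnedVertex, corners]; omega
    · rcases h1.eq_or_lt with rfl | h3
      · refine ⟨turnedSquare n (X₁, Y - 1), 1, ?_, ?_, ?_⟩
        · simp [turnedVertex, turnedSquare]
        · rw [turnedTile_turnedSquare T n (hnot _)]
          refine hbelow _ ?_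
          rw [h.left, Tile.hasEnd_arc]; left; rfl
        · simp [turnedVertex, turnedSquare, corners]; omega
      · refine ⟨turnedVertex n (X - 1, Y), 0, ?_, ?_, ?_⟩
        · simp [turnedVertex]
        · rw [turnedTile_turnedVertex T n (by omega) (by omega), Tile.hasEnd_line_false]
          left; rfl
        · simp [turnedVertex, corners]; omega

end

/-- The array of turned tiles. -/
def turnedArray {n : ℕ} (M : TileArray n) (X₁ X₂ Y : ℤ) : TileArray (2 * n) :=
  fun t => turnedTile (planeTile M) X₁ X₂ Y n (GridPath.square t)

theorem bounds_of_planeTile {n : ℕ} {M : TileArray n} {q : ℤ × ℤ}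
    (h : planeTile M q ≠ .blank) : 0 ≤ q.1 ∧ q.1 < n ∧ q.2 ≤ 0 ∧ -(n : ℤ) < q.2 := by
  obtain ⟨t, rfl⟩ := exists_square_of_planeTile h
  have := t.1.2
  have := t.2.2
  simp only [GridPath.square]
  omega

/-! ### The turned array and its number of tiles -/

section
variable {n : ℕ} {M : TileArray n} {X₁ X₂ Y : ℤ}

/-- The turn doubles the extent in both directions; the shift by `n` brings the rows into the range
of a `2 * n` array. -/
theorem TopRun.exists_square (h : TopRun (planeTile M) X₁ X₂ Y) {r : ℤ × ℤ}
    (hr : turnedTile (planeTile M) X₁ X₂ Y n r ≠ .blank) :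
    ∃ t : Fin (2 * n) × Fin (2 * n), GridPath.square t = r := by
  have key : 0 ≤ r.1 ∧ r.1 < 2 * n ∧ r.2 ≤ 0 ∧ -(2 * n : ℤ) < r.2 := by
    rcases turnedTile_cases hr with ⟨q, hq, rfl⟩ | ⟨X, h1, h2, rfl⟩
    · rw [turnedTile_turnedSquare _ _ hq] at hr
      obtain ⟨b1, b2, b3, b4⟩ := bounds_of_planeTile hr
      simp only [turnedSquare]
      omega
    · obtain ⟨b1, b2, b3, b4⟩ := bounds_of_planeTile (M := M) (q := (X₁, Y)) (by rw [h.left]; simp)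
      obtain ⟨c1, c2, c3, c4⟩ := bounds_of_planeTile (M := M) (q := (X₂, Y)) (by rw [h.right]; simp)
      simp only [turnedVertex]
      simp only at b1 b2 b3 b4 c1 c2 c3 c4
      omega
  exact GridPath.exists_square key.1 (by push_cast; exact key.2.1) key.2.2.1
    (by push_cast; exact key.2.2.2)

theorem TopRun.isMosaic (hT : Closed (planeTile M)) (h : TopRun (planeTile M) X₁ X₂ Y) :
    IsMosaic corners (turnedArray M X₁ X₂ Y) := by
  rintro t x ⟨p, hp, rfl⟩
  obtain ⟨r', p', hr', hp', e⟩ := h.turned_closed n hT hp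
  obtain ⟨s, rfl⟩ := h.exists_square hp'.ne_blank
  refine ⟨s, fun e => hr' (by rw [e]), p', hp', ?_⟩
  rw [GridPath.centre_eq, GridPath.centre_eq, e]

theorem TopRun.curve_turnedArray (h : TopRun (planeTile M) X₁ X₂ Y) :
    curve corners (turnedArray M X₁ X₂ Y) = turn (2 * (n : ℤ)) ''
      ((⋃ q ∈ (runSquares X₁ X₂ Y)ᶜ, ⋃ s ∈ (planeTile M q).strands,
        strandCurve edgeMidpoints (2 • q) s) ∪
        ⋃ X : ℤ, ⋃ _ : X₁ ≤ X ∧ X < X₂,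
          strandCurve edgeMidpoints (2 * X + 1, 2 * Y - 1) ⟨0, 2, false⟩) := by
  simp_rw [image_union, image_iUnion]
  have e1 : ∀ q s, turn (2 * (n : ℤ)) '' strandCurve edgeMidpoints (2 • q) s =
      strandCurve corners (2 • turnedSquare n q) s := by
    rintro ⟨a, b⟩ s
    rw [Prod.smul_mk, turn_image_strandCurve]
    congr 1
    simp [turnedSquare]
    constructor <;> ring
  have e2 : ∀ X s, turn (2 * (n : ℤ)) '' strandCurve edgeMidpoints (2 * X + 1, 2 * Y - 1) s =
      strandCurve corners (2 • turnedVertex n (X, Y)) s := by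
    intro X s
    rw [turn_image_strandCurve]
    congr 1
    simp [turnedVertex]
    constructor <;> ring
  simp_rw [e1, e2]
  ext x
  simp only [curve, mem_union, mem_iUnion, exists_prop, GridPath.centre_eq]
  constructor
  · rintro ⟨t, s, hs, hx⟩
    have hb : turnedArray M X₁ X₂ Y t ≠ .blank := fun e => by
      rw [e] at hs; simp [Tile.strands] at hs
    unfold turnedArray at hs hb
    rcases turnedTile_cases hb with ⟨q, hq, e⟩ | ⟨X, h1, h2, e⟩
    · rw [e, turnedTile_turnedSquare _ _ hq] at hs
      rw [e] at hx
      exact Or.inl ⟨q, hq, s, hs, hx⟩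
    · rw [e, turnedTile_turnedVertex _ _ h1 h2] at hs
      simp only [Tile.strands, List.mem_cons, List.not_mem_nil, or_false] at hs
      rw [e, hs] at hx
      exact Or.inr ⟨X, ⟨h1, h2⟩, hx⟩
  · rintro (⟨q, hq, s, hs, hx⟩ | ⟨X, ⟨h1, h2⟩, hx⟩)
    · rw [← turnedTile_turnedSquare (planeTile M) n hq] at hs
      obtain ⟨t, ht⟩ := h.exists_square (r := turnedSquare n q) (fun e => by
        rw [e] at hs; simp [Tile.strands] at hs)
      refine ⟨t, s, ?_, ?_⟩
      · rwa [turnedArray, ht]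
      · rwa [ht]
    · have e := turnedTile_turnedVertex (planeTile M) (Y := Y) n h1 h2
      obtain ⟨t, ht⟩ := h.exists_square (r := turnedVertex n (X, Y)) (by rw [e]; simp)
      refine ⟨t, ⟨0, 2, false⟩, ?_, ?_⟩
      · rw [turnedArray, ht, e]; exact List.mem_cons_self
      · rwa [ht]

/-- Each new non-blank tile is charged to an old one: a turned square to itself, the turned vertex
of column `X` to the run tile of column `X`. Whether the old tile lies in the run tells the two
kinds apart, so this is injective; the last tile of the run is never charged. -/
theorem TopRun.tileCount_lt (h : TopRun (planeTile M) X₁ X₂ Y) :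
    tileCount (turnedArray M X₁ X₂ Y) < tileCount M := by
  classical
  have hex : ∀ t, turnedArray M X₁ X₂ Y t ≠ .blank → ∃ t' : Fin n × Fin n, M t' ≠ .blank ∧
      GridPath.square t' ≠ (X₂, Y) ∧
      (GridPath.square t' ∉ runSquares X₁ X₂ Y ∧
        GridPath.square t = turnedSquare n (GridPath.square t') ∨
      GridPath.square t' ∈ runSquares X₁ X₂ Y ∧
        GridPath.square t = turnedVertex n (GridPath.square t')) := by
    intro t ht
    unfold turnedArray at ht
    rcases turnedTile_cases ht with ⟨q, hq, e⟩ | ⟨X, h1, h2, e⟩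
    · rw [e, turnedTile_turnedSquare _ _ hq] at ht
      obtain ⟨t', rfl⟩ := exists_square_of_planeTile ht
      rw [planeTile_square] at ht
      refine ⟨t', ht, fun e' => hq ?_, Or.inl ⟨hq, e⟩⟩
      rw [e']
      exact ⟨h.lt.le, le_rfl, rfl⟩
    · have hb : planeTile M (X, Y) ≠ .blank := by
        rcases h1.eq_or_lt with rfl | h1
        · rw [h.left]; simp
        · rw [h.between X h1 h2]; simp
      obtain ⟨t', ht'⟩ := exists_square_of_planeTile hb
      refine ⟨t', ?_, ?_, Or.inr ⟨?_, ?_⟩⟩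
      · rwa [← ht', planeTile_square] at hb
      · rw [ht']
        simp [h2.ne]
      · rw [ht']
        exact ⟨h1, h2.le, rfl⟩
      · rw [ht', e]
  obtain ⟨t₂, ht₂⟩ := exists_square_of_planeTile (M := M) (q := (X₂, Y)) (by rw [h.right]; simp)
  have hmem : t₂ ∈ Finset.univ.filter fun t => M t ≠ Tile.blank := by
    rw [Finset.mem_filter, ← planeTile_square M, ht₂, h.right]
    simp
  have : Nonempty (Fin n × Fin n) := ⟨t₂⟩
  choose! f hf using hex
  refine lt_of_le_of_lt ?_ (Finset.card_erase_lt_of_mem hmem)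
  refine Finset.card_le_card_of_injOn f (fun t ht => ?_) fun t ht t' ht' e => ?_
  · have ht := (Finset.mem_filter.1 ht).2
    obtain ⟨f1, f2, -⟩ := hf t ht
    refine Finset.mem_erase.2 ⟨fun e => f2 (by rw [e, ht₂]), Finset.mem_filter.2 ⟨Finset.mem_univ _, f1⟩⟩
  · obtain ⟨-, -, f3⟩ := hf t (Finset.mem_filter.1 ht).2
    obtain ⟨-, -, f3'⟩ := hf t' (Finset.mem_filter.1 ht').2
    rw [← e] at f3'
    refine GridPath.square_injective ?_
    rcases f3 with ⟨g, g'⟩ | ⟨g, g'⟩ <;> rcases f3' with ⟨k, k'⟩ | ⟨k, k'⟩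
    · rw [g', k']
    · exact absurd k g
    · exact absurd g k
    · rw [g', k']

end

/-- A nonempty mosaic of traditional tiles can be replaced by a mosaic of corner connection tiles
with fewer tiles. -/
theorem exists_corner_mosaic {n : ℕ} {M : TileArray n} (hM : IsMosaic edgeMidpoints M)
    (hne : (curve edgeMidpoints M).Nonempty) : ∃ M' : TileArray (2 * n), IsMosaic corners M' ∧
      AmbientIsotopic (curve edgeMidpoints M) (curve corners M') ∧ tileCount M' < tileCount M := by
  have hT := hM.closed
  obtain ⟨X₁, X₂, Y, h⟩ := hT.exists_topRun
    ((finite_range (GridPath.square (n := n))).subset fun q hq => exists_square_of_planeTile hq) (by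
      obtain ⟨x, hx⟩ := hne
      simp only [curve_eq_iUnion, mem_iUnion] at hx
      obtain ⟨q, s, hs, -⟩ := hx
      exact ⟨q, fun e => by rw [e] at hs; simp [Tile.strands] at hs⟩)
  refine ⟨turnedArray M X₁ X₂ Y, h.isMosaic hT, ?_, h.tileCount_lt⟩
  rw [h.curve_turnedArray, curve_eq_iUnion]
  exact (h.ambientIsotopic hT).trans (ambientIsotopic_turn _ _)

/-! ### Comparison of the tile numbers -/

theorem AmbientIsotopic.nonempty {K L : Set Space} (h : AmbientIsotopic K L) (hK : K.Nonempty) :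
    L.Nonempty := by
  obtain ⟨H, -, -, rfl⟩ := h
  exact hK.image _

theorem IsLink.tileNumber_lt {K : Set Space} (hK : IsLink K) :
    cornerTileNumber K < traditionalTileNumber K ∧ traditionalTileNumber K < ⊤ := by
  obtain ⟨hne, n, M, hM, hiso⟩ := hK.exists_mosaic
  -- Since some mosaic exists, the infimum in the well-ordered `ℕ∞` is attained, and the trade is
  -- applied to a minimal mosaic.
  obtain ⟨n', M', hM', hiso', he⟩ := csInf_mem (s := {m : ℕ∞ | ∃ (n : ℕ) (M : TileArray n),
    IsMosaic edgeMidpoints M ∧ AmbientIsotopic K (curve edgeMidpoints M) ∧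
      m = (tileCount M : ℕ∞)}) ⟨_, n, M, hM, hiso, rfl⟩
  change traditionalTileNumber K = _ at he
  obtain ⟨M'', hM'', hiso'', hlt⟩ := exists_corner_mosaic hM' (hiso'.nonempty hne)
  rw [he]
  refine ⟨lt_of_le_of_lt (sInf_le ⟨_, M'', hM'', hiso'.trans hiso'', rfl⟩) ?_, ?_⟩
  · exact_mod_cast hlt
  · exact ENat.natCast_lt_top _

end KnotMosaic

end

theorem theorem4p1 (K : Set KnotMosaic.Space)
    (hK : KnotMosaic.IsKnot K ∨ (KnotMosaic.IsLink K ∧ ¬ KnotMosaic.IsSplit K)) :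
    KnotMosaic.cornerTileNumber K < KnotMosaic.traditionalTileNumber K ∧
      KnotMosaic.traditionalTileNumber K < ⊤ := by
  rcases hK with hK | ⟨hK, -⟩
  · exact KnotMosaic.IsLink.tileNumber_lt ⟨1, le_rfl, hK⟩
  · exact KnotMosaic.IsLink.tileNumber_lt hK
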